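/- **Definitions.** Languages are sets of binary strings. A language $L$ is in $\mathrm{NP}$ if there are a polynomial-time computable predicate $V$ and a polynomial $q$ such that $x\in L$ iff $V(x,w)$ accepts for some $w$ with $|w|\le q(|x|)$; $L$ is NP-complete if it is in $\mathrm{NP}$ and every language in $\mathrm{NP}$ has a polynomial-time many-one reduction to it. A 3CNF formula is a conjunction of clauses, each the OR of at most three literals. A verifier is a probabilistic polynomial-time Turing machine $V$ with oracle access to a witness string $w$; it is $(r(n),q(n))$-restricted if on every input $x$ of length $n$, for every $w$ and all outcomes of the coin tosses, it uses at most $r(n)$ random bits and makes at most $q(n)$ queries to $w$. $L\in\mathrm{PCP}[r(n),q(n)]$ if some $(r(n),q(n))$-restricted verifier $V$ satisfies: if $x\in L$, then for some $w$ the probability that $V^w(x)$ accepts is $1$; if $x\notin L$, then for every $w$ it is at most $1/2$. $\mathrm{PCP}[O(\log n),O(1)]$ is the union of $\mathrm{PCP}[r(n),q(n)]$ over all $r(n)=O(\log n)$ and $q(n)=O(1)$. **Theorem 3 (converse: gap reduction implies PCP).** There is an absolute constant $C$ such that the following holds. Let $L\in\mathrm{NP}$ and $\varepsilon_1>0$,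 and suppose that there is a polynomial-time computable map $x\mapsto\varphi_x$ from binary strings to 3CNF formulas such that - if $x\in L$, then $\varphi_x$ is satisfiable; - if $x\notin L$, then $\varphi_x$ has $m\ge 1$ clauses and no assignment satisfies more than $(1-\varepsilon_1)m$ of them. Then $L\in\mathrm{PCP}[r(n),q(n)]$ for some $r(n)=O(\log n)$ and some $q(n)\le C/\varepsilon_1$; in particular $L\in\mathrm{PCP}[O(\log n),O(1)]$. If moreover $L$ is NP-complete, then the PCP Theorem holds, that is, $\mathrm{NP}=\mathrm{PCP}[O(\log n),O(1)]$. -/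

import Mathlib

open Turing Computability

namespace Complexity

/-! ### Polynomial time, NP, reductions -/

/-- `f` is computable in polynomial time by a (multi-stack) Turing machine, with respect to the
given representations of inputs and outputs as strings. -/
def PolyTimeComputable {α β αΓ βΓ : Type} (ea : α → List αΓ) (eb : β → List βΓ) (f : α → β) :
    Prop :=
  Nonempty (TM2ComputableInPolyTime ea eb f)

/-- A pair of binary strings, written as a single string over the four-letter alphabet
`Bool ⊕ Bool`. -/
def encodePair : List Bool × List Bool → List (Bool ⊕ Bool) :=
  (encodingProd (encodingList Bool) (encodingList Bool)).encode

/-- The class NP: languages with polynomial-time checkable witnesses of polynomial length. -/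
def NP : Set (Language Bool) :=
  {L | ∃ V : List Bool × List Bool → Bool, PolyTimeComputable encodePair encodeBool V ∧
    ∃ q : Polynomial ℕ, ∀ x : List Bool,
      x ∈ L ↔ ∃ w : List Bool, w.length ≤ q.eval x.length ∧ V (x, w) = true}

/-- Polynomial-time many-one reducibility `L₁ ≤ₘ L₂`. -/
def ReducesTo (L₁ L₂ : Language Bool) : Prop :=
  ∃ f : List Bool → List Bool, PolyTimeComputable id id f ∧ ∀ x, x ∈ L₁ ↔ f x ∈ L₂

def NPHard (A : Language Bool) : Prop :=
  ∀ L ∈ NP, ReducesTo L A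

def NPComplete (A : Language Bool) : Prop :=
  NPHard A ∧ A ∈ NP

/-! ### 3CNF formulas -/

/-- A literal: the variable with number `var`, negated if `pos` is `false`. -/
structure Literal where
  var : ℕ
  pos : Bool

/-- The truth value of a literal under an assignment. -/
def Literal.eval (a : ℕ → Bool) (l : Literal) : Bool :=
  a l.var == l.pos

/-- A clause, read as the OR of its literals. -/
abbrev Clause := List Literal

/-- The truth value of a clause under an assignment. -/
def Clause.eval (a : ℕ → Bool) (c : Clause) : Bool :=
  c.any (Literal.eval a)

/-- A 3CNF formula: a conjunction of clauses (possibly repeated), each of which is the OR of at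
most three literals. -/
structure ThreeCNF where
  clauses : List Clause
  length_le_three : ∀ c ∈ clauses, c.length ≤ 3

namespace ThreeCNF

/-- The number of clauses. -/
def numClauses (φ : ThreeCNF) : ℕ :=
  φ.clauses.length

/-- The number of clauses satisfied by the assignment `a`. -/
def numSat (φ : ThreeCNF) (a : ℕ → Bool) : ℕ :=
  φ.clauses.countP (Clause.eval a)

def Satisfiable (φ : ThreeCNF) : Prop :=
  ∃ a : ℕ → Bool, ∀ c ∈ φ.clauses, Clause.eval a c = true

end ThreeCNF

/-! Formulas as binary strings. The string is built from two-bit symbols: `[true, b]` is the data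
bit `b`, `[false, true]` ends a literal and `[false, false]` ends a clause. -/

def encodeDataBits (l : List Bool) : List Bool :=
  l.flatMap fun b => [true, b]

/-- The sign of the literal, then the number of its variable in binary (least significant bit
first), then the end mark. -/
def Literal.encode (l : Literal) : List Bool :=
  encodeDataBits (l.pos :: Nat.bits l.var) ++ [false, true]

def Clause.encode (c : Clause) : List Bool :=
  c.flatMap Literal.encode ++ [false, false]

def ThreeCNF.encode (φ : ThreeCNF) : List Bool :=
  φ.clauses.flatMap Clause.encode

theorem encodeDataBits_append_inj :
    ∀ {l l' : List Bool} {c c' : Bool} {s s' : List Bool},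
      encodeDataBits l ++ (false :: c :: s) = encodeDataBits l' ++ (false :: c' :: s') →
        l = l' ∧ c = c' ∧ s = s'
  | [], [], _, _, _, _, h => by simpa [encodeDataBits] using h
  | [], _ :: _, _, _, _, _, h => by simp [encodeDataBits] at h
  | _ :: _, [], _, _, _, _, h => by simp [encodeDataBits] at h
  | b :: l, b' :: l', _, _, _, _, h => by
      simp only [encodeDataBits, List.flatMap_cons, List.cons_append, List.nil_append,
        List.cons.injEq, true_and] at h
      have h₂ := encodeDataBits_append_inj (l := l) (l' := l') h.2
      exact ⟨by rw [h.1, h₂.1], h₂.2⟩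

theorem Literal.encode_append_inj {l l' : Literal} {s s' : List Bool}
    (h : l.encode ++ s = l'.encode ++ s') : l = l' ∧ s = s' := by
  have h := encodeDataBits_append_inj (by simpa [Literal.encode] using h)
  obtain ⟨v, p⟩ := l
  obtain ⟨v', p'⟩ := l'
  obtain ⟨h₁, -, h₂⟩ := h
  have h₁ : p = p' ∧ v.bits = v'.bits := by simpa using h₁
  have hv : v = v' := by
    have := congrArg (fun l => Nat.ofDigits 2 (l.map fun b : Bool => cond b 1 0)) h₁.2
    simpa [← Nat.digits_two_eq_bits, Nat.ofDigits_digits] using this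
  exact ⟨by rw [hv, h₁.1], h₂⟩

theorem Clause.encode_append_inj :
    ∀ {c c' : Clause} {s s' : List Bool},
      Clause.encode c ++ s = Clause.encode c' ++ s' → c = c' ∧ s = s'
  | [], [], _, _, h => by simpa [Clause.encode] using h
  | [], _ :: _, _, _, h => by simp [Clause.encode, Literal.encode, encodeDataBits] at h
  | _ :: _, [], _, _, h => by simp [Clause.encode, Literal.encode, encodeDataBits] at h
  | l :: c, l' :: c', _, _, h => by
      have h₁ := Literal.encode_append_inj (l := l) (l' := l')
        (by simpa only [Clause.encode, List.flatMap_cons, List.append_assoc] using h)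
      have h₂ := Clause.encode_append_inj (c := c) (c' := c')
        (by simpa only [Clause.encode, List.append_assoc] using h₁.2)
      simp [h₁.1, h₂]

/-- Distinct formulas are represented by distinct strings. -/
theorem ThreeCNF.encode_injective : Function.Injective ThreeCNF.encode := by
  have key : ∀ cs cs' : List Clause,
      cs.flatMap Clause.encode = cs'.flatMap Clause.encode → cs = cs' := by
    intro cs
    induction cs with
    | nil =>
      intro cs' h
      cases cs' with
      | nil => rfl
      | cons c cs' => simp [Clause.encode] at h
    | cons c cs ih =>
      intro cs' h
      cases cs' with
      | nil => simp [Clause.encode] at h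
      | cons c' cs' =>
        have h := Clause.encode_append_inj
          (by simpa only [List.flatMap_cons] using h)
        rw [h.1, ih _ h.2]
  rintro ⟨cs, _⟩ ⟨cs', _⟩ h
  obtain rfl := key cs cs' h
  rfl

/-- `f` is a polynomial-time reduction from `L` to Max 3SAT with a satisfiable versus
`(1 - ε)`-satisfiable gap: members of `L` go to satisfiable formulas, and non-members go to
formulas with `m ≥ 1` clauses of which no assignment satisfies more than `(1 - ε) m`. -/
def IsGapReduction (L : Language Bool) (ε : ℝ) (f : List Bool → ThreeCNF) : Prop :=
  PolyTimeComputable id ThreeCNF.encode f ∧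
  ∀ x : List Bool,
    (x ∈ L → (f x).Satisfiable) ∧
    (x ∉ L → 1 ≤ (f x).numClauses ∧
      ∀ a : ℕ → Bool, ((f x).numSat a : ℝ) ≤ (1 - ε) * (f x).numClauses)

/-! ### Probabilistic machines with oracle access to a witness -/

/-- What happens when control reaches a program label: an ordinary step, a coin toss, or a query to
the witness. -/
inductive LabelKind
  | plain
  | toss
  | query

/-- A probabilistic oracle Turing machine: a multi-stack machine, the stack `k₀` holding the input
and the stack `k₁` serving as the query stack, in which some of the program labels are coin-tossing
labels and some are query labels. -/
structure OracleTM where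
  /-- stacks, labels, internal states and program -/
  tm : FinTM2
  inputAlphabet : tm.Γ tm.k₀ ≃ Bool
  queryAlphabet : tm.Γ tm.k₁ ≃ Bool
  kind : tm.Λ → LabelKind
  /-- how a random bit, or the answer to a query, enters the internal state -/
  receive : Bool → tm.σ → tm.σ
  /-- the internal states in which halting means accepting -/
  accept : tm.σ → Bool

namespace OracleTM

/-- A configuration, with the numbers of coins tossed and of queries made so far. -/
structure Cfg (M : OracleTM) where
  cfg : TM2.Cfg M.tm.Γ M.tm.Λ M.tm.σ
  coins : ℕ
  queries : ℕ

/-- The position written on the query stack, in binary, least significant bit on top. -/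
def queryPosition (M : OracleTM) (s : List (M.tm.Γ M.tm.k₁)) : ℕ :=
  Nat.ofDigits 2 (s.map fun a => (M.queryAlphabet a).toNat)

/-- One step, with witness `w` and random bits `R 0, R 1, …`. At a toss label the next random bit
is received, at a query label the bit of `w` at the position written on the query stack is received
(`false` beyond the end of `w`) and the query stack is erased; then the statement at that label is
executed. A halted configuration stays as it is. -/
def step (M : OracleTM) (w : List Bool) (R : ℕ → Bool) (c : M.Cfg) : M.Cfg :=
  match c.cfg.l with
  | none => c
  | some l =>
    match M.kind l with
    | .plain => ⟨TM2.stepAux (M.tm.m l) c.cfg.var c.cfg.stk, c.coins, c.queries⟩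
    | .toss =>
      ⟨TM2.stepAux (M.tm.m l) (M.receive (R c.coins) c.cfg.var) c.cfg.stk,
        c.coins + 1, c.queries⟩
    | .query =>
      ⟨TM2.stepAux (M.tm.m l)
          (M.receive (w.getD (M.queryPosition (c.cfg.stk M.tm.k₁)) false) c.cfg.var)
          (Function.update c.cfg.stk M.tm.k₁ []),
        c.coins, c.queries + 1⟩

/-- The configuration after `t` steps on input `x`. -/
def run (M : OracleTM) (x w : List Bool) (R : ℕ → Bool) (t : ℕ) : M.Cfg :=
  (M.step w R)^[t] ⟨initList M.tm (x.map M.inputAlphabet.symm), 0, 0⟩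

/-- The machine halts on every input `x`, whatever the witness and the random bits, within a number
of steps polynomial in the length of `x`. -/
def IsPolyTime (M : OracleTM) : Prop :=
  ∃ p : Polynomial ℕ, ∀ (x w : List Bool) (R : ℕ → Bool),
    (M.run x w R (p.eval x.length)).cfg.l = none

/-- On every input of length `n`, whatever the witness and the random bits, the machine tosses at
most `r n` coins and makes at most `q n` queries. -/
def IsRestricted (M : OracleTM) (r q : ℕ → ℕ) : Prop :=
  ∀ (x w : List Bool) (R : ℕ → Bool) (t : ℕ),
    (M.run x w R t).coins ≤ r x.length ∧ (M.run x w R t).queries ≤ q x.length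

/-- The machine halts in an accepting state. -/
def Accepts (M : OracleTM) (x w : List Bool) (R : ℕ → Bool) : Prop :=
  ∃ t, (M.run x w R t).cfg.l = none ∧ M.accept (M.run x w R t).cfg.var = true

/-- A finite string of random bits, padded to an infinite sequence. -/
def padBits {k : ℕ} (R : Fin k → Bool) : ℕ → Bool :=
  fun i => if h : i < k then R ⟨i, h⟩ else false

open Classical in
/-- The probability that `M` accepts, over a uniformly random string of `k` bits (used where the
machine tosses at most `k` coins). -/
noncomputable def acceptProb (M : OracleTM) (k : ℕ) (x w : List Bool) : ℝ :=
  (Finset.univ.filter fun R : Fin k → Bool => M.Accepts x w (padBits R)).card / (2 : ℝ) ^ k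

end OracleTM

/-- The class `PCP[r(n), q(n)]`. -/
def PCP (r q : ℕ → ℕ) : Set (Language Bool) :=
  {L | ∃ V : OracleTM, V.IsPolyTime ∧ V.IsRestricted r q ∧
    ∀ x : List Bool,
      (x ∈ L → ∃ w, V.acceptProb (r x.length) x w = 1) ∧
      (x ∉ L → ∀ w, V.acceptProb (r x.length) x w ≤ 1 / 2)}

/-- `r(n) = O(log n)`. -/
def IsBigOLog (r : ℕ → ℕ) : Prop :=
  (fun n => (r n : ℝ)) =O[Filter.atTop] fun n : ℕ => Real.log n

/-- `q(n) = O(1)`. -/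
def IsBigOOne (q : ℕ → ℕ) : Prop :=
  (fun n => (q n : ℝ)) =O[Filter.atTop] fun _ : ℕ => (1 : ℝ)

/-- The class `PCP[O(log n), O(1)]`. -/
def PCPLogConst : Set (Language Bool) :=
  {L | ∃ r q : ℕ → ℕ, IsBigOLog r ∧ IsBigOOne q ∧ L ∈ PCP r q}

end Complexity

/-! A gap reduction turns a language `L` into a probabilistically checkable one: the verifier
computes `φ_x`, reads the oracle as an assignment, and tests random clauses.

Clauses are picked with fair coins by halving: the clauses that are left are dealt alternately into
two halves, a coin decides which half is kept, and this goes on until at most one clause is left.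
After at most `⌈log₂ m⌉` coins every one of the `m` clauses is found with probability at least
`1 / (2 m)`, so if a fraction `ε` of the clauses is false, one trial rejects with probability at
least `ε / 2`. After `⌈2 / ε⌉` trials, at three queries each, a bad oracle is accepted with
probability at most `1 / 2` (`prob_clauseTrials_le_half`), and there are at most `12 / ε` queries.
The machine `sampler` carries this out on the encoding of a formula (`sampler_run`); that the
encoding has polynomial length makes the number of coins logarithmic. `exists_precompose` puts a
polynomial-time function in front of an oracle machine, which gives `exists_PCP_of_isGapReduction`.

Precomposition also shows that `PCP[O(log n), O(1)]` is closed under reductions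
(`mem_PCPLogConst_of_reducesTo`), so if `L` is NP-hard, the class contains NP. For the other
inclusion (`mem_NP_of_mem_PCPLogConst`), an NP witness is a table of the answers of the oracle to
all queries that are made for some coin string; there are polynomially many coin strings, so the
table is short. A table always describes some oracle (`tableWord`), and hence the only thing to be
checked is that all coin strings lead to acceptance. If they do, the acceptance probability is `1`,
so that `x ∈ L` by soundness. The machine `checker` does this, running through the coin strings in
the order of `coinVal`: after a run that tossed the coins `u`, it goes on with the first string
after those that start with `u` (`nextCoins`), so that it need not know the number of coins in
advance. -/

namespace Complexity

/-! ### Stepping stack machines -/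

section Stepping

variable {K : Type} {Γ : K → Type} {Λ σ : Type}

theorem cfg_ext {c c' : TM2.Cfg Γ Λ σ} (hl : c.l = c'.l) (hv : c.var = c'.var)
    (hs : ∀ k, c.stk k = c'.stk k) : c = c' := by
  obtain ⟨l, v, S⟩ := c
  obtain ⟨l', v', S'⟩ := c'
  obtain rfl : l = l' := hl
  obtain rfl : v = v' := hv
  obtain rfl : S = S' := funext hs
  rfl

/-- The largest number of symbols that a statement pushes on its stacks. -/
def pushes : TM2.Stmt Γ Λ σ → ℕ
  | .push _ _ q => pushes q + 1
  | .peek _ _ q => pushes q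
  | .pop _ _ q => pushes q
  | .load _ q => pushes q
  | .branch _ q₁ q₂ => max (pushes q₁) (pushes q₂)
  | .goto _ => 0
  | .halt => 0

/-- The largest number of symbols pushed in one step by a program. -/
noncomputable def programPushes [Fintype Λ] (m : Λ → TM2.Stmt Γ Λ σ) : ℕ :=
  Finset.univ.sup fun l => pushes (m l)

theorem pushes_le_programPushes [Fintype Λ] (m : Λ → TM2.Stmt Γ Λ σ) (l : Λ) :
    pushes (m l) ≤ programPushes m :=
  Finset.le_sup (f := fun l => pushes (m l)) (Finset.mem_univ l)

variable [DecidableEq K]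

/-- The step function of a stack machine made total: a halted configuration stays as it is. -/
def totalStep (m : Λ → TM2.Stmt Γ Λ σ) (c : TM2.Cfg Γ Λ σ) : TM2.Cfg Γ Λ σ :=
  match c.l with
  | none => c
  | some l => TM2.stepAux (m l) c.var c.stk

theorem step_eq_ite (m : Λ → TM2.Stmt Γ Λ σ) (c : TM2.Cfg Γ Λ σ) :
    TM2.step m c = if c.l = none then none else some (totalStep m c) := by
  obtain ⟨_ | l, v, S⟩ := c <;> simp [TM2.step, totalStep]

theorem iterate_bind_none {α : Type} (f : α → Option α) (n : ℕ) :
    (flip bind f)^[n] none = none := by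
  induction n with
  | zero => rfl
  | succ n ih => rw [Function.iterate_succ_apply]; exact ih

theorem iterate_bind_succ {α : Type} (f : α → Option α) (n : ℕ) (a : α) :
    (flip bind f)^[n + 1] (some a) = (flip bind f)^[n] (f a) := by
  rw [Function.iterate_succ_apply]; rfl

/-- Iterating the partial step function through a simulation `e` of it by `F`. -/
theorem iterate_of_bind {α β : Type} {f : α → Option α} {F : β → β} {e : α → β}
    (h : ∀ a a', f a = some a' → F (e a) = e a') {n : ℕ} {a a' : α}
    (hn : (flip bind f)^[n] (some a) = some a') : F^[n] (e a) = e a' := by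
  induction n generalizing a with
  | zero => simpa using congrArg e (Option.some.inj hn)
  | succ n ih =>
    rw [iterate_bind_succ] at hn
    cases hf : f a with
    | none => rw [hf, iterate_bind_none] at hn; cases hn
    | some b =>
      rw [hf] at hn
      rw [Function.iterate_succ_apply, h a b hf, ih hn]

/-- A total run that ends in a halted configuration is a run of the partial step function. -/
theorem exists_evalsToInTime (m : Λ → TM2.Stmt Γ Λ σ) {n : ℕ} {c c' : TM2.Cfg Γ Λ σ}
    (h : (totalStep m)^[n] c = c') :
    Nonempty (StateTransition.EvalsToInTime (TM2.step m) c (some c') n) := by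
  induction n generalizing c with
  | zero => exact ⟨⟨⟨0, by simpa using h⟩, le_rfl⟩⟩
  | succ n ih =>
    by_cases hl : c.l = none
    · have hfix : totalStep m c = c := by
        obtain ⟨l, v, S⟩ := c
        obtain rfl : l = none := hl
        rfl
      rw [Function.iterate_fixed hfix] at h
      exact ⟨⟨⟨0, by simpa using h⟩, Nat.zero_le _⟩⟩
    · rw [Function.iterate_succ_apply] at h
      obtain ⟨⟨⟨s, hs⟩, hsn⟩⟩ := ih h
      refine ⟨⟨⟨s + 1, ?_⟩, Nat.succ_le_succ hsn⟩⟩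
      rw [iterate_bind_succ, step_eq_ite, if_neg hl]
      exact hs

theorem initList_stk (tm : FinTM2) (s : List (tm.Γ tm.k₀)) :
    (initList tm s).stk = Function.update (fun _ => []) tm.k₀ s := by
  funext k
  by_cases h : k = tm.k₀
  · subst h; simp [initList]
  · simp [initList, h]

theorem haltList_stk (tm : FinTM2) (s : List (tm.Γ tm.k₁)) :
    (haltList tm s).stk = Function.update (fun _ => []) tm.k₁ s := by
  funext k
  by_cases h : k = tm.k₁
  · subst h; simp [haltList]
  · simp [haltList, h]

theorem length_stepAux_le (q : TM2.Stmt Γ Λ σ) (v : σ) (S : ∀ k, List (Γ k)) (k : K) :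
    ((TM2.stepAux q v S).stk k).length ≤ (S k).length + pushes q := by
  induction q generalizing v S with
  | push k' f q ih =>
    refine (ih _ _).trans ?_
    by_cases h : k = k'
    · subst h; simp [pushes]; omega
    · simp [pushes, h]
  | peek k' f q ih => exact ih _ _
  | pop k' f q ih =>
    refine (ih _ _).trans ?_
    by_cases h : k = k'
    · subst h; simp [pushes]
    · simp [pushes, h]
  | load f q ih => exact ih _ _
  | branch f q₁ q₂ ih₁ ih₂ =>
    simp only [TM2.stepAux, pushes]
    cases f v
    · exact (ih₂ _ _).trans (by simp)
    · exact (ih₁ _ _).trans (by simp)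
  | goto f => simp [pushes]
  | halt => simp [pushes]

theorem length_totalStep_le [Fintype Λ] (m : Λ → TM2.Stmt Γ Λ σ) (c : TM2.Cfg Γ Λ σ) (k : K) :
    ((totalStep m c).stk k).length ≤ (c.stk k).length + programPushes m := by
  obtain ⟨_ | l, v, S⟩ := c
  · simp [totalStep]
  · exact (length_stepAux_le _ _ _ _).trans
      (Nat.add_le_add_left (pushes_le_programPushes m l) _)

theorem length_iterate_totalStep_le [Fintype Λ] (m : Λ → TM2.Stmt Γ Λ σ) (c : TM2.Cfg Γ Λ σ)
    (n : ℕ) (k : K) :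
    (((totalStep m)^[n] c).stk k).length ≤ (c.stk k).length + n * programPushes m := by
  induction n with
  | zero => simp
  | succ n ih =>
    rw [Function.iterate_succ_apply']
    refine (length_totalStep_le m _ k).trans ?_
    rw [Nat.succ_mul]
    omega

theorem stepAux_pop_cons {k : K} {S : ∀ k, List (Γ k)} {a : Γ k} {l : List (Γ k)}
    (h : S k = a :: l) (f : σ → Option (Γ k) → σ) (q : TM2.Stmt Γ Λ σ) (v : σ) :
    TM2.stepAux (.pop k f q) v S = TM2.stepAux q (f v (some a)) (Function.update S k l) := by
  simp only [TM2.stepAux, h, List.head?_cons, List.tail_cons]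

theorem stepAux_pop_nil {k : K} {S : ∀ k, List (Γ k)} (h : S k = [])
    (f : σ → Option (Γ k) → σ) (q : TM2.Stmt Γ Λ σ) (v : σ) :
    TM2.stepAux (.pop k f q) v S = TM2.stepAux q (f v none) (Function.update S k []) := by
  simp only [TM2.stepAux, h, List.head?_nil, List.tail_nil]

end Stepping

/-! ### Embedding one machine in another -/

section Lift

variable {K K' : Type} [DecidableEq K] [DecidableEq K'] {Γ' : K' → Type} {Λ Λ' σ σ' : Type}

/-- A statement of a machine carried over to a larger machine: the stacks are renamed by `ι`, the
internal state is the part `get s` of the larger state, the labels are renamed by `lab`, and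
instead of halting the statement `ex` is executed. -/
def liftStmt (ι : K → K') (get : σ' → σ) (set : σ' → σ → σ') (lab : Λ → Λ')
    (ex : TM2.Stmt Γ' Λ' σ') : TM2.Stmt (fun k => Γ' (ι k)) Λ σ → TM2.Stmt Γ' Λ' σ'
  | .push k f q => .push (ι k) (fun s => f (get s)) (liftStmt ι get set lab ex q)
  | .peek k f q => .peek (ι k) (fun s a => set s (f (get s) a)) (liftStmt ι get set lab ex q)
  | .pop k f q => .pop (ι k) (fun s a => set s (f (get s) a)) (liftStmt ι get set lab ex q)
  | .load f q => .load (fun s => set s (f (get s))) (liftStmt ι get set lab ex q)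
  | .branch p q₁ q₂ =>
    .branch (fun s => p (get s)) (liftStmt ι get set lab ex q₁) (liftStmt ι get set lab ex q₂)
  | .goto f => .goto fun s => lab (f (get s))
  | .halt => ex

/-- A configuration of the smaller machine seen in the larger one: `cv` and `cs` put the internal
state and the stacks of the smaller machine into their surroundings. -/
def liftCfg {ι : K → K'} (lab : Λ → Λ') (ex : TM2.Stmt Γ' Λ' σ') (cv : σ → σ')
    (cs : (∀ k, List (Γ' (ι k))) → ∀ k, List (Γ' k)) :
    TM2.Cfg (fun k => Γ' (ι k)) Λ σ → TM2.Cfg Γ' Λ' σ'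
  | ⟨some l, v, S⟩ => ⟨some (lab l), cv v, cs S⟩
  | ⟨none, v, S⟩ => TM2.stepAux ex (cv v) (cs S)

theorem stepAux_liftStmt {ι : K → K'} {get : σ' → σ} {set : σ' → σ → σ'} {lab : Λ → Λ'}
    {ex : TM2.Stmt Γ' Λ' σ'} {cv : σ → σ'} {cs : (∀ k, List (Γ' (ι k))) → ∀ k, List (Γ' k)}
    (hget : ∀ v, get (cv v) = v) (hset : ∀ v v', set (cv v) v' = cv v')
    (hcs : ∀ S k, cs S (ι k) = S k)
    (hupd : ∀ S k l, Function.update (cs S) (ι k) l = cs (Function.update S k l))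
    (q : TM2.Stmt (fun k => Γ' (ι k)) Λ σ) (v : σ) (S : ∀ k, List (Γ' (ι k))) :
    TM2.stepAux (liftStmt ι get set lab ex q) (cv v) (cs S) =
      liftCfg lab ex cv cs (TM2.stepAux q v S) := by
  induction q generalizing v S with
  | push k f q ih => simp only [liftStmt, TM2.stepAux, hget, hcs, hupd, ih]
  | peek k f q ih => simp only [liftStmt, TM2.stepAux, hget, hcs, hset, ih]
  | pop k f q ih => simp only [liftStmt, TM2.stepAux, hget, hcs, hset, hupd, ih]
  | load f q ih => simp only [liftStmt, TM2.stepAux, hget, hset, ih]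
  | branch p q₁ q₂ ih₁ ih₂ =>
    simp only [liftStmt, TM2.stepAux, hget]
    cases p v
    · exact ih₂ _ _
    · exact ih₁ _ _
  | goto f => simp only [liftStmt, TM2.stepAux, hget, liftCfg]
  | halt => rfl

end Lift

/-! ### Polynomial bounds -/

/-- `f` is bounded by a polynomial. -/
def PolyBounded (f : ℕ → ℕ) : Prop :=
  ∃ p : Polynomial ℕ, ∀ n, f n ≤ p.eval n

theorem eval_le_eval (p : Polynomial ℕ) {m n : ℕ} (h : m ≤ n) : p.eval m ≤ p.eval n := by
  rw [Polynomial.eval_eq_sum, Polynomial.eval_eq_sum]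
  exact Finset.sum_le_sum fun i _ => Nat.mul_le_mul_left _ (Nat.pow_le_pow_left h i)

namespace PolyBounded

theorem mono {f g : ℕ → ℕ} (hg : PolyBounded g) (h : ∀ n, f n ≤ g n) : PolyBounded f :=
  hg.imp fun _ hp n => (h n).trans (hp n)

theorem eval (p : Polynomial ℕ) : PolyBounded fun n => p.eval n := ⟨p, fun _ => le_rfl⟩

theorem const (c : ℕ) : PolyBounded fun _ => c := ⟨Polynomial.C c, by simp⟩

theorem id : PolyBounded fun n => n := ⟨Polynomial.X, by simp⟩

theorem add {f g : ℕ → ℕ} (hf : PolyBounded f) (hg : PolyBounded g) :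
    PolyBounded fun n => f n + g n := by
  obtain ⟨p, hp⟩ := hf
  obtain ⟨q, hq⟩ := hg
  exact ⟨p + q, fun n => by rw [Polynomial.eval_add]; exact Nat.add_le_add (hp n) (hq n)⟩

theorem mul {f g : ℕ → ℕ} (hf : PolyBounded f) (hg : PolyBounded g) :
    PolyBounded fun n => f n * g n := by
  obtain ⟨p, hp⟩ := hf
  obtain ⟨q, hq⟩ := hg
  exact ⟨p * q, fun n => by rw [Polynomial.eval_mul]; exact Nat.mul_le_mul (hp n) (hq n)⟩

theorem pow {f : ℕ → ℕ} (hf : PolyBounded f) (k : ℕ) : PolyBounded fun n => f n ^ k := by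
  obtain ⟨p, hp⟩ := hf
  exact ⟨p ^ k, fun n => by rw [Polynomial.eval_pow]; exact Nat.pow_le_pow_left (hp n) k⟩

/-- A polynomially bounded function is at most a power of `n + 2`. -/
theorem exists_le_pow {f : ℕ → ℕ} (hf : PolyBounded f) : ∃ d, ∀ n, f n ≤ (n + 2) ^ d := by
  obtain ⟨p, hp⟩ := hf
  refine (?_ : ∃ d, ∀ n, p.eval n ≤ (n + 2) ^ d).imp fun d hd n => (hp n).trans (hd n)
  clear hp
  induction p using Polynomial.induction_on' with
  | add p q hp hq =>
    obtain ⟨d, hd⟩ := hp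
    obtain ⟨e, he⟩ := hq
    refine ⟨d + e + 1, fun n => ?_⟩
    have h₁ : (n + 2) ^ d ≤ (n + 2) ^ (d + e) := Nat.pow_le_pow_right (by omega) (by omega)
    have h₂ : (n + 2) ^ e ≤ (n + 2) ^ (d + e) := Nat.pow_le_pow_right (by omega) (by omega)
    have h₃ : (n + 2) ^ (d + e) * 2 ≤ (n + 2) ^ (d + e) * (n + 2) :=
      Nat.mul_le_mul_left _ (by omega)
    rw [Polynomial.eval_add, pow_succ]
    have := hd n
    have := he n
    omega
  | monomial k c =>
    refine ⟨c + k, fun n => ?_⟩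
    rw [Polynomial.eval_monomial, pow_add]
    refine Nat.mul_le_mul ?_ (Nat.pow_le_pow_left (by omega) k)
    exact (Nat.lt_pow_self (by omega)).le

end PolyBounded

/-- A function is `O(log n)` if and only if it is bounded, for all `n`, by a multiple of the number
of binary digits needed below `n + 2`. -/
theorem isBigOLog_iff {r : ℕ → ℕ} : IsBigOLog r ↔ ∃ d, ∀ n, r n ≤ d * Nat.clog 2 (n + 2) := by
  have hpos : ∀ n, 1 ≤ Nat.clog 2 (n + 2) := fun n => Nat.clog_pos (by omega) (by omega)
  constructor
  · intro h
    obtain ⟨C, hC⟩ := h.bound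
    obtain ⟨n₀, hn₀⟩ := Filter.eventually_atTop.1 hC
    refine ⟨⌈|C|⌉₊ + (Finset.range n₀).sup r, fun n => ?_⟩
    by_cases hn : n < n₀
    · have h₁ : r n ≤ (Finset.range n₀).sup r := Finset.le_sup (f := r) (Finset.mem_range.2 hn)
      nlinarith [hpos n]
    · have h₁ := hn₀ n (not_lt.1 hn)
      have h₂ : Real.log n ≤ Nat.clog 2 (n + 2) := by
        rcases Nat.eq_zero_or_pos n with rfl | h0
        · simp
        have h₃ : (n : ℝ) ≤ (2 : ℝ) ^ Nat.clog 2 (n + 2) := by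
          have := Nat.le_pow_clog (b := 2) (by omega) (n + 2)
          exact_mod_cast (by omega : n ≤ 2 ^ Nat.clog 2 (n + 2))
        have h₄ := Real.log_le_log (by exact_mod_cast h0) h₃
        rw [Real.log_pow] at h₄
        have h₅ : Real.log 2 ≤ 1 := by linarith [Real.log_two_lt_d9]
        nlinarith [(Nat.cast_nonneg (Nat.clog 2 (n + 2)) : (0 : ℝ) ≤ _)]
      have h₆ : (0 : ℝ) ≤ Real.log n := Real.log_natCast_nonneg n
      rw [Real.norm_of_nonneg (Nat.cast_nonneg _), Real.norm_of_nonneg h₆] at h₁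
      have h₇ : (r n : ℝ) ≤ ⌈|C|⌉₊ * Nat.clog 2 (n + 2) :=
        calc (r n : ℝ) ≤ C * Real.log n := h₁
          _ ≤ ⌈|C|⌉₊ * Real.log n :=
            mul_le_mul_of_nonneg_right ((le_abs_self C).trans (Nat.le_ceil _)) h₆
          _ ≤ _ := mul_le_mul_of_nonneg_left h₂ (Nat.cast_nonneg _)
      have h₈ : r n ≤ ⌈|C|⌉₊ * Nat.clog 2 (n + 2) := by exact_mod_cast h₇
      rw [Nat.add_mul]
      omega
  · rintro ⟨d, hd⟩
    refine Asymptotics.IsBigO.of_bound (d * 6) (Filter.eventually_atTop.2 ⟨2, fun n hn => ?_⟩)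
    have hlog2 : (0.69 : ℝ) < Real.log 2 := by linarith [Real.log_two_gt_d9]
    have hn' : Real.log 2 ≤ Real.log n := Real.log_le_log (by norm_num) (by exact_mod_cast hn)
    have h₆ : (0 : ℝ) ≤ Real.log n := by linarith
    rw [Real.norm_of_nonneg (Nat.cast_nonneg _), Real.norm_of_nonneg h₆]
    have h₁ : (r n : ℝ) ≤ d * Nat.clog 2 (n + 2) := by exact_mod_cast hd n
    have h₂ : (Nat.clog 2 (n + 2) : ℝ) ≤ 6 * Real.log n := by
      have h₃ := Nat.pow_pred_clog_lt_self (b := 2) (by omega) (x := n + 2) (by omega)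
      have h₄ : (2 : ℝ) ^ (Nat.clog 2 (n + 2) - 1) ≤ (n : ℝ) ^ 2 := by
        have : n + 2 ≤ n ^ 2 := by nlinarith
        exact_mod_cast h₃.le.trans this
      have h₅ := Real.log_le_log (by positivity) h₄
      rw [Real.log_pow, Real.log_pow, Nat.cast_sub (hpos n)] at h₅
      push_cast at h₅
      have h₇ : (1 : ℝ) ≤ Nat.clog 2 (n + 2) := by exact_mod_cast hpos n
      nlinarith
    calc (r n : ℝ) ≤ d * Nat.clog 2 (n + 2) := h₁
      _ ≤ d * (6 * Real.log n) := mul_le_mul_of_nonneg_left h₂ (Nat.cast_nonneg _)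
      _ = _ := by ring

/-- The logarithm of a polynomially bounded function is `O(log n)`. -/
theorem exists_clog_le {f : ℕ → ℕ} (hf : PolyBounded f) :
    ∃ d, ∀ n, Nat.clog 2 (f n) ≤ d * Nat.clog 2 (n + 2) := by
  obtain ⟨d, hd⟩ := hf.exists_le_pow
  refine ⟨d, fun n => Nat.clog_le_of_le_pow ((hd n).trans ?_)⟩
  rw [mul_comm, pow_mul]
  exact Nat.pow_le_pow_left (Nat.le_pow_clog (by omega) _) d

/-- Two to a power that is `O(log n)` is polynomially bounded. -/
theorem polyBounded_two_pow {r : ℕ → ℕ} {d : ℕ} (h : ∀ n, r n ≤ d * Nat.clog 2 (n + 2)) :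
    PolyBounded fun n => 2 ^ r n := by
  refine (((PolyBounded.const 2).mul (PolyBounded.id.add (PolyBounded.const 2))).pow d).mono
    fun n => ?_
  refine (Nat.pow_le_pow_right (by omega) (h n)).trans ?_
  rw [mul_comm, pow_mul]
  refine Nat.pow_le_pow_left ?_ d
  have h₁ := Nat.pow_pred_clog_lt_self (b := 2) (by omega) (x := n + 2) (by omega)
  have h₂ : 1 ≤ Nat.clog 2 (n + 2) := Nat.clog_pos (by omega) (by omega)
  have h₃ : 2 ^ Nat.clog 2 (n + 2) = 2 * 2 ^ (Nat.clog 2 (n + 2) - 1) := by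
    rw [← pow_succ']; congr 1
  rw [Nat.pred_eq_sub_one] at h₁
  rw [h₃]
  omega

/-! ### Runs of oracle machines -/

namespace OracleTM

variable (M : OracleTM) (x w : List Bool) (R : ℕ → Bool)

theorem run_succ (t : ℕ) : M.run x w R (t + 1) = M.step w R (M.run x w R t) :=
  Function.iterate_succ_apply' _ _ _

section

variable {M} {l : M.tm.Λ} (v : M.tm.σ) (S : ∀ k, List (M.tm.Γ k)) (a b : ℕ)

theorem step_plain (h : M.kind l = .plain) :
    M.step w R ⟨⟨some l, v, S⟩, a, b⟩ = ⟨TM2.stepAux (M.tm.m l) v S, a, b⟩ := by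
  simp only [step, h]

theorem step_toss (h : M.kind l = .toss) :
    M.step w R ⟨⟨some l, v, S⟩, a, b⟩ =
      ⟨TM2.stepAux (M.tm.m l) (M.receive (R a) v) S, a + 1, b⟩ := by
  simp only [step, h]

theorem step_query (h : M.kind l = .query) :
    M.step w R ⟨⟨some l, v, S⟩, a, b⟩ =
      ⟨TM2.stepAux (M.tm.m l) (M.receive (w.getD (M.queryPosition (S M.tm.k₁)) false) v)
        (Function.update S M.tm.k₁ []), a, b + 1⟩ := by
  simp only [step, h]

end

theorem step_of_halted {c : M.Cfg} (h : c.cfg.l = none) : M.step w R c = c := by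
  obtain ⟨⟨l, v, S⟩, a, b⟩ := c
  obtain rfl : l = none := h
  rfl

theorem iterate_of_halted {c : M.Cfg} (h : c.cfg.l = none) (n : ℕ) : (M.step w R)^[n] c = c :=
  Function.iterate_fixed (M.step_of_halted w R h) n

theorem run_eq_of_halted {s t : ℕ} (hst : s ≤ t) (h : (M.run x w R s).cfg.l = none) :
    M.run x w R t = M.run x w R s := by
  obtain ⟨n, rfl⟩ := Nat.exists_eq_add_of_le' hst
  rw [run, Function.iterate_add_apply]
  exact M.iterate_of_halted w R h n

theorem le_coins_step (c : M.Cfg) : c.coins ≤ (M.step w R c).coins := by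
  unfold step; split
  · exact le_rfl
  · split <;> simp

theorem le_queries_step (c : M.Cfg) : c.queries ≤ (M.step w R c).queries := by
  unfold step; split
  · exact le_rfl
  · split <;> simp

theorem monotone_coins : Monotone fun t => (M.run x w R t).coins :=
  monotone_nat_of_le_succ fun t => by rw [run_succ]; exact M.le_coins_step w R _

theorem monotone_queries : Monotone fun t => (M.run x w R t).queries :=
  monotone_nat_of_le_succ fun t => by rw [run_succ]; exact M.le_queries_step w R _

/-- A run depends only on the coins that it tosses. -/
theorem run_congr {R R' : ℕ → Bool} {t : ℕ} (h : ∀ i < (M.run x w R t).coins, R i = R' i) :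
    M.run x w R' t = M.run x w R t := by
  induction t with
  | zero => rfl
  | succ t ih =>
    rw [run_succ] at h
    rw [run_succ, run_succ, ih fun i hi => h i (hi.trans_le (M.le_coins_step w R _))]
    unfold step at h ⊢
    split
    · rfl
    · next l hl =>
      simp only [hl] at h
      split
      · rfl
      · next hk =>
        simp only [hk] at h
        rw [h _ (Nat.lt_succ_self _)]
      · rfl

theorem accepts_iff_of_halted {T : ℕ} (h : (M.run x w R T).cfg.l = none) :
    M.Accepts x w R ↔ M.accept (M.run x w R T).cfg.var = true := by
  refine ⟨fun ⟨t, ht, ha⟩ => ?_, fun ha => ⟨T, h, ha⟩⟩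
  rcases le_total t T with hle | hle
  · rwa [M.run_eq_of_halted x w R hle ht]
  · rwa [← M.run_eq_of_halted x w R hle h]

/-- If the machine tosses at most `k` coins, acceptance depends on the first `k` random bits. -/
theorem accepts_congr {k : ℕ} (hk : ∀ R t, (M.run x w R t).coins ≤ k) {R R' : ℕ → Bool}
    (h : ∀ i < k, R i = R' i) : M.Accepts x w R ↔ M.Accepts x w R' := by
  have : ∀ t, M.run x w R' t = M.run x w R t := fun t =>
    M.run_congr x w fun i hi => h i (hi.trans_le (hk R t))
  simp only [Accepts, this]

/-- The largest number of symbols that the machine pushes on its stacks in one step. -/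
noncomputable def stackGrowth : ℕ :=
  @programPushes _ _ _ _ M.tm.ΛFin M.tm.m

theorem length_stk_step_le (c : M.Cfg) (k : M.tm.K) :
    ((M.step w R c).cfg.stk k).length ≤ (c.cfg.stk k).length + M.stackGrowth := by
  obtain ⟨⟨_ | l, v, S⟩, a, b⟩ := c
  · exact Nat.le_add_right _ _
  · have h : ∀ v' S', (S' k).length ≤ (S k).length →
        ((TM2.stepAux (M.tm.m l) v' S').stk k).length ≤ (S k).length + M.stackGrowth :=
      fun v' S' hS => (length_stepAux_le _ _ _ _).trans
        (Nat.add_le_add hS (@pushes_le_programPushes _ _ _ _ M.tm.ΛFin M.tm.m l))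
    cases hk : M.kind l
    · rw [M.step_plain w R v S a b hk]
      exact h _ _ le_rfl
    · rw [M.step_toss w R v S a b hk]
      exact h _ _ le_rfl
    · rw [M.step_query w R v S a b hk]
      refine h _ _ ?_
      by_cases h' : k = M.tm.k₁
      · subst h'; simp
      · simp [h']

theorem length_stk_run_le (t : ℕ) (k : M.tm.K) :
    ((M.run x w R t).cfg.stk k).length ≤ x.length + t * M.stackGrowth := by
  induction t with
  | zero =>
    change ((initList M.tm (x.map M.inputAlphabet.symm)).stk k).length ≤ _
    rw [initList_stk]
    by_cases h : k = M.tm.k₀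
    · subst h; simp
    · simp [h]
  | succ t ih =>
    rw [M.run_succ]
    refine (M.length_stk_step_le w R _ k).trans ?_
    rw [Nat.add_mul t 1, Nat.one_mul]
    omega

end OracleTM

/-! ### Probabilities over finitely many coin tosses -/

/-- The random bits that start with `b` and go on with `R`. -/
def consBit (b : Bool) (R : ℕ → Bool) : ℕ → Bool
  | 0 => b
  | i + 1 => R i

theorem padBits_cons {k : ℕ} (b : Bool) (R : Fin k → Bool) :
    OracleTM.padBits (Fin.cons b R : Fin (k + 1) → Bool) = consBit b (OracleTM.padBits R) := by
  funext i
  cases i with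
  | zero => rfl
  | succ i =>
    by_cases h : i < k
    · simp only [OracleTM.padBits, consBit, h, Nat.succ_lt_succ h, dif_pos]
      exact Fin.cons_succ (α := fun _ => Bool) b R ⟨i, h⟩
    · simp [OracleTM.padBits, consBit, h]

open Classical in
/-- The probability of an event over `k` uniformly random bits. -/
noncomputable def bitProb (k : ℕ) (P : (ℕ → Bool) → Prop) : ℝ :=
  (Finset.univ.filter fun R : Fin k → Bool => P (OracleTM.padBits R)).card / (2 : ℝ) ^ k

theorem acceptProb_eq_bitProb (M : OracleTM) (k : ℕ) (x w : List Bool) :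
    M.acceptProb k x w = bitProb k (M.Accepts x w) := rfl

/-- Conditioning on the first random bit. -/
theorem bitProb_succ (k : ℕ) (P : (ℕ → Bool) → Prop) :
    bitProb (k + 1) P =
      (bitProb k (fun R => P (consBit false R)) + bitProb k (fun R => P (consBit true R))) / 2 := by
  classical
  have key : (Finset.univ.filter fun R : Fin (k + 1) → Bool => P (OracleTM.padBits R)).card =
      (Finset.univ.filter fun R : Fin k → Bool => P (consBit false (OracleTM.padBits R))).card +
      (Finset.univ.filter fun R : Fin k → Bool => P (consBit true (OracleTM.padBits R))).card := by
    simp only [Finset.card_filter]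
    rw [← Equiv.sum_comp (Fin.consEquiv fun _ : Fin (k + 1) => Bool), Fintype.sum_prod_type,
      Fintype.sum_bool, add_comm]
    simp only [Fin.consEquiv, Equiv.coe_fn_mk, padBits_cons]
  unfold bitProb
  have h : ((Finset.univ.filter fun R : Fin (k + 1) → Bool => P (OracleTM.padBits R)).card : ℝ) =
      (Finset.univ.filter fun R : Fin k → Bool => P (consBit false (OracleTM.padBits R))).card +
      (Finset.univ.filter fun R : Fin k → Bool => P (consBit true (OracleTM.padBits R))).card := by
    exact_mod_cast key
  rw [pow_succ]
  have h2 : (2 : ℝ) ^ k ≠ 0 := by positivity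
  field_simp
  convert h using 2

theorem bitProb_of_forall {k : ℕ} {P : (ℕ → Bool) → Prop} (h : ∀ R, P R) : bitProb k P = 1 := by
  simp [bitProb, h]

theorem bitProb_of_forall_not {k : ℕ} {P : (ℕ → Bool) → Prop} (h : ∀ R, ¬ P R) :
    bitProb k P = 0 := by
  simp [bitProb, h]

theorem forall_of_bitProb_eq_one {k : ℕ} {P : (ℕ → Bool) → Prop} (h : bitProb k P = 1)
    (R : Fin k → Bool) : P (OracleTM.padBits R) := by
  classical
  unfold bitProb at h
  rw [div_eq_one_iff_eq (by positivity)] at h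
  have hcard : (Finset.univ.filter fun R : Fin k → Bool => P (OracleTM.padBits R)).card =
      Fintype.card (Fin k → Bool) := by
    rw [Fintype.card_fun, Fintype.card_bool, Fintype.card_fin]
    have : ((Finset.univ.filter fun R : Fin k → Bool => P (OracleTM.padBits R)).card : ℝ) =
        ((2 ^ k : ℕ) : ℝ) := by
      push_cast
      convert h using 2
    exact_mod_cast this
  have := Finset.filter_card_eq (hcard.trans Finset.card_univ.symm) R (Finset.mem_univ R)
  exact this

theorem padBits_of_lt {k i : ℕ} (hi : i < k) (R : ℕ → Bool) :
    OracleTM.padBits (fun j : Fin k => R j) i = R i := by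
  simp [OracleTM.padBits, hi]

/-- The probability of an event that depends on the first `c` bits only may be computed with any
number `k ≥ c` of bits. -/
theorem bitProb_eq_of_le {c k : ℕ} (hck : c ≤ k) {P : (ℕ → Bool) → Prop}
    (hP : ∀ R R' : ℕ → Bool, (∀ i < c, R i = R' i) → (P R ↔ P R')) :
    bitProb k P = bitProb c P := by
  induction c generalizing k P with
  | zero =>
    by_cases h : P fun _ => false
    · have : ∀ R, P R := fun R => (hP _ R (by simp)).1 h
      rw [bitProb_of_forall this, bitProb_of_forall this]
    · have : ∀ R, ¬ P R := fun R hR => h ((hP _ R (by simp)).2 hR)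
      rw [bitProb_of_forall_not this, bitProb_of_forall_not this]
  | succ c ih =>
    obtain ⟨k, rfl⟩ : ∃ k', k = k' + 1 := ⟨k - 1, by omega⟩
    have h : ∀ b, ∀ R R' : ℕ → Bool, (∀ i < c, R i = R' i) →
        (P (consBit b R) ↔ P (consBit b R')) := by
      intro b R R' hR
      refine hP _ _ fun i hi => ?_
      cases i with
      | zero => rfl
      | succ i => exact hR i (by omega)
    rw [bitProb_succ, bitProb_succ, ih (by omega) (h false), ih (by omega) (h true)]

/-- A probabilistic computation whose outcome is a bit: either the outcome is there, or a coin is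
tossed and the computation goes on according to it. -/
inductive CoinTree
  | leaf (b : Bool)
  | node (next : Bool → CoinTree)

namespace CoinTree

/-- The outcome for the given random bits. -/
def eval : CoinTree → (ℕ → Bool) → Bool
  | leaf b, _ => b
  | node next, R => (next (R 0)).eval fun i => R (i + 1)

/-- The largest number of coins tossed. -/
def depth : CoinTree → ℕ
  | leaf _ => 0
  | node next => max (next false).depth (next true).depth + 1

/-- The probability of the outcome `true`. -/
noncomputable def prob : CoinTree → ℝ
  | leaf b => if b then 1 else 0
  | node next => ((next false).prob + (next true).prob) / 2

theorem bitProb_eval (T : CoinTree) {k : ℕ} (h : T.depth ≤ k) :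
    bitProb k (fun R => T.eval R = true) = T.prob := by
  induction T generalizing k with
  | leaf b => cases b <;> simp [eval, prob, bitProb]
  | node next ih =>
    simp only [depth] at h
    obtain ⟨k, rfl⟩ : ∃ k', k = k' + 1 := ⟨k - 1, by omega⟩
    rw [bitProb_succ, prob, ← ih false (k := k) (by omega), ← ih true (k := k) (by omega)]
    rfl

end CoinTree

/-! ### Composing a polynomial-time function with an oracle machine -/

section Precompose

variable (A : FinTM2) (ei : A.Γ A.k₀ ≃ Bool) (eo : A.Γ A.k₁ ≃ Bool) (V : OracleTM)

/-- The stacks of the composite machine: those of `A`, those of `V`, and one on which the output of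
`A` is turned over before it becomes the input of `V`. -/
abbrev CompStacks : A.K ⊕ (V.tm.K ⊕ Unit) → Type :=
  Sum.elim A.Γ (Sum.elim V.tm.Γ fun _ => Bool)

/-- The labels of the composite machine: those of `A`, those of `V`, and one for each of the two
loops that hand the output of `A` over to `V`. -/
abbrev CompLabels : Type := A.Λ ⊕ (V.tm.Λ ⊕ Bool)

/-- The internal states of the composite machine, with a register for the symbol being moved. -/
abbrev CompState : Type := A.σ × V.tm.σ × Option Bool

/-- The program of the composite machine. -/
def compProgram : CompLabels A V → TM2.Stmt (CompStacks A V) (CompLabels A V) (CompState A V)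
  | .inl l =>
    liftStmt (Γ' := CompStacks A V) (σ := A.σ) Sum.inl (fun s => s.1) (fun s a => (a, s.2)) Sum.inl
      (.goto fun _ => .inr (.inr false)) (A.m l)
  | .inr (.inl l) =>
    liftStmt (Γ' := CompStacks A V) (σ := V.tm.σ) (fun k => Sum.inr (Sum.inl k)) (fun s => s.2.1)
      (fun s v => (s.1, v, s.2.2)) (fun l => Sum.inr (Sum.inl l)) .halt (V.tm.m l)
  | .inr (.inr false) =>
    .pop (.inl A.k₁) (fun s a => (s.1, s.2.1, a.map eo)) <|
    .branch (fun s => s.2.2.isSome)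
      (.push (.inr (.inr ())) (fun s => s.2.2.getD false) <| .goto fun _ => .inr (.inr false))
      (.goto fun _ => .inr (.inr true))
  | .inr (.inr true) =>
    .pop (.inr (.inr ())) (fun s a => (s.1, s.2.1, a)) <|
    .branch (fun s => s.2.2.isSome)
      (.push (.inr (.inl V.tm.k₀)) (fun s => V.inputAlphabet.symm (s.2.2.getD false)) <|
        .goto fun _ => .inr (.inr true))
      (.goto fun _ => .inr (.inl V.tm.main))

/-- The oracle machine that runs `A` and then `V` on the output of `A`. -/
def compMachine : OracleTM where
  tm :=
    { K := A.K ⊕ (V.tm.K ⊕ Unit)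
      kFin := by
        haveI := A.kFin
        haveI := V.tm.kFin
        infer_instance
      k₀ := .inl A.k₀
      k₁ := .inr (.inl V.tm.k₁)
      Γ := CompStacks A V
      Λ := CompLabels A V
      main := .inl A.main
      ΛFin := by
        haveI := A.ΛFin
        haveI := V.tm.ΛFin
        infer_instance
      σ := CompState A V
      initialState := (A.initialState, V.tm.initialState, none)
      σFin := by
        haveI := A.σFin
        haveI := V.tm.σFin
        infer_instance
      Γk₀Fin := A.Γk₀Fin
      m := compProgram A eo V }
  inputAlphabet := ei
  queryAlphabet := V.queryAlphabet
  kind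
    | .inr (.inl l) => V.kind l
    | _ => .plain
  receive b s := (s.1, V.receive b s.2.1, s.2.2)
  accept s := V.accept s.2.1

variable {A V}

/-- The stacks of the composite machine, given those of its parts. -/
def compStk (S : ∀ k, List (A.Γ k)) (S' : ∀ k, List (V.tm.Γ k)) (b : List Bool) :
    ∀ k, List (CompStacks A V k)
  | .inl k => S k
  | .inr (.inl k) => S' k
  | .inr (.inr _) => b

theorem compStk_update_inl (S : ∀ k, List (A.Γ k)) (S' : ∀ k, List (V.tm.Γ k)) (b : List Bool)
    (k : A.K) (l : List (A.Γ k)) :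
    Function.update (compStk S S' b) (.inl k) l = compStk (Function.update S k l) S' b := by
  funext k'
  rcases k' with k' | k' | k'
  · by_cases h : k' = k
    · subst h
      exact (Function.update_self _ _ _).trans
        (Function.update_self k' l S).symm
    · exact (Function.update_of_ne (by simpa using h) _ _).trans
        (Function.update_of_ne h _ _).symm
  · rfl
  · rfl

theorem compStk_update_inr (S : ∀ k, List (A.Γ k)) (S' : ∀ k, List (V.tm.Γ k)) (b : List Bool)
    (k : V.tm.K) (l : List (V.tm.Γ k)) :
    Function.update (compStk S S' b) (.inr (.inl k)) l = compStk S (Function.update S' k l) b := by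
  funext k'
  rcases k' with k' | k' | k'
  · rfl
  · by_cases h : k' = k
    · subst h
      exact (Function.update_self _ _ _).trans
        (Function.update_self k' l S').symm
    · exact (Function.update_of_ne (by simpa using h) _ _).trans
        (Function.update_of_ne h _ _).symm
  · rfl

theorem compStk_update_buffer (S : ∀ k, List (A.Γ k)) (S' : ∀ k, List (V.tm.Γ k))
    (b l : List Bool) :
    Function.update (compStk S S' b) (.inr (.inr ())) l = compStk S S' l := by
  funext k'
  rcases k' with k' | k' | k' <;> rfl

variable (A V) (w : List Bool) (R : ℕ → Bool)

/-- A configuration of `A` inside the composite machine. -/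
def compFirst (c : A.Cfg) : (compMachine A ei eo V).Cfg :=
  ⟨⟨some (match c.l with
      | some l => .inl l
      | none => .inr (.inr false)), (c.var, V.tm.initialState, none),
    compStk c.stk (fun _ => []) []⟩, 0, 0⟩

/-- A configuration of `V` inside the composite machine. -/
def compSecond (c : V.Cfg) : (compMachine A ei eo V).Cfg :=
  ⟨⟨c.cfg.l.map fun l => .inr (.inl l), (A.initialState, c.cfg.var, none),
    compStk (fun _ => []) c.cfg.stk []⟩, c.coins, c.queries⟩

theorem compMachine_step_first (c c' : A.Cfg) (h : A.step c = some c') :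
    (compMachine A ei eo V).step w R (compFirst A ei eo V c) = compFirst A ei eo V c' := by
  obtain ⟨_ | l, v, S⟩ := c
  · cases h
  · obtain rfl : TM2.stepAux (A.m l) v S = c' := Option.some.inj h
    have key := stepAux_liftStmt (Γ' := CompStacks A V) (ι := Sum.inl)
      (get := fun s : CompState A V => s.1) (set := fun s a => (a, s.2))
      (lab := (Sum.inl : A.Λ → CompLabels A V)) (ex := .goto fun _ => .inr (.inr false))
      (cv := fun v => (v, V.tm.initialState, none)) (cs := fun S => compStk S (fun _ => []) [])
      (fun _ => rfl) (fun _ _ => rfl) (fun _ _ => rfl)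
      (fun S k l => compStk_update_inl S _ _ k l) (A.m l) v S
    have key' : ∀ c : A.Cfg, liftCfg (Γ' := CompStacks A V) (ι := Sum.inl)
        (Sum.inl : A.Λ → CompLabels A V) (.goto fun _ => .inr (.inr false))
        (fun v => (v, V.tm.initialState, none)) (fun S => compStk S (fun _ => []) []) c =
        (compFirst A ei eo V c).cfg := by
      rintro ⟨_ | l, v, S⟩ <;> rfl
    refine (OracleTM.step_plain (M := compMachine A ei eo V) _ _ _ _ _ _ rfl).trans ?_
    exact congrArg (fun c => (⟨c, 0, 0⟩ : (compMachine A ei eo V).Cfg)) (key.trans (key' _))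

theorem compMachine_step_second (c : V.Cfg) :
    (compMachine A ei eo V).step w R (compSecond A ei eo V c) =
      compSecond A ei eo V (V.step w R c) := by
  obtain ⟨⟨_ | l, v, S⟩, a, b⟩ := c
  · rfl
  · have key := fun (v : V.tm.σ) (S : ∀ k, List (V.tm.Γ k)) =>
      stepAux_liftStmt (Γ' := CompStacks A V) (ι := fun k => Sum.inr (Sum.inl k))
      (get := fun s : CompState A V => s.2.1) (set := fun s v => (s.1, v, s.2.2))
      (lab := fun l : V.tm.Λ => (Sum.inr (Sum.inl l) : CompLabels A V)) (ex := .halt)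
      (cv := fun v => (A.initialState, v, none)) (cs := fun S => compStk (fun _ => []) S [])
      (fun _ => rfl) (fun _ _ => rfl) (fun _ _ => rfl)
      (fun S k l => compStk_update_inr _ S _ k l) (V.tm.m l) v S
    have key' : ∀ c : V.tm.Cfg, liftCfg (Γ' := CompStacks A V) (ι := fun k => Sum.inr (Sum.inl k))
        (fun l : V.tm.Λ => (Sum.inr (Sum.inl l) : CompLabels A V)) .halt
        (fun v => (A.initialState, v, none)) (fun S => compStk (fun _ => []) S []) c =
        (compSecond A ei eo V ⟨c, 0, 0⟩).cfg := by
      rintro ⟨_ | l, v, S⟩ <;> rfl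
    have hstep : ∀ (v : V.tm.σ) (S : ∀ k, List (V.tm.Γ k)) (i j : ℕ),
        (⟨TM2.stepAux (compProgram A eo V (.inr (.inl l))) (A.initialState, v, none)
          (compStk (fun _ => []) S []), i, j⟩ : (compMachine A ei eo V).Cfg) =
        compSecond A ei eo V ⟨TM2.stepAux (V.tm.m l) v S, i, j⟩ := fun v S i j =>
      congrArg (fun c => (⟨c, i, j⟩ : (compMachine A ei eo V).Cfg)) ((key v S).trans (key' _))
    cases hk : V.kind l with
    | plain =>
      rw [OracleTM.step_plain _ _ _ _ _ _ hk, ← hstep]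
      exact OracleTM.step_plain (M := compMachine A ei eo V) _ _ _ _ _ _ hk
    | toss =>
      rw [OracleTM.step_toss _ _ _ _ _ _ hk, ← hstep]
      exact OracleTM.step_toss (M := compMachine A ei eo V) _ _ _ _ _ _ hk
    | query =>
      rw [OracleTM.step_query _ _ _ _ _ _ hk, ← hstep, ← compStk_update_inr]
      exact OracleTM.step_query (M := compMachine A ei eo V) _ _ _ _ _ _ hk

/-- A configuration of the composite machine before any coin toss or query. -/
def compCfg (c : TM2.Cfg (CompStacks A V) (CompLabels A V) (CompState A V)) :
    (compMachine A ei eo V).Cfg :=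
  ⟨c, 0, 0⟩

theorem compMachine_step_transfer (b : Bool) (s : CompState A V)
    (S : ∀ k, List (CompStacks A V k)) :
    (compMachine A ei eo V).step w R (compCfg A ei eo V ⟨some (.inr (.inr b)), s, S⟩) =
      compCfg A ei eo V (TM2.stepAux (compProgram A eo V (.inr (.inr b))) s S) :=
  OracleTM.step_plain (M := compMachine A ei eo V) (l := .inr (.inr b)) _ _ _ _ _ _ rfl

theorem compMachine_unload (s b : List Bool) (S : ∀ k, List (A.Γ k))
    (S' : ∀ k, List (V.tm.Γ k)) (hS : S A.k₁ = s.map eo.symm) (u : A.σ) (v : V.tm.σ)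
    (o : Option Bool) :
    ((compMachine A ei eo V).step w R)^[s.length + 1]
      (compCfg A ei eo V ⟨some (.inr (.inr false)), (u, v, o), compStk S S' b⟩) =
      compCfg A ei eo V ⟨some (.inr (.inr true)), (u, v, none),
        compStk (Function.update S A.k₁ []) S' (s.reverse ++ b)⟩ := by
  induction s generalizing S b o with
  | nil =>
    refine (compMachine_step_transfer A ei eo V w R _ _ _).trans (congrArg _ ?_)
    refine (stepAux_pop_nil (Γ := CompStacks A V) (S := compStk S S' b) (k := .inl A.k₁)
      hS _ _ _).trans ?_
    exact cfg_ext rfl rfl fun k => congrFun (compStk_update_inl S S' b A.k₁ []) k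
  | cons a s ih =>
    rw [List.length_cons, Function.iterate_succ_apply]
    have hstep : (compMachine A ei eo V).step w R
        (compCfg A ei eo V ⟨some (.inr (.inr false)), (u, v, o), compStk S S' b⟩) =
        compCfg A ei eo V ⟨some (.inr (.inr false)), (u, v, some a),
          compStk (Function.update S A.k₁ (s.map eo.symm)) S' (a :: b)⟩ := by
      refine (compMachine_step_transfer A ei eo V w R _ _ _).trans (congrArg _ ?_)
      refine (stepAux_pop_cons (Γ := CompStacks A V) (S := compStk S S' b) (k := .inl A.k₁)
        hS _ _ _).trans ?_
      have e := compStk_update_inl S S' b A.k₁ (s.map eo.symm)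
      have e' := compStk_update_buffer (Function.update S A.k₁ (s.map eo.symm)) S' b (a :: b)
      rw [← e] at e'
      have ha : eo (eo.symm a) = a := eo.apply_symm_apply a
      refine Eq.trans (b := ⟨_, (u, v, some (eo (eo.symm a))),
        Function.update (Function.update (compStk S S' b) (.inl A.k₁) (s.map eo.symm))
          (.inr (.inr ())) (show List Bool from eo (eo.symm a) :: b)⟩) rfl ?_
      rw [ha]
      exact cfg_ext rfl rfl fun k => congrFun e' k
    rw [hstep, ih _ _ (Function.update_self _ _ _), Function.update_idem]
    simp

theorem compMachine_load (s : List Bool) (S : ∀ k, List (A.Γ k))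
    (S' : ∀ k, List (V.tm.Γ k)) (u : A.σ) (v : V.tm.σ) (o : Option Bool) :
    ((compMachine A ei eo V).step w R)^[s.length + 1]
      (compCfg A ei eo V ⟨some (.inr (.inr true)), (u, v, o), compStk S S' s⟩) =
      compCfg A ei eo V ⟨some (.inr (.inl V.tm.main)), (u, v, none),
        compStk S
          (Function.update S' V.tm.k₀ (s.reverse.map V.inputAlphabet.symm ++ S' V.tm.k₀)) []⟩ := by
  induction s generalizing S' o with
  | nil =>
    refine (compMachine_step_transfer A ei eo V w R _ _ _).trans (congrArg _ ?_)
    refine (stepAux_pop_nil (Γ := CompStacks A V) (S := compStk S S' []) (k := .inr (.inr ()))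
      rfl _ _ _).trans ?_
    refine cfg_ext rfl rfl fun k => (congrFun (compStk_update_buffer S S' [] []) k).trans ?_
    rw [List.reverse_nil, List.map_nil, List.nil_append, Function.update_eq_self]
  | cons a s ih =>
    rw [List.length_cons, Function.iterate_succ_apply]
    have hstep : (compMachine A ei eo V).step w R
        (compCfg A ei eo V ⟨some (.inr (.inr true)), (u, v, o), compStk S S' (a :: s)⟩) =
        compCfg A ei eo V ⟨some (.inr (.inr true)), (u, v, some a),
          compStk S (Function.update S' V.tm.k₀ (V.inputAlphabet.symm a :: S' V.tm.k₀)) s⟩ := by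
      refine (compMachine_step_transfer A ei eo V w R _ _ _).trans (congrArg _ ?_)
      refine (stepAux_pop_cons (Γ := CompStacks A V) (S := compStk S S' (a :: s))
        (k := .inr (.inr ())) rfl _ _ _).trans ?_
      have e := compStk_update_buffer S S' (a :: s) s
      have e' := compStk_update_inr S S' s V.tm.k₀ (V.inputAlphabet.symm a :: S' V.tm.k₀)
      rw [← e] at e'
      exact cfg_ext rfl rfl fun k => congrFun e' k
    rw [hstep, ih, Function.update_idem, Function.update_self]
    simp

/-- After the hand-over, the composite machine behaves on `x` as `V` does on the output of `A`. -/
theorem compMachine_run {x y : List Bool} {n : ℕ}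
    (h : (flip bind A.step)^[n] (some (initList A (x.map ei.symm))) =
      some (haltList A (y.map eo.symm))) (t : ℕ) :
    (compMachine A ei eo V).run x w R (n + (y.length + 1) + (y.length + 1) + t) =
      compSecond A ei eo V (V.run y w R t) := by
  have hstart : (⟨initList (compMachine A ei eo V).tm (x.map ei.symm), 0, 0⟩ :
      (compMachine A ei eo V).Cfg) = compFirst A ei eo V (initList A (x.map ei.symm)) := by
    refine congrArg (fun c => (⟨c, 0, 0⟩ : (compMachine A ei eo V).Cfg)) ?_
    refine cfg_ext rfl rfl fun k => ?_
    refine (congrFun (initList_stk (compMachine A ei eo V).tm (x.map ei.symm)) k).trans ?_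
    change _ = compStk (initList A (x.map ei.symm)).stk (fun _ => []) [] k
    rw [initList_stk, ← compStk_update_inl]
    have hnil : (fun _ => [] : ∀ k, List (CompStacks A V k)) =
        compStk (fun _ => []) (fun _ => []) [] := by
      funext k'
      rcases k' with k' | k' | k' <;> rfl
    rw [← hnil]
    rfl
  have hsecond : ∀ c : V.Cfg, ((compMachine A ei eo V).step w R)^[t] (compSecond A ei eo V c) =
      compSecond A ei eo V ((V.step w R)^[t] c) := by
    induction t with
    | zero => intro c; rfl
    | succ t ih =>
      intro c
      rw [Function.iterate_succ_apply, Function.iterate_succ_apply, compMachine_step_second, ih]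
  have hfirst := iterate_of_bind (F := (compMachine A ei eo V).step w R)
    (e := compFirst A ei eo V) (fun c c' => compMachine_step_first A ei eo V w R c c') h
  have hhalt : compFirst A ei eo V (haltList A (y.map eo.symm)) =
      compCfg A ei eo V ⟨some (.inr (.inr false)), (A.initialState, V.tm.initialState, none),
        compStk (haltList A (y.map eo.symm)).stk (fun _ => []) []⟩ := rfl
  have hunload := compMachine_unload A ei eo V w R y [] (haltList A (y.map eo.symm)).stk
    (fun _ => []) (by rw [haltList_stk]; exact Function.update_self _ _ _) A.initialState
    V.tm.initialState none
  have hload := compMachine_load A ei eo V w R y.reverse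
    (Function.update (haltList A (y.map eo.symm)).stk A.k₁ []) (fun _ => []) A.initialState
    V.tm.initialState none
  have hlast : compCfg A ei eo V ⟨some (.inr (.inl V.tm.main)),
      (A.initialState, V.tm.initialState, none),
      compStk (Function.update (haltList A (y.map eo.symm)).stk A.k₁ [])
        (Function.update (fun _ => []) V.tm.k₀ (y.map V.inputAlphabet.symm)) []⟩ =
      compSecond A ei eo V ⟨initList V.tm (y.map V.inputAlphabet.symm), 0, 0⟩ := by
    refine congrArg (compCfg A ei eo V) (cfg_ext rfl rfl fun k => ?_)
    rw [haltList_stk, Function.update_idem, Function.update_eq_self]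
    change _ = compStk (fun _ => []) (initList V.tm (y.map V.inputAlphabet.symm)).stk [] k
    rw [initList_stk]
  rw [List.length_reverse, List.reverse_reverse, List.append_nil, hlast] at hload
  rw [List.append_nil] at hunload
  rw [hhalt] at hfirst
  unfold OracleTM.run
  rw [show n + (y.length + 1) + (y.length + 1) + t =
    t + ((y.length + 1) + ((y.length + 1) + n)) by omega, Function.iterate_add_apply _ t,
    Function.iterate_add_apply _ (y.length + 1) (y.length + 1 + n),
    Function.iterate_add_apply _ (y.length + 1) n, ← hsecond, ← hload, ← hunload, ← hfirst,
    ← hstart]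
  rfl

end Precompose

/-- A polynomial-time function `f` may be put before an oracle machine `V`. After a number of steps
that is polynomial in the input, the resulting machine does on `x` what `V` does on `f x`. -/
theorem exists_precompose {β : Type} {eb : β → List Bool} {f : List Bool → β}
    (hf : PolyTimeComputable id eb f) (V : OracleTM) :
    ∃ (V' : OracleTM) (p : Polynomial ℕ), ∀ x : List Bool,
      (eb (f x)).length ≤ p.eval x.length ∧
      ∃ t₀ ≤ p.eval x.length, ∀ (w : List Bool) (R : ℕ → Bool),
        (∀ t, ((V'.run x w R (t₀ + t)).cfg.l = none ↔ (V.run (eb (f x)) w R t).cfg.l = none)) ∧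
        (∀ t, (V'.run x w R t).coins ≤ (V.run (eb (f x)) w R t).coins ∧
          (V'.run x w R t).queries ≤ (V.run (eb (f x)) w R t).queries) ∧
        (V'.Accepts x w R ↔ V.Accepts (eb (f x)) w R) := by
  obtain ⟨A, time, hA⟩ := hf
  obtain ⟨A, ei, eo⟩ := A
  have := A.ΛFin
  obtain ⟨p, hp⟩ : PolyBounded fun n => n + time.eval n * programPushes A.m + time.eval n +
      2 * (n + time.eval n * programPushes A.m + 1) := by
    have h₁ := PolyBounded.eval time
    have h₂ := PolyBounded.id.add (h₁.mul (PolyBounded.const (programPushes A.m)))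
    exact (h₂.add h₁).add ((PolyBounded.const 2).mul (h₂.add (PolyBounded.const 1)))
  refine ⟨compMachine A ei eo V, p, fun x => ?_⟩
  obtain ⟨⟨n, hn⟩, hle⟩ := hA x
  have hle : n ≤ time.eval x.length := hle
  have hn : (flip bind A.step)^[n] (some (initList A (x.map ei.symm))) =
      some (haltList A ((eb (f x)).map eo.symm)) := hn
  have hlen : (eb (f x)).length ≤ x.length + time.eval x.length * programPushes A.m := by
    have h₁ := iterate_of_bind (F := totalStep A.m) (e := fun c : A.Cfg => c)
      (fun c c' h => by
        have h := (step_eq_ite A.m c).symm.trans h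
        split at h
        · cases h
        · exact Option.some.inj h) hn
    have h₂ := length_iterate_totalStep_le A.m (initList A (x.map ei.symm)) n A.k₁
    have h₃ : ((initList A (x.map ei.symm)).stk A.k₁).length ≤ x.length := by
      rw [initList_stk]
      by_cases h : A.k₁ = A.k₀
      · have : ∀ k, k = A.k₀ → (Function.update (fun k => ([] : List (A.Γ k))) A.k₀
            (x.map ei.symm) k).length ≤ x.length := by
          rintro k rfl; rw [Function.update_self, List.length_map]
        exact this _ h
      · rw [Function.update_of_ne h]; exact Nat.zero_le _
    have h₄ : (((totalStep A.m)^[n] (initList A (x.map ei.symm))).stk A.k₁).length =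
        (eb (f x)).length := by
      rw [h₁, haltList_stk, Function.update_self, List.length_map]
    have h₅ := Nat.mul_le_mul_right (programPushes A.m) hle
    omega
  have hpx := hp x.length
  beta_reduce at hpx
  refine ⟨by omega, n + ((eb (f x)).length + 1) + ((eb (f x)).length + 1), by omega,
    fun w R => ?_⟩
  have hrun := compMachine_run A ei eo V w R hn
  have hhalt : ∀ t, ((compMachine A ei eo V).run x w R
      (n + ((eb (f x)).length + 1) + ((eb (f x)).length + 1) + t)).cfg.l = none ↔
      (V.run (eb (f x)) w R t).cfg.l = none := fun t => by
    rw [hrun]; exact Option.map_eq_none_iff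
  refine ⟨hhalt, fun t => ?_, ?_⟩
  · generalize n + ((eb (f x)).length + 1) + ((eb (f x)).length + 1) = t₀ at hrun
    have h₁ := (compMachine A ei eo V).monotone_coins x w R (Nat.le_add_left t t₀)
    have h₂ := (compMachine A ei eo V).monotone_queries x w R (Nat.le_add_left t t₀)
    simp only [hrun] at h₁ h₂
    exact ⟨h₁, h₂⟩
  · generalize n + ((eb (f x)).length + 1) + ((eb (f x)).length + 1) = t₀ at hrun hhalt
    constructor
    · rintro ⟨t, ht, ha⟩
      have h := (compMachine A ei eo V).run_eq_of_halted x w R (Nat.le_add_left t t₀) ht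
      refine ⟨t, (hhalt t).1 (by rw [h]; exact ht), ?_⟩
      rw [← h, hrun] at ha
      exact ha
    · rintro ⟨t, ht, ha⟩
      exact ⟨t₀ + t, (hhalt t).2 ht, by rw [hrun]; exact ha⟩

/-! ### Formulas as strings of symbols -/

/-- The four two-bit symbols of which the encoding of a formula consists. -/
abbrev Symb : Type := Bool × Bool

/-- The symbol that ends a clause. -/
abbrev endClause : Symb := (false, false)

/-- The symbols of which the encoding of a literal consists. -/
def Literal.symbols (l : Literal) : List Symb :=
  (true, l.pos) :: ((Nat.bits l.var).map fun b => (true, b)) ++ [(false, true)]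

/-- The symbols of which the encoding of a clause consists. -/
def Clause.symbols (c : Clause) : List Symb :=
  c.flatMap Literal.symbols ++ [endClause]

/-- The symbols of a list of clauses. -/
def clauseSymbols (l : List Clause) : List Symb :=
  l.flatMap Clause.symbols

/-- The string of bits that a string of symbols stands for. -/
def symbolBits (s : List Symb) : List Bool :=
  s.flatMap fun x => [x.1, x.2]

theorem symbolBits_append (s t : List Symb) : symbolBits (s ++ t) = symbolBits s ++ symbolBits t :=
  List.flatMap_append

theorem symbolBits_map_data (l : List Bool) :
    symbolBits (l.map fun b => (true, b)) = encodeDataBits l := by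
  induction l with
  | nil => rfl
  | cons b l ih =>
    simp only [symbolBits, encodeDataBits, List.map_cons, List.flatMap_cons] at ih ⊢
    rw [ih]

theorem symbolBits_literal (l : Literal) : symbolBits l.symbols = l.encode := by
  have : l.symbols = ((l.pos :: Nat.bits l.var).map fun b => (true, b)) ++ [(false, true)] := rfl
  rw [this, symbolBits_append, symbolBits_map_data]
  rfl

theorem symbolBits_clause (c : Clause) : symbolBits (Clause.symbols c) = c.encode := by
  rw [Clause.symbols, symbolBits_append, Clause.encode]
  congr 1
  induction c with
  | nil => rfl
  | cons l c ih => rw [List.flatMap_cons, List.flatMap_cons, symbolBits_append, ih,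
      symbolBits_literal]

theorem symbolBits_clauseSymbols (l : List Clause) :
    symbolBits (clauseSymbols l) = l.flatMap Clause.encode := by
  induction l with
  | nil => rfl
  | cons c l ih =>
    rw [clauseSymbols, List.flatMap_cons, List.flatMap_cons, symbolBits_append,
      ← clauseSymbols, ih, symbolBits_clause]

theorem length_symbolBits (s : List Symb) : (symbolBits s).length = 2 * s.length := by
  induction s with
  | nil => rfl
  | cons x s ih =>
    simp only [symbolBits, List.flatMap_cons, List.length_append, List.length_cons] at ih ⊢
    rw [ih]
    simp only [List.length_nil]
    omega

/-- Every second element of a list, without or with the first one dropped. -/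
def half {α : Type} : Bool → List α → List α
  | _, [] => []
  | false, a :: l => a :: half true l
  | true, _ :: l => half false l

theorem length_half {α : Type} (b : Bool) (l : List α) :
    2 * (half b l).length ≤ l.length + 1 := by
  have : ∀ l : List α, 2 * (half false l).length ≤ l.length + 1 ∧
      2 * (half true l).length ≤ l.length := by
    intro l
    induction l with
    | nil => simp [half]
    | cons a l ih => simp only [half, List.length_cons]; omega
  cases b
  · exact (this l).1
  · exact (this l).2.trans (Nat.le_succ _)

theorem countP_half_add {α : Type} (p : α → Bool) (l : List α) :
    (half false l).countP p + (half true l).countP p = l.countP p := by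
  induction l with
  | nil => rfl
  | cons a l ih =>
    simp only [half, List.countP_cons]
    omega

theorem half_sublist {α : Type} (b : Bool) (l : List α) : (half b l).Sublist l := by
  induction l generalizing b with
  | nil => cases b <;> exact List.Sublist.refl _
  | cons a l ih =>
    cases b
    · exact (ih true).cons_cons a
    · exact (ih false).cons a

/-- The effect of halving on symbols: what belongs to a clause that is dropped is erased. -/
def halfSymbols : Bool → List Symb → List Symb
  | _, [] => []
  | b, x :: s => (if b then [] else [x]) ++ halfSymbols (b ^^ (x == endClause)) s

theorem halfSymbols_append (b : Bool) (u s : List Symb) (hu : ∀ x ∈ u, x ≠ endClause) :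
    halfSymbols b (u ++ s) = (if b then [] else u) ++ halfSymbols b s := by
  induction u with
  | nil => simp
  | cons x u ih =>
    have hx : (x == endClause) = false := by simpa using hu x (by simp)
    rw [List.cons_append, halfSymbols, hx, Bool.xor_false,
      ih fun y hy => hu y (List.mem_cons_of_mem _ hy)]
    cases b <;> simp

theorem ne_endClause_of_mem {c : Clause} {x : Symb} (hx : x ∈ c.flatMap Literal.symbols) :
    x ≠ endClause := by
  obtain ⟨l, -, hx⟩ := List.mem_flatMap.1 hx
  simp only [Literal.symbols, List.cons_append, List.mem_cons, List.mem_append, List.mem_map,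
    List.not_mem_nil, or_false] at hx
  rintro rfl
  simp at hx

theorem halfSymbols_clauseSymbols (b : Bool) (l : List Clause) :
    halfSymbols b (clauseSymbols l) = clauseSymbols (half b l) := by
  induction l generalizing b with
  | nil => cases b <;> rfl
  | cons c l ih =>
    rw [clauseSymbols, List.flatMap_cons, Clause.symbols, List.append_assoc,
      halfSymbols_append _ _ _ fun x => ne_endClause_of_mem, List.singleton_append, halfSymbols,
      ← clauseSymbols, ih]
    cases b <;> simp [half, clauseSymbols, Clause.symbols]

theorem countP_clauseSymbols (l : List Clause) :
    (clauseSymbols l).countP (· == endClause) = l.length := by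
  induction l with
  | nil => rfl
  | cons c l ih =>
    have h : (c.flatMap Literal.symbols).countP (· == endClause) = 0 := by
      rw [List.countP_eq_zero]
      intro x hx
      simpa using ne_endClause_of_mem hx
    rw [clauseSymbols, List.flatMap_cons, List.countP_append, ← clauseSymbols, ih,
      Clause.symbols, List.countP_append, h]
    simp [add_comm]

theorem length_le_clauseSymbols (l : List Clause) : l.length ≤ (clauseSymbols l).length := by
  rw [← countP_clauseSymbols]
  exact List.countP_le_length

theorem clauseSymbols_sublist {l l' : List Clause} (h : l.Sublist l') :
    (clauseSymbols l).length ≤ (clauseSymbols l').length := by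
  induction h with
  | slnil => exact le_rfl
  | cons a _ ih => simp only [clauseSymbols, List.flatMap_cons, List.length_append] at ih ⊢; omega
  | cons_cons a _ ih =>
    simp only [clauseSymbols, List.flatMap_cons, List.length_append] at ih ⊢; omega

/-! ### Picking a clause at random -/

/-- Halve a list of clauses by coin tosses until at most one clause is left, and go on with that
clause, or with `e` if there is none. -/
def pickClause (e : CoinTree) (cont : Clause → CoinTree) (l : List Clause) : CoinTree :=
  match l with
  | [] => e
  | [c] => cont c
  | c₁ :: c₂ :: l => .node fun b => pickClause e cont (half b (c₁ :: c₂ :: l))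
termination_by l.length
decreasing_by
  have := length_half b (c₁ :: c₂ :: l)
  simp only [List.length_cons] at this ⊢
  omega

theorem pickClause_nil (e : CoinTree) (cont : Clause → CoinTree) : pickClause e cont [] = e := by
  rw [pickClause]

theorem pickClause_singleton (e : CoinTree) (cont : Clause → CoinTree) (c : Clause) :
    pickClause e cont [c] = cont c := by
  rw [pickClause]

theorem pickClause_of_two_le (e : CoinTree) (cont : Clause → CoinTree) {l : List Clause}
    (hl : 2 ≤ l.length) :
    pickClause e cont l = .node fun b => pickClause e cont (half b l) := by
  match l with
  | [] => simp at hl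
  | [_] => simp at hl
  | c₁ :: c₂ :: l => rw [pickClause]

theorem half_induction {α : Type} {P : List α → Prop} (nil : P []) (singleton : ∀ c, P [c])
    (half : ∀ l : List α, 2 ≤ l.length → (∀ b, P (half b l)) → P l) (l : List α) : P l := by
  induction h : l.length using Nat.strong_induction_on generalizing l with
  | _ n ih =>
    subst h
    match l with
    | [] => exact nil
    | [c] => exact singleton c
    | c₁ :: c₂ :: l =>
      refine half _ (by simp) fun b => ih _ ?_ _ rfl
      have := length_half b (c₁ :: c₂ :: l)
      simp only [List.length_cons] at this ⊢
      omega

theorem half_length_le_pow {α : Type} {l : List α} (hl : 2 ≤ l.length) {s : ℕ}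
    (h : l.length ≤ 2 ^ s) (b : Bool) : ∃ s', s = s' + 1 ∧ (half b l).length ≤ 2 ^ s' := by
  cases s with
  | zero => simp at h; omega
  | succ s =>
    refine ⟨s, rfl, ?_⟩
    have := length_half b l
    rw [pow_succ] at h
    omega

theorem depth_pickClause {e : CoinTree} {cont : Clause → CoinTree} {D : ℕ} (he : e.depth ≤ D)
    (hcont : ∀ c, (cont c).depth ≤ D) (l : List Clause) {s : ℕ} (hs : l.length ≤ 2 ^ s) :
    (pickClause e cont l).depth ≤ s + D := by
  induction l using half_induction generalizing s with
  | nil => rw [pickClause_nil]; omega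
  | singleton c => rw [pickClause_singleton]; exact (hcont c).trans (Nat.le_add_left _ _)
  | half l hl ih =>
    obtain ⟨s, rfl, h₁⟩ := half_length_le_pow hl hs false
    obtain ⟨s', h, h₂⟩ := half_length_le_pow hl hs true
    obtain rfl : s' = s := by omega
    rw [pickClause_of_two_le _ _ hl, CoinTree.depth]
    have := ih false h₁
    have := ih true h₂
    omega

/-- If the clauses in which `good` fails lead to rejection, then each of them lowers the
acceptance probability by the factor that is the chance of picking it, at least `2⁻ˢ`. -/
theorem prob_pickClause_le {e : CoinTree} {cont : Clause → CoinTree} {good : Clause → Bool}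
    {P : ℝ} (hP : 0 ≤ P) (he : e.prob ≤ P)
    (hcont : ∀ c, (cont c).prob ≤ if good c then P else 0) (l : List Clause) {s : ℕ}
    (hs : l.length ≤ 2 ^ s) :
    (pickClause e cont l).prob ≤ P * (1 - (l.countP fun c => !good c) / 2 ^ s) := by
  induction l using half_induction generalizing s with
  | nil => simpa [pickClause_nil] using he
  | singleton c =>
    rw [pickClause_singleton]
    refine (hcont c).trans ?_
    cases hg : good c with
    | true => simp [hg]
    | false =>
      have h : (1 : ℝ) / 2 ^ s ≤ 1 := by
        rw [div_le_one (by positivity)]; exact one_le_pow₀ (by norm_num)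
      simpa [hg] using mul_nonneg hP (sub_nonneg.2 h)
  | half l hl ih =>
    obtain ⟨s, rfl, h₁⟩ := half_length_le_pow hl hs false
    obtain ⟨s', h, h₂⟩ := half_length_le_pow hl hs true
    obtain rfl : s' = s := by omega
    rw [pickClause_of_two_le _ _ hl, CoinTree.prob]
    have i₁ := ih false h₁
    have i₂ := ih true h₂
    rw [← countP_half_add]
    push_cast
    have h2 : (2 : ℝ) ^ s' ≠ 0 := by positivity
    calc _ ≤ _ := div_le_div_of_nonneg_right (add_le_add i₁ i₂) (by norm_num)
      _ = _ := by rw [pow_succ]; field_simp; ring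

/-- `k` rounds, in each of which a random clause is checked under the assignment `a`. -/
def clauseTrials (a : ℕ → Bool) (cs : List Clause) : ℕ → CoinTree
  | 0 => .leaf true
  | k + 1 => pickClause (clauseTrials a cs k)
      (fun c => if Clause.eval a c then clauseTrials a cs k else .leaf false) cs

theorem depth_clauseTrials (a : ℕ → Bool) (cs : List Clause) (k : ℕ) :
    (clauseTrials a cs k).depth ≤ k * Nat.clog 2 cs.length := by
  induction k with
  | zero => simp [clauseTrials, CoinTree.depth]
  | succ k ih =>
    rw [clauseTrials, Nat.succ_mul, add_comm]
    refine depth_pickClause ih (fun c => ?_) cs (Nat.le_pow_clog (by omega) _)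
    split
    · exact ih
    · exact Nat.zero_le _

theorem prob_clauseTrials_le (a : ℕ → Bool) (cs : List Clause) (k : ℕ) :
    (clauseTrials a cs k).prob ≤
      (1 - (cs.countP fun c => !Clause.eval a c) / 2 ^ Nat.clog 2 cs.length : ℝ) ^ k := by
  have hs : cs.length ≤ 2 ^ Nat.clog 2 cs.length := Nat.le_pow_clog (by omega) _
  have h0 : (0 : ℝ) ≤ 1 - (cs.countP fun c => !Clause.eval a c) / 2 ^ Nat.clog 2 cs.length := by
    rw [sub_nonneg, div_le_one (by positivity)]
    exact_mod_cast List.countP_le_length.trans hs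
  induction k with
  | zero => simp [clauseTrials, CoinTree.prob]
  | succ k ih =>
    rw [clauseTrials, pow_succ]
    refine prob_pickClause_le (pow_nonneg h0 k) ih (fun c => ?_) cs hs
    split
    · exact ih
    · simp [CoinTree.prob]

theorem eval_clauseTrials {a : ℕ → Bool} {cs : List Clause}
    (h : ∀ c ∈ cs, Clause.eval a c = true) (k : ℕ) (R : ℕ → Bool) :
    (clauseTrials a cs k).eval R = true := by
  induction k generalizing R with
  | zero => rfl
  | succ k ih =>
    rw [clauseTrials]
    have : ∀ l : List Clause, (∀ c ∈ l, Clause.eval a c = true) → ∀ R,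
        (pickClause (clauseTrials a cs k)
          (fun c => if Clause.eval a c then clauseTrials a cs k else .leaf false) l).eval R =
          true := by
      intro l
      induction l using half_induction with
      | nil => intro _ R; rw [pickClause_nil]; exact ih R
      | singleton c => intro hc R; rw [pickClause_singleton, if_pos (hc c (by simp))]; exact ih R
      | half l hl ih' =>
        intro hl' R
        rw [pickClause_of_two_le _ _ hl, CoinTree.eval]
        exact ih' _ (fun c hc => hl' c ((half_sublist _ l).mem hc)) _
    exact this cs h R

/-- Amplification: if no assignment satisfies more than a `1 - ε` fraction of the clauses, then
`k ≥ 2 / ε` rounds all succeed with probability at most one half. -/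
theorem prob_clauseTrials_le_half {a : ℕ → Bool} {cs : List Clause} {ε : ℝ} (hε : 0 < ε)
    (hcs : 1 ≤ cs.length) (h : (cs.countP (Clause.eval a) : ℝ) ≤ (1 - ε) * cs.length) {k : ℕ}
    (hk : 2 / ε ≤ k) : (clauseTrials a cs k).prob ≤ 1 / 2 := by
  refine (prob_clauseTrials_le a cs k).trans ?_
  set s := Nat.clog 2 cs.length with hs_def
  set bad := cs.countP fun c => !Clause.eval a c with hbad_def
  have hs : cs.length ≤ 2 ^ s := Nat.le_pow_clog (by omega) _
  have hs' : 2 ^ s ≤ 2 * cs.length := by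
    rcases Nat.lt_or_ge 1 cs.length with h1 | h1
    · have h₁ := Nat.pow_pred_clog_lt_self (b := 2) (by omega) h1
      have h₂ : 1 ≤ s := Nat.clog_pos (by omega) h1
      have h₃ : 2 ^ s = 2 * 2 ^ (s - 1) := by rw [← pow_succ']; congr 1; omega
      rw [Nat.pred_eq_sub_one, ← hs_def] at h₁
      omega
    · have : cs.length = 1 := by omega
      simp [hs_def, this]
  have hsum : bad + cs.countP (Clause.eval a) = cs.length := by
    have := List.length_eq_countP_add_countP (Clause.eval a) (l := cs)
    have h' : bad = cs.countP fun c => decide ¬Clause.eval a c = true := by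
      rw [hbad_def]; congr 1; funext c; cases Clause.eval a c <;> rfl
    omega
  have hbad : ε * cs.length ≤ bad := by
    have : (bad : ℝ) + cs.countP (Clause.eval a) = cs.length := by exact_mod_cast hsum
    linarith
  have hle : 1 - (bad : ℝ) / 2 ^ s ≤ 1 - ε / 2 := by
    have : ε / 2 ≤ (bad : ℝ) / 2 ^ s := by
      rw [div_le_div_iff₀ (by norm_num) (by positivity)]
      have h₂ : (2 : ℝ) ^ s ≤ 2 * cs.length := by exact_mod_cast hs'
      nlinarith
    linarith
  have h0 : (0 : ℝ) ≤ 1 - (bad : ℝ) / 2 ^ s := by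
    rw [sub_nonneg, div_le_one (by positivity)]
    exact_mod_cast List.countP_le_length.trans hs
  calc (1 - (bad : ℝ) / 2 ^ s) ^ k ≤ (Real.exp (-(ε / 2))) ^ k :=
        pow_le_pow_left₀ h0 (hle.trans (by linarith [Real.add_one_le_exp (-(ε / 2))])) k
    _ = Real.exp (-(k * (ε / 2))) := by rw [← Real.exp_nat_mul]; congr 1; ring
    _ ≤ Real.exp (-1) := by
        refine Real.exp_le_exp.2 ?_
        rw [div_le_iff₀ hε] at hk
        linarith
    _ ≤ 1 / 2 := by
        rw [Real.exp_neg, inv_le_comm₀ (Real.exp_pos 1) (by norm_num)]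
        linarith [Real.exp_one_gt_d9]

/-! ### The sampling verifier -/

/-- The stacks of the sampling verifier: its input, its query stack, a scratch stack, a copy of the
whole formula, and the clauses that are still candidates in the current round. -/
inductive SampStack
  | input
  | query
  | scratch
  | copy
  | work
  deriving DecidableEq

instance : Fintype SampStack :=
  ⟨{.input, .query, .scratch, .copy, .work}, fun i => by cases i <;> simp⟩

/-- The stack alphabets: bits for the input and the query stack, two-bit symbols elsewhere. -/
abbrev SampSymb : SampStack → Type
  | .input => Bool
  | .query => Bool
  | .scratch => Symb
  | .copy => Symb
  | .work => Symb

/-- The labels of the sampling verifier. At the start the formula is parsed. A round copies the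
formula to the working stack (`gather`, `spread`), halves the list of candidate clauses by a coin
toss, keeping every other clause (`toss`, `filter`, `restore`), until at most one is left, and then
evaluates the literals of that clause (`literal`), for which the number of the variable is moved to
the query stack (`bits`, `turn`, `query`). -/
inductive SampLabel
  | parse
  | gather
  | spread
  | toss
  | filter
  | restore
  | literal
  | bits
  | turn
  | query
  deriving DecidableEq

instance : Fintype SampLabel :=
  ⟨{.parse, .gather, .spread, .toss, .filter, .restore, .literal, .bits, .turn, .query},
    fun l => by cases l <;> simp⟩

/-- The internal state of the sampling verifier: the symbol just read, the last bit received (from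
a coin or the oracle), the number of candidate clauses up to two, whether the clause being checked
is already known to be true, the sign of the literal being read, and the number of rounds left. -/
structure SampState (k : ℕ) where
  reg : Option Symb
  bit : Bool
  count : Fin 3
  sat : Bool
  pos : Bool
  left : Fin (k + 1)
  deriving Fintype

namespace SampState

/-- Counting up to two. -/
def countUp : Fin 3 → Fin 3
  | 0 => 1
  | _ => 2

/-- A number cut off at two. -/
def countOf : ℕ → Fin 3
  | 0 => 0
  | 1 => 1
  | _ => 2

theorem countUp_countOf (n : ℕ) : countUp (countOf n) = countOf (n + 1) := by
  match n with
  | 0 => rfl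
  | 1 => rfl
  | n + 2 => rfl

def isZero : ℕ → Bool
  | 0 => true
  | _ => false

variable {k : ℕ}

def read (s : SampState k) (a : Option Symb) : SampState k := { s with reg := a }

def isSome (s : SampState k) : Bool := s.reg.isSome

def symb (s : SampState k) : Symb := s.reg.getD endClause

/-- The symbol read is a data bit. -/
def isData (s : SampState k) : Bool := s.reg.isSome && s.symb.1

/-- The symbol read ends a clause. -/
def isEnd (s : SampState k) : Bool := s.symb == endClause

def clear (s : SampState k) : SampState k := { s with reg := none }

/-- Empty the register, counting the clause that ends here. -/
def tally (s : SampState k) : SampState k :=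
  { s with reg := none, count := if s.isEnd then countUp s.count else s.count }

end SampState

open SampState

variable {k : ℕ}

/-- Start the next round, or accept if there is none left. -/
def nextRound (k : ℕ) : TM2.Stmt SampSymb SampLabel (SampState k) :=
  .branch (fun s => isZero s.left)
    (.load (fun s => { s with sat := true }) .halt)
    (.load (fun s => { s with left := ⟨s.left.val.pred, (Nat.pred_le _).trans_lt s.left.2⟩ }) <|
      .goto fun _ => .gather)

/-- Go on according to the number of candidate clauses: none, one, or more. -/
def decideRound (k : ℕ) : TM2.Stmt SampSymb SampLabel (SampState k) :=
  .branch (fun s => isZero s.count) (nextRound k) <|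
  .branch (fun s => isZero s.count.val.pred)
    (.load (fun s => { s with sat := false }) <| .goto fun _ => .literal)
    (.goto fun _ => .toss)

/-- The program of the sampling verifier with `k` rounds. -/
def sampProgram (k : ℕ) : SampLabel → TM2.Stmt SampSymb SampLabel (SampState k)
  | .parse =>
    .pop .input (fun s a => s.read (a.map fun b => (b, false))) <|
    .branch isSome
      (.pop .input (fun s a => s.read (some (s.symb.1, a.getD false))) <|
        .push .scratch symb <| .load clear <| .goto fun _ => .parse)
      (nextRound k)
  | .gather =>
    .pop .copy read <|
    .branch isSome
      (.push .scratch symb <| .load clear <| .goto fun _ => .gather)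
      (.load (fun s => { s with count := 0 }) <| .goto fun _ => .spread)
  | .spread =>
    .pop .scratch read <|
    .branch isSome
      (.push .copy symb <| .push .work symb <| .load tally <| .goto fun _ => .spread)
      (decideRound k)
  | .toss => .load (fun s => { s with count := 0 }) <| .goto fun _ => .filter
  | .filter =>
    .pop .work read <|
    .branch isSome
      (.branch bit
        (.load (fun s => { s with reg := none, bit := s.bit ^^ s.isEnd }) <|
          .goto fun _ => .filter)
        (.push .scratch symb <|
          .load (fun s => { s with reg := none, bit := s.bit ^^ s.isEnd }) <|
          .goto fun _ => .filter))
      (.goto fun _ => .restore)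
  | .restore =>
    .pop .scratch read <|
    .branch isSome
      (.push .work symb <| .load tally <| .goto fun _ => .restore)
      (decideRound k)
  | .literal =>
    .pop .work read <|
    .branch isData
      (.load (fun s => { s with reg := none, pos := s.symb.2 }) <| .goto fun _ => .bits)
      (.load clear <| .branch sat (nextRound k) .halt)
  | .bits =>
    .pop .work read <|
    .branch isData
      (.push .scratch symb <| .load clear <| .goto fun _ => .bits)
      (.load clear <| .goto fun _ => .turn)
  | .turn =>
    .pop .scratch read <|
    .branch isSome
      (.push .query (fun s => s.symb.2) <| .load clear <| .goto fun _ => .turn)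
      (.goto fun _ => .query)
  | .query =>
    .load (fun s => { s with sat := s.sat || s.bit == s.pos }) <| .goto fun _ => .literal

/-- The sampling verifier with `k` rounds, for formulas in conjunctive normal form. In each round
it picks a clause by halving the list of clauses with coin tosses, and checks that the clause is
true under the assignment given by the oracle. -/
def sampler (k : ℕ) : OracleTM where
  tm :=
    { K := SampStack
      k₀ := .input
      k₁ := .query
      Γ := SampSymb
      Λ := SampLabel
      main := .parse
      σ := SampState k
      initialState := ⟨none, false, 0, false, false, Fin.last k⟩
      Γk₀Fin := inferInstanceAs (Fintype Bool)
      m := sampProgram k }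
  inputAlphabet := Equiv.refl Bool
  queryAlphabet := Equiv.refl Bool
  kind
    | .toss => .toss
    | .query => .query
    | _ => .plain
  receive b s := { s with bit := b }
  accept := sat

/-- The contents of all stacks, in the order in which `SampStack` lists them. -/
def sampStk (a q : List Bool) (b c w : List Symb) : ∀ i, List (SampSymb i)
  | .input => a
  | .query => q
  | .scratch => b
  | .copy => c
  | .work => w

/-- A configuration of the sampling verifier. -/
def sampCfg (l : SampLabel) (s : SampState k) (a q : List Bool) (b c w : List Symb)
    (nc nq : ℕ) : (sampler k).Cfg :=
  ⟨⟨some l, s, sampStk a q b c w⟩, nc, nq⟩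

/-- The configuration after executing a statement. -/
def sampAfter (q : TM2.Stmt SampSymb SampLabel (SampState k)) (s : SampState k) (c w : List Symb)
    (nc nq : ℕ) : (sampler k).Cfg :=
  ⟨TM2.stepAux q s (sampStk [] [] [] c w), nc, nq⟩

namespace OracleTM

theorem cfg_ext {M : OracleTM} {c c' : M.Cfg} (hl : c.cfg.l = c'.cfg.l)
    (hv : c.cfg.var = c'.cfg.var) (hs : ∀ k, c.cfg.stk k = c'.cfg.stk k)
    (hc : c.coins = c'.coins) (hq : c.queries = c'.queries) : c = c' := by
  obtain ⟨c, _, _⟩ := c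
  obtain ⟨c', _, _⟩ := c'
  obtain rfl : c = c' := Complexity.cfg_ext hl hv hs
  obtain rfl := hc
  obtain rfl := hq
  rfl

end OracleTM

section Steps

variable (w : List Bool) (R : ℕ → Bool)

theorem step_parse_cons (bit sat pos : Bool) (n : Fin 3) (j : Fin (k + 1)) (x : Symb)
    (a q : List Bool) (b c u : List Symb) (nc nq : ℕ) :
    (sampler k).step w R
      (sampCfg .parse ⟨none, bit, n, sat, pos, j⟩ (x.1 :: x.2 :: a) q b c u nc nq) =
      sampCfg .parse ⟨none, bit, n, sat, pos, j⟩ a q (x :: b) c u nc nq :=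
  OracleTM.cfg_ext rfl rfl (fun i => by cases i <;> rfl) rfl rfl

theorem step_gather_cons (bit sat pos : Bool) (n : Fin 3) (j : Fin (k + 1)) (x : Symb)
    (a q : List Bool) (b c u : List Symb) (nc nq : ℕ) :
    (sampler k).step w R
      (sampCfg .gather ⟨none, bit, n, sat, pos, j⟩ a q b (x :: c) u nc nq) =
      sampCfg .gather ⟨none, bit, n, sat, pos, j⟩ a q (x :: b) c u nc nq :=
  OracleTM.cfg_ext rfl rfl (fun i => by cases i <;> rfl) rfl rfl

theorem step_gather_nil (bit sat pos : Bool) (n : Fin 3) (j : Fin (k + 1))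
    (a q : List Bool) (b u : List Symb) (nc nq : ℕ) :
    (sampler k).step w R
      (sampCfg .gather ⟨none, bit, n, sat, pos, j⟩ a q b [] u nc nq) =
      sampCfg .spread ⟨none, bit, 0, sat, pos, j⟩ a q b [] u nc nq :=
  OracleTM.cfg_ext rfl rfl (fun i => by cases i <;> rfl) rfl rfl

theorem step_spread_cons (bit sat pos : Bool) (n : Fin 3) (j : Fin (k + 1)) (x : Symb)
    (a q : List Bool) (b c u : List Symb) (nc nq : ℕ) :
    (sampler k).step w R
      (sampCfg .spread ⟨none, bit, n, sat, pos, j⟩ a q (x :: b) c u nc nq) =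
      sampCfg .spread ⟨none, bit, if x == endClause then countUp n else n, sat, pos, j⟩
        a q b (x :: c) (x :: u) nc nq :=
  OracleTM.cfg_ext rfl rfl (fun i => by cases i <;> rfl) rfl rfl

theorem step_spread_nil (bit sat pos : Bool) (n : Fin 3) (j : Fin (k + 1))
    (c u : List Symb) (nc nq : ℕ) :
    (sampler k).step w R
      (sampCfg .spread ⟨none, bit, n, sat, pos, j⟩ [] [] [] c u nc nq) =
      sampAfter (decideRound k) ⟨none, bit, n, sat, pos, j⟩ c u nc nq := by
  have : Function.update (sampStk [] [] [] c u) .scratch [] = sampStk [] [] [] c u := by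
    funext i; cases i <;> rfl
  unfold sampAfter
  rw [← this]
  rfl

theorem step_toss (bit sat pos : Bool) (n : Fin 3) (j : Fin (k + 1))
    (a q : List Bool) (b c u : List Symb) (nc nq : ℕ) :
    (sampler k).step w R
      (sampCfg .toss ⟨none, bit, n, sat, pos, j⟩ a q b c u nc nq) =
      sampCfg .filter ⟨none, R nc, 0, sat, pos, j⟩ a q b c u (nc + 1) nq :=
  OracleTM.cfg_ext rfl rfl (fun i => by cases i <;> rfl) rfl rfl

theorem step_filter_cons (bit sat pos : Bool) (n : Fin 3) (j : Fin (k + 1)) (x : Symb)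
    (a q : List Bool) (b c u : List Symb) (nc nq : ℕ) :
    (sampler k).step w R
      (sampCfg .filter ⟨none, bit, n, sat, pos, j⟩ a q b c (x :: u) nc nq) =
      sampCfg .filter ⟨none, bit ^^ (x == endClause), n, sat, pos, j⟩
        a q (if bit then b else x :: b) c u nc nq := by
  cases bit <;> exact OracleTM.cfg_ext rfl rfl (fun i => by cases i <;> rfl) rfl rfl

theorem step_filter_nil (bit sat pos : Bool) (n : Fin 3) (j : Fin (k + 1))
    (a q : List Bool) (b c : List Symb) (nc nq : ℕ) :
    (sampler k).step w R
      (sampCfg .filter ⟨none, bit, n, sat, pos, j⟩ a q b c [] nc nq) =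
      sampCfg .restore ⟨none, bit, n, sat, pos, j⟩ a q b c [] nc nq :=
  OracleTM.cfg_ext rfl rfl (fun i => by cases i <;> rfl) rfl rfl

theorem step_restore_cons (bit sat pos : Bool) (n : Fin 3) (j : Fin (k + 1)) (x : Symb)
    (a q : List Bool) (b c u : List Symb) (nc nq : ℕ) :
    (sampler k).step w R
      (sampCfg .restore ⟨none, bit, n, sat, pos, j⟩ a q (x :: b) c u nc nq) =
      sampCfg .restore ⟨none, bit, if x == endClause then countUp n else n, sat, pos, j⟩
        a q b c (x :: u) nc nq :=
  OracleTM.cfg_ext rfl rfl (fun i => by cases i <;> rfl) rfl rfl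

theorem step_restore_nil (bit sat pos : Bool) (n : Fin 3) (j : Fin (k + 1))
    (c u : List Symb) (nc nq : ℕ) :
    (sampler k).step w R
      (sampCfg .restore ⟨none, bit, n, sat, pos, j⟩ [] [] [] c u nc nq) =
      sampAfter (decideRound k) ⟨none, bit, n, sat, pos, j⟩ c u nc nq := by
  have : Function.update (sampStk [] [] [] c u) .scratch [] = sampStk [] [] [] c u := by
    funext i; cases i <;> rfl
  unfold sampAfter
  rw [← this]
  rfl

theorem step_literal_data (bit sat pos d : Bool) (n : Fin 3) (j : Fin (k + 1))
    (a q : List Bool) (b c u : List Symb) (nc nq : ℕ) :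
    (sampler k).step w R
      (sampCfg .literal ⟨none, bit, n, sat, pos, j⟩ a q b c ((true, d) :: u) nc nq) =
      sampCfg .bits ⟨none, bit, n, sat, d, j⟩ a q b c u nc nq :=
  OracleTM.cfg_ext rfl rfl (fun i => by cases i <;> rfl) rfl rfl

theorem step_literal_end (bit sat pos : Bool) (n : Fin 3) (j : Fin (k + 1))
    (c u : List Symb) (nc nq : ℕ) :
    (sampler k).step w R
      (sampCfg .literal ⟨none, bit, n, sat, pos, j⟩ [] [] [] c (endClause :: u) nc nq) =
      sampAfter (.branch SampState.sat (nextRound k) .halt) ⟨none, bit, n, sat, pos, j⟩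
        c u nc nq := by
  have : Function.update (sampStk [] [] [] c (endClause :: u)) .work u =
      sampStk [] [] [] c u := by
    funext i; cases i <;> rfl
  unfold sampAfter
  rw [← this]
  rfl

theorem step_bits_data (bit sat pos d : Bool) (n : Fin 3) (j : Fin (k + 1))
    (a q : List Bool) (b c u : List Symb) (nc nq : ℕ) :
    (sampler k).step w R
      (sampCfg .bits ⟨none, bit, n, sat, pos, j⟩ a q b c ((true, d) :: u) nc nq) =
      sampCfg .bits ⟨none, bit, n, sat, pos, j⟩ a q ((true, d) :: b) c u nc nq :=
  OracleTM.cfg_ext rfl rfl (fun i => by cases i <;> rfl) rfl rfl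

theorem step_bits_end (bit sat pos d : Bool) (n : Fin 3) (j : Fin (k + 1))
    (a q : List Bool) (b c u : List Symb) (nc nq : ℕ) :
    (sampler k).step w R
      (sampCfg .bits ⟨none, bit, n, sat, pos, j⟩ a q b c ((false, d) :: u) nc nq) =
      sampCfg .turn ⟨none, bit, n, sat, pos, j⟩ a q b c u nc nq :=
  OracleTM.cfg_ext rfl rfl (fun i => by cases i <;> rfl) rfl rfl

theorem step_turn_cons (bit sat pos : Bool) (n : Fin 3) (j : Fin (k + 1)) (x : Symb)
    (a q : List Bool) (b c u : List Symb) (nc nq : ℕ) :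
    (sampler k).step w R
      (sampCfg .turn ⟨none, bit, n, sat, pos, j⟩ a q (x :: b) c u nc nq) =
      sampCfg .turn ⟨none, bit, n, sat, pos, j⟩ a (x.2 :: q) b c u nc nq :=
  OracleTM.cfg_ext rfl rfl (fun i => by cases i <;> rfl) rfl rfl

theorem step_turn_nil (bit sat pos : Bool) (n : Fin 3) (j : Fin (k + 1))
    (a q : List Bool) (c u : List Symb) (nc nq : ℕ) :
    (sampler k).step w R
      (sampCfg .turn ⟨none, bit, n, sat, pos, j⟩ a q [] c u nc nq) =
      sampCfg .query ⟨none, bit, n, sat, pos, j⟩ a q [] c u nc nq :=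
  OracleTM.cfg_ext rfl rfl (fun i => by cases i <;> rfl) rfl rfl

theorem step_query (bit sat pos : Bool) (n : Fin 3) (j : Fin (k + 1))
    (a q : List Bool) (b c u : List Symb) (nc nq : ℕ) :
    (sampler k).step w R
      (sampCfg .query ⟨none, bit, n, sat, pos, j⟩ a q b c u nc nq) =
      sampCfg .literal
        ⟨none, w.getD (Nat.ofDigits 2 (q.map Bool.toNat)) false, n,
          sat || (w.getD (Nat.ofDigits 2 (q.map Bool.toNat)) false == pos), pos, j⟩
        a [] b c u nc (nq + 1) :=
  OracleTM.cfg_ext rfl rfl (fun i => by cases i <;> rfl) rfl rfl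

end Steps

open SampState

/-- From the configuration `c` the machine halts within `n` steps with the verdict `b`, having
tossed at most `nc` coins and made at most `nq` queries in all. -/
def HaltsWithin (M : OracleTM) (w : List Bool) (R : ℕ → Bool) (n : ℕ) (c : M.Cfg) (b : Bool)
    (nc nq : ℕ) : Prop :=
  ((M.step w R)^[n] c).cfg.l = none ∧ M.accept ((M.step w R)^[n] c).cfg.var = b ∧
    ((M.step w R)^[n] c).coins ≤ nc ∧ ((M.step w R)^[n] c).queries ≤ nq

namespace HaltsWithin

variable {M : OracleTM} {w : List Bool} {R : ℕ → Bool} {n n' nc nc' nq nq' : ℕ} {c c' : M.Cfg}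
  {b : Bool}

theorem mono (h : HaltsWithin M w R n c b nc nq) (hn : n ≤ n') (hc : nc ≤ nc') (hq : nq ≤ nq') :
    HaltsWithin M w R n' c b nc' nq' := by
  obtain ⟨m, rfl⟩ := Nat.exists_eq_add_of_le' hn
  obtain ⟨h₁, h₂, h₃, h₄⟩ := h
  have : (M.step w R)^[m + n] c = (M.step w R)^[n] c := by
    rw [Function.iterate_add_apply, M.iterate_of_halted w R h₁]
  unfold HaltsWithin
  rw [this]
  exact ⟨h₁, h₂, h₃.trans hc, h₄.trans hq⟩

theorem prepend {m : ℕ} (h : HaltsWithin M w R n c' b nc nq) (hm : (M.step w R)^[m] c = c') :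
    HaltsWithin M w R (n + m) c b nc nq := by
  unfold HaltsWithin
  rw [Function.iterate_add_apply, hm]
  exact h

end HaltsWithin

section Loops

variable {k : ℕ} (w : List Bool) (R : ℕ → Bool)

theorem parse_loop (bit sat pos : Bool) (n : Fin 3) (j : Fin (k + 1)) (t : List Symb)
    (q : List Bool) (b c u : List Symb) (nc nq : ℕ) :
    ((sampler k).step w R)^[t.length]
      (sampCfg .parse ⟨none, bit, n, sat, pos, j⟩ (symbolBits t) q b c u nc nq) =
      sampCfg .parse ⟨none, bit, n, sat, pos, j⟩ [] q (t.reverse ++ b) c u nc nq := by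
  induction t generalizing b with
  | nil => rfl
  | cons x t ih =>
    have h : symbolBits (x :: t) = x.1 :: x.2 :: symbolBits t := rfl
    rw [List.length_cons, Function.iterate_succ_apply, h, step_parse_cons, ih]
    simp

theorem gather_loop (bit sat pos : Bool) (n : Fin 3) (j : Fin (k + 1)) (t : List Symb)
    (a q : List Bool) (b u : List Symb) (nc nq : ℕ) :
    ((sampler k).step w R)^[t.length]
      (sampCfg .gather ⟨none, bit, n, sat, pos, j⟩ a q b t u nc nq) =
      sampCfg .gather ⟨none, bit, n, sat, pos, j⟩ a q (t.reverse ++ b) [] u nc nq := by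
  induction t generalizing b with
  | nil => rfl
  | cons x t ih =>
    rw [List.length_cons, Function.iterate_succ_apply, step_gather_cons, ih]
    simp

theorem countOf_countP_cons (x : Symb) (t : List Symb) (n : ℕ) :
    countOf (n + (x :: t).countP (· == endClause)) =
      countOf ((if x == endClause then n + 1 else n) + t.countP (· == endClause)) := by
  rw [List.countP_cons]
  congr 1
  split <;> omega

theorem ite_countUp (p : Bool) (n : ℕ) :
    (if p then countUp (countOf n) else countOf n) = countOf (if p then n + 1 else n) := by
  cases p
  · rfl
  · exact countUp_countOf n

theorem spread_loop (bit sat pos : Bool) (n : ℕ) (j : Fin (k + 1)) (t : List Symb)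
    (a q : List Bool) (c u : List Symb) (nc nq : ℕ) :
    ((sampler k).step w R)^[t.length]
      (sampCfg .spread ⟨none, bit, countOf n, sat, pos, j⟩ a q t c u nc nq) =
      sampCfg .spread ⟨none, bit, countOf (n + t.countP (· == endClause)), sat, pos, j⟩
        a q [] (t.reverse ++ c) (t.reverse ++ u) nc nq := by
  induction t generalizing n c u with
  | nil => rfl
  | cons x t ih =>
    rw [List.length_cons, Function.iterate_succ_apply, step_spread_cons, ite_countUp, ih,
      countOf_countP_cons]
    simp

theorem restore_loop (bit sat pos : Bool) (n : ℕ) (j : Fin (k + 1)) (t : List Symb)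
    (a q : List Bool) (c u : List Symb) (nc nq : ℕ) :
    ((sampler k).step w R)^[t.length]
      (sampCfg .restore ⟨none, bit, countOf n, sat, pos, j⟩ a q t c u nc nq) =
      sampCfg .restore ⟨none, bit, countOf (n + t.countP (· == endClause)), sat, pos, j⟩
        a q [] c (t.reverse ++ u) nc nq := by
  induction t generalizing n u with
  | nil => rfl
  | cons x t ih =>
    rw [List.length_cons, Function.iterate_succ_apply, step_restore_cons, ite_countUp, ih,
      countOf_countP_cons]
    simp

theorem filter_loop (bit sat pos : Bool) (n : Fin 3) (j : Fin (k + 1)) (t : List Symb)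
    (a q : List Bool) (b c : List Symb) (nc nq : ℕ) :
    ∃ bit', ((sampler k).step w R)^[t.length]
      (sampCfg .filter ⟨none, bit, n, sat, pos, j⟩ a q b c t nc nq) =
      sampCfg .filter ⟨none, bit', n, sat, pos, j⟩ a q ((halfSymbols bit t).reverse ++ b) c []
        nc nq := by
  induction t generalizing bit b with
  | nil => exact ⟨bit, by cases bit <;> rfl⟩
  | cons x t ih =>
    obtain ⟨bit', h⟩ := ih (bit ^^ (x == endClause)) (if bit then b else x :: b)
    refine ⟨bit', ?_⟩
    rw [List.length_cons, Function.iterate_succ_apply, step_filter_cons, h]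
    cases bit <;> simp [halfSymbols]

theorem bits_loop (bit sat pos : Bool) (n : Fin 3) (j : Fin (k + 1)) (t : List Bool)
    (a q : List Bool) (b c u : List Symb) (nc nq : ℕ) :
    ((sampler k).step w R)^[t.length]
      (sampCfg .bits ⟨none, bit, n, sat, pos, j⟩ a q b c (t.map (fun d => (true, d)) ++ u) nc nq) =
      sampCfg .bits ⟨none, bit, n, sat, pos, j⟩ a q ((t.map fun d => (true, d)).reverse ++ b) c u
        nc nq := by
  induction t generalizing b with
  | nil => rfl
  | cons x t ih =>
    rw [List.length_cons, Function.iterate_succ_apply, List.map_cons, List.cons_append,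
      step_bits_data, ih]
    simp

theorem turn_loop (bit sat pos : Bool) (n : Fin 3) (j : Fin (k + 1)) (t : List Symb)
    (a q : List Bool) (c u : List Symb) (nc nq : ℕ) :
    ((sampler k).step w R)^[t.length]
      (sampCfg .turn ⟨none, bit, n, sat, pos, j⟩ a q t c u nc nq) =
      sampCfg .turn ⟨none, bit, n, sat, pos, j⟩ a ((t.map Prod.snd).reverse ++ q) [] c u
        nc nq := by
  induction t generalizing q with
  | nil => rfl
  | cons x t ih =>
    rw [List.length_cons, Function.iterate_succ_apply, step_turn_cons, ih]
    simp

theorem ofDigits_bits (n : ℕ) : Nat.ofDigits 2 ((Nat.bits n).map Bool.toNat) = n := by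
  have h := Nat.ofDigits_digits 2 n
  rwa [Nat.digits_two_eq_bits] at h

/-- Reading one literal of the clause being checked. -/
theorem literal_block (bit sat pos : Bool) (n : Fin 3) (j : Fin (k + 1)) (l : Literal)
    (c u : List Symb) (nc nq : ℕ) :
    ∃ bit' pos', ((sampler k).step w R)^[2 * l.symbols.length]
      (sampCfg .literal ⟨none, bit, n, sat, pos, j⟩ [] [] [] c (l.symbols ++ u) nc nq) =
      sampCfg .literal ⟨none, bit', n, sat || l.eval (fun i => w.getD i false), pos', j⟩
        [] [] [] c u nc (nq + 1) := by
  refine ⟨w.getD l.var false, l.pos, ?_⟩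
  have hlen : 2 * l.symbols.length =
      1 + (1 + (l.var.bits.length + (1 + (l.var.bits.length + 1)))) := by
    simp only [Literal.symbols, List.length_append, List.length_cons, List.length_map,
      List.length_nil]
    omega
  have hsym : l.symbols ++ u =
      (true, l.pos) :: (l.var.bits.map (fun d => (true, d)) ++ (false, true) :: u) := by
    simp [Literal.symbols]
  have hturn : ((l.var.bits.map fun d => ((true, d) : Symb)).reverse.map Prod.snd).reverse =
      l.var.bits := by
    rw [← List.map_reverse, List.reverse_reverse, List.map_map]
    exact List.map_id _
  have h := turn_loop w R bit sat l.pos n j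
    ((l.var.bits.map fun d => ((true, d) : Symb)).reverse) [] [] c u nc nq
  rw [List.length_reverse, List.length_map, hturn, List.append_nil] at h
  rw [hlen, hsym, Function.iterate_add_apply, Function.iterate_add_apply,
    Function.iterate_add_apply, Function.iterate_add_apply, Function.iterate_add_apply,
    Function.iterate_one, step_literal_data, bits_loop, step_bits_end, List.append_nil, h,
    step_turn_nil, step_query, ofDigits_bits]
  rfl

theorem clause_block (bit sat pos : Bool) (n : Fin 3) (j : Fin (k + 1)) (l : Clause)
    (c u : List Symb) (nc nq : ℕ) :
    ∃ bit' pos', ((sampler k).step w R)^[2 * (l.flatMap Literal.symbols).length]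
      (sampCfg .literal ⟨none, bit, n, sat, pos, j⟩ [] [] [] c
        (l.flatMap Literal.symbols ++ u) nc nq) =
      sampCfg .literal ⟨none, bit', n, sat || Clause.eval (fun i => w.getD i false) l, pos', j⟩
        [] [] [] c u nc (nq + l.length) := by
  induction l generalizing bit sat pos nq with
  | nil => exact ⟨bit, pos, by simp [Clause.eval]⟩
  | cons x l ih =>
    obtain ⟨bit', pos', h⟩ := literal_block w R bit sat pos n j x c
      (l.flatMap Literal.symbols ++ u) nc nq
    obtain ⟨bit'', pos'', h'⟩ := ih bit' (sat || x.eval fun i => w.getD i false) pos' (nq + 1)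
    refine ⟨bit'', pos'', ?_⟩
    rw [List.flatMap_cons, List.length_append, mul_add, add_comm, Function.iterate_add_apply,
      List.append_assoc, h, h', List.length_cons, Bool.or_assoc, add_assoc, add_comm 1]
    rfl

/-- The number of steps, for a formula with `N` symbols, from the moment when the candidate
clauses are known to be the `m` ones on the working stack to the end of the round. -/
def pickTime (N m : ℕ) : ℕ := m * (2 * N + 3) + (2 * N + 1)

/-- The number of steps of one round for a formula with `N` symbols. -/
def roundTime (N : ℕ) : ℕ := pickTime N N + 2 * N + 2

variable {cs : List Clause}

/-- The run of the verifier when `j` rounds are left, at the point between two rounds. -/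
def RoundsHalt (k : ℕ) (cs : List Clause) (j : ℕ) : Prop :=
  ∀ (hj : j < k + 1) (bit sat pos : Bool) (n : Fin 3) (nc nq : ℕ),
    HaltsWithin (sampler k) w R (j * roundTime (clauseSymbols cs).length)
      (sampAfter (nextRound k) ⟨none, bit, n, sat, pos, ⟨j, hj⟩⟩ (clauseSymbols cs) [] nc nq)
      ((clauseTrials (fun i => w.getD i false) cs j).eval fun i => R (nc + i))
      (nc + j * Nat.clog 2 cs.length) (nq + 3 * j)

theorem pick_halts (hcs : ∀ c ∈ cs, c.length ≤ 3) {j : ℕ} (hj : j < k + 1)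
    (ih : RoundsHalt w R k cs j) (l : List Clause) (hl : l.Sublist cs) {s : ℕ}
    (hs : l.length ≤ 2 ^ s) (bit sat pos : Bool) (nc nq : ℕ) :
    HaltsWithin (sampler k) w R
      (pickTime (clauseSymbols cs).length l.length + j * roundTime (clauseSymbols cs).length)
      (sampAfter (decideRound k) ⟨none, bit, countOf l.length, sat, pos, ⟨j, hj⟩⟩
        (clauseSymbols cs) (clauseSymbols l) nc nq)
      ((pickClause (clauseTrials (fun i => w.getD i false) cs j)
        (fun c => if Clause.eval (fun i => w.getD i false) c
          then clauseTrials (fun i => w.getD i false) cs j else .leaf false) l).eval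
        fun i => R (nc + i))
      (nc + s + j * Nat.clog 2 cs.length) (nq + 3 * (j + 1)) := by
  induction l using half_induction generalizing s bit sat pos nc with
  | nil =>
    rw [pickClause_nil]
    exact (ih hj bit sat pos 0 nc nq).mono (by omega) (by omega) (by omega)
  | singleton c =>
    rw [pickClause_singleton]
    have hstart : sampAfter (decideRound k)
        ⟨none, bit, countOf [c].length, sat, pos, ⟨j, hj⟩⟩
        (clauseSymbols cs) (clauseSymbols [c]) nc nq =
        sampCfg .literal ⟨none, bit, 1, false, pos, ⟨j, hj⟩⟩ [] [] [] (clauseSymbols cs)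
          (c.flatMap Literal.symbols ++ [endClause]) nc nq := by
      rw [clauseSymbols, clauseSymbols, List.flatMap_singleton]
      rfl
    obtain ⟨bit', pos', h⟩ := clause_block w R bit false pos 1 ⟨j, hj⟩ c (clauseSymbols cs)
      [endClause] nc nq
    rw [Bool.false_or] at h
    have hc : c.length ≤ 3 := hcs c (hl.mem (by simp))
    have hlen : (c.flatMap Literal.symbols).length + 1 ≤ (clauseSymbols cs).length := by
      have := clauseSymbols_sublist hl
      simpa [clauseSymbols, Clause.symbols] using this
    have hend := step_literal_end w R bit' (Clause.eval (fun i => w.getD i false) c) pos' 1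
      ⟨j, hj⟩ (clauseSymbols cs) [] nc (nq + c.length)
    rw [← Function.iterate_one ((sampler k).step w R)] at hend
    rw [hstart]
    refine HaltsWithin.mono (n := pickTime (clauseSymbols cs).length 0 +
      j * roundTime (clauseSymbols cs).length) (nc := nc + j * Nat.clog 2 cs.length)
      (nq := nq + c.length + 3 * j) ?_ (by simp only [pickTime, List.length_singleton]; omega)
      (by omega) (by omega)
    refine HaltsWithin.mono (HaltsWithin.prepend (HaltsWithin.prepend (m := 1)
      (n := j * roundTime (clauseSymbols cs).length) (nc := nc + j * Nat.clog 2 cs.length)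
      (nq := nq + c.length + 3 * j) ?_ hend) h)
      (by simp only [pickTime]; omega) le_rfl le_rfl
    cases hv : Clause.eval (fun i => w.getD i false) c with
    | true => exact ih hj bit' true pos' 1 nc (nq + c.length)
    | false =>
      have h0 : HaltsWithin (sampler k) w R 0
          (sampAfter (.branch SampState.sat (nextRound k) .halt)
            ⟨none, bit', 1, false, pos', ⟨j, hj⟩⟩ (clauseSymbols cs) [] nc (nq + c.length))
          false nc (nq + c.length) := ⟨rfl, rfl, le_rfl, le_rfl⟩
      exact h0.mono (Nat.zero_le _) (by omega) (by omega)
  | half l hlen ih' =>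
    obtain ⟨s, rfl, -⟩ := half_length_le_pow hlen hs false
    rw [pickClause_of_two_le _ _ hlen, CoinTree.eval]
    have hcount : countOf l.length = 2 := by
      match l, hlen with
      | _ :: _ :: _, _ => rfl
    have hstart : sampAfter (decideRound k)
        ⟨none, bit, countOf l.length, sat, pos, ⟨j, hj⟩⟩
        (clauseSymbols cs) (clauseSymbols l) nc nq =
        sampCfg .toss ⟨none, bit, 2, sat, pos, ⟨j, hj⟩⟩ [] [] [] (clauseSymbols cs)
          (clauseSymbols l) nc nq := by
      rw [hcount]; rfl
    obtain ⟨s', hs', hle⟩ := half_length_le_pow hlen hs (R nc)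
    obtain rfl : s' = s := by omega
    obtain ⟨bit', hfilter⟩ := filter_loop w R (R nc) sat pos 0 ⟨j, hj⟩ (clauseSymbols l) [] [] []
      (clauseSymbols cs) (nc + 1) nq
    rw [halfSymbols_clauseSymbols, List.append_nil] at hfilter
    have hrestore := restore_loop w R bit' sat pos 0 ⟨j, hj⟩
      (clauseSymbols (half (R nc) l)).reverse [] [] (clauseSymbols cs) [] (nc + 1) nq
    rw [List.length_reverse, List.countP_reverse, countP_clauseSymbols, Nat.zero_add,
      List.reverse_reverse, List.append_nil] at hrestore
    have key := ih' (R nc) ((half_sublist _ l).trans hl) hle bit' sat pos (nc + 1)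
    rw [hstart]
    have hR : (fun i => R (nc + (i + 1))) = fun i => R (nc + 1 + i) := by
      funext i; congr 1; omega
    rw [hR]
    have h₁ := clauseSymbols_sublist hl
    have h₂ := clauseSymbols_sublist ((half_sublist (R nc) l).trans hl)
    refine ((((((key.prepend (m := 1) ?_).prepend hrestore).prepend (m := 1) ?_).prepend
      hfilter).prepend (m := 1) ?_).mono ?_ (by omega) le_rfl)
    · exact step_restore_nil w R _ _ _ _ _ _ _ _ _
    · exact step_filter_nil w R _ _ _ _ _ _ _ _ _ _ _
    · exact step_toss w R _ _ _ _ _ _ _ _ _ _ _ _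
    · have h₃ := length_half (R nc) l
      have h₄ : (half (R nc) l).length + 1 ≤ l.length := by omega
      have h₅ := Nat.mul_le_mul_right (2 * (clauseSymbols cs).length + 3) h₄
      rw [Nat.succ_mul] at h₅
      simp only [pickTime]
      omega

theorem round_halts (hcs : ∀ c ∈ cs, c.length ≤ 3) {j : ℕ} (hj : j < k + 1)
    (ih : RoundsHalt w R k cs j) (bit sat pos : Bool) (nc nq : ℕ) :
    HaltsWithin (sampler k) w R
      ((clauseSymbols cs).length + 1 + pickTime (clauseSymbols cs).length (clauseSymbols cs).length
        + j * roundTime (clauseSymbols cs).length)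
      (sampCfg .spread ⟨none, bit, 0, sat, pos, ⟨j, hj⟩⟩ [] [] (clauseSymbols cs).reverse [] []
        nc nq)
      ((clauseTrials (fun i => w.getD i false) cs (j + 1)).eval fun i => R (nc + i))
      (nc + (j + 1) * Nat.clog 2 cs.length) (nq + 3 * (j + 1)) := by
  have hspread := spread_loop w R bit sat pos 0 ⟨j, hj⟩ (clauseSymbols cs).reverse [] [] [] []
    nc nq
  rw [List.length_reverse, List.countP_reverse, countP_clauseSymbols, Nat.zero_add,
    List.reverse_reverse, List.append_nil] at hspread
  have key := pick_halts w R hcs hj ih cs (List.Sublist.refl _)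
    (Nat.le_pow_clog (by omega) cs.length) bit sat pos nc nq
  refine ((key.prepend (m := 1) ?_).prepend hspread).mono ?_ ?_ le_rfl
  · exact step_spread_nil w R _ _ _ _ _ _ _ _ _
  · have := Nat.mul_le_mul_right (2 * (clauseSymbols cs).length + 3) (length_le_clauseSymbols cs)
    simp only [pickTime]
    omega
  · rw [Nat.succ_mul]
    omega

theorem rounds_halt (hcs : ∀ c ∈ cs, c.length ≤ 3) (j : ℕ) : RoundsHalt w R k cs j := by
  induction j with
  | zero =>
    intro hj bit sat pos n nc nq
    have h0 : HaltsWithin (sampler k) w R 0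
        (sampAfter (nextRound k) ⟨none, bit, n, sat, pos, ⟨0, hj⟩⟩ (clauseSymbols cs) [] nc nq)
        true nc nq := ⟨rfl, rfl, le_rfl, le_rfl⟩
    exact h0.mono (Nat.zero_le _) (by omega) (by omega)
  | succ j ih =>
    intro hj bit sat pos n nc nq
    have hstart : sampAfter (nextRound k) ⟨none, bit, n, sat, pos, ⟨j + 1, hj⟩⟩
        (clauseSymbols cs) [] nc nq =
        sampCfg .gather ⟨none, bit, n, sat, pos, ⟨j, by omega⟩⟩ [] [] [] (clauseSymbols cs) []
          nc nq := rfl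
    have hgather := gather_loop (k := k) w R bit sat pos n ⟨j, by omega⟩ (clauseSymbols cs)
      [] [] [] [] nc nq
    rw [List.append_nil] at hgather
    rw [hstart]
    refine (((round_halts (k := k) w R hcs (j := j) (by omega) ih bit sat pos nc nq).prepend
      (m := 1) ?_).prepend hgather).mono ?_ le_rfl le_rfl
    · exact step_gather_nil w R _ _ _ _ _ _ _ _ _ _ _
    · rw [Nat.succ_mul]
      simp only [roundTime]
      omega

theorem sampler_init (y : List Bool) :
    (⟨initList (sampler k).tm (y.map (sampler k).inputAlphabet.symm), 0, 0⟩ : (sampler k).Cfg) =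
      sampCfg .parse ⟨none, false, 0, false, false, Fin.last k⟩ y [] [] [] [] 0 0 := by
  have hy : y.map (sampler k).inputAlphabet.symm = y := List.map_id y
  refine OracleTM.cfg_ext rfl rfl (fun i => ?_) rfl rfl
  refine (congrFun (initList_stk (sampler k).tm (y.map (sampler k).inputAlphabet.symm)) i).trans ?_
  rw [hy]
  cases i <;> rfl

end Loops

/-- The sampling verifier on the encoding of a formula performs the clause trials. -/
theorem sampler_run (k : ℕ) : ∃ p : Polynomial ℕ, ∀ (φ : ThreeCNF) (w : List Bool) (R : ℕ → Bool),
    ((sampler k).run φ.encode w R (p.eval φ.encode.length)).cfg.l = none ∧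
    ((sampler k).Accepts φ.encode w R ↔
      (clauseTrials (fun i => w.getD i false) φ.clauses k).eval R = true) ∧
    ∀ t, ((sampler k).run φ.encode w R t).coins ≤ k * Nat.clog 2 φ.clauses.length ∧
      ((sampler k).run φ.encode w R t).queries ≤ 3 * k := by
  obtain ⟨p, hp⟩ : PolyBounded fun n => (k + 1) * roundTime n := by
    have h₁ := (((PolyBounded.const 2).mul .id).add (.const 3))
    have h₂ := ((PolyBounded.id.mul h₁).add (((PolyBounded.const 2).mul .id).add (.const 1)))
    exact (PolyBounded.const (k + 1)).mul ((h₂.add ((PolyBounded.const 2).mul .id)).add (.const 2))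
  refine ⟨p, fun φ w R => ?_⟩
  have hcode : φ.encode = symbolBits (clauseSymbols φ.clauses) :=
    (symbolBits_clauseSymbols _).symm
  have key : HaltsWithin (sampler k) w R (p.eval φ.encode.length)
      (sampCfg .parse ⟨none, false, 0, false, false, Fin.last k⟩ φ.encode [] [] [] [] 0 0)
      ((clauseTrials (fun i => w.getD i false) φ.clauses k).eval R)
      (k * Nat.clog 2 φ.clauses.length) (3 * k) := by
    have hN : (clauseSymbols φ.clauses).length ≤ φ.encode.length := by
      rw [hcode, length_symbolBits]; omega
    have htime : (k + 1) * roundTime (clauseSymbols φ.clauses).length ≤ p.eval φ.encode.length :=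
      (hp _).trans (eval_le_eval p hN)
    have hparse := parse_loop w R false false false 0 (Fin.last k) (clauseSymbols φ.clauses) [] []
      [] [] 0 0
    rw [List.append_nil] at hparse
    rw [hcode] at htime ⊢
    rw [Nat.succ_mul] at htime
    refine HaltsWithin.mono (HaltsWithin.prepend (n := k * roundTime
      (clauseSymbols φ.clauses).length + (clauseSymbols φ.clauses).length + 2) ?_ hparse)
      (by simp only [roundTime, pickTime] at htime ⊢; omega) le_rfl le_rfl
    cases k with
    | zero =>
      have h0 : HaltsWithin (sampler 0) w R 1 (sampCfg .parse
          ⟨none, false, 0, false, false, Fin.last 0⟩ [] [] (clauseSymbols φ.clauses).reverse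
          [] [] 0 0) true 0 0 := ⟨rfl, rfl, le_rfl, le_rfl⟩
      exact h0.mono (by omega) (Nat.zero_le _) (Nat.zero_le _)
    | succ k =>
      have h := round_halts (k := k + 1) w R φ.length_le_three (j := k) (by omega)
        (rounds_halt w R φ.length_le_three k) false false false 0 0
      simp only [Nat.zero_add] at h
      refine (h.prepend (m := 2) ?_).mono ?_ le_rfl le_rfl
      · exact OracleTM.cfg_ext rfl rfl (fun i => by cases i <;> rfl) rfl rfl
      · rw [Nat.succ_mul]
        simp only [roundTime]
        omega
  have hrun : ∀ t, (sampler k).run φ.encode w R t = ((sampler k).step w R)^[t]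
      (sampCfg .parse ⟨none, false, 0, false, false, Fin.last k⟩ φ.encode [] [] [] [] 0 0) := by
    intro t
    rw [← sampler_init]
    rfl
  unfold HaltsWithin at key
  rw [← hrun] at key
  obtain ⟨h₁, h₂, h₃, h₄⟩ := key
  refine ⟨h₁, ?_, fun t => ?_⟩
  · rw [(sampler k).accepts_iff_of_halted _ _ _ h₁, h₂]
  · rcases le_total t (p.eval φ.encode.length) with h | h
    · exact ⟨((sampler k).monotone_coins _ _ _ h).trans h₃,
        ((sampler k).monotone_queries _ _ _ h).trans h₄⟩
    · rw [(sampler k).run_eq_of_halted _ _ _ h h₁]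
      exact ⟨h₃, h₄⟩

/-! ### Languages with a gap reduction -/

theorem isBigOOne_iff {q : ℕ → ℕ} : IsBigOOne q ↔ ∃ c, ∀ n, q n ≤ c := by
  constructor
  · intro h
    obtain ⟨C, hC⟩ := h.bound
    obtain ⟨n₀, hn₀⟩ := Filter.eventually_atTop.1 hC
    refine ⟨⌈C⌉₊ + (Finset.range n₀).sup q, fun n => ?_⟩
    by_cases hn : n < n₀
    · have h₁ : q n ≤ (Finset.range n₀).sup q := Finset.le_sup (f := q) (Finset.mem_range.2 hn)
      omega
    · have h₁ := hn₀ n (not_lt.1 hn)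
      rw [Real.norm_of_nonneg (Nat.cast_nonneg _), norm_one, mul_one] at h₁
      have h₂ : q n ≤ ⌈C⌉₊ := by exact_mod_cast h₁.trans (Nat.le_ceil C)
      omega
  · rintro ⟨c, hc⟩
    refine Asymptotics.IsBigO.of_bound c (Filter.Eventually.of_forall fun n => ?_)
    rw [Real.norm_of_nonneg (Nat.cast_nonneg _), norm_one, mul_one]
    exact_mod_cast hc n

/-- `PCP` is closed under polynomial-time preprocessing: it is enough that a machine `V` decides
`L` with the given resources when it is started on `f x` in place of `x`. -/
theorem mem_PCP_of_precompose {β : Type} {eb : β → List Bool} {f : List Bool → β}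
    (hf : PolyTimeComputable id eb f) {V : OracleTM} {L : Language Bool} {p : Polynomial ℕ}
    (hp : ∀ x w R, (V.run (eb (f x)) w R (p.eval (eb (f x)).length)).cfg.l = none)
    {s q : ℕ → ℕ} {d : ℕ} (hs : ∀ n, s n ≤ d * Nat.clog 2 (n + 2))
    (hcoins : ∀ x w R t, (V.run (eb (f x)) w R t).coins ≤ s (eb (f x)).length)
    (hqueries : ∀ x w R t, (V.run (eb (f x)) w R t).queries ≤ q x.length)
    (hmem : ∀ x ∈ L, ∃ w, ∀ R, V.Accepts (eb (f x)) w R)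
    (hnot : ∀ x ∉ L, ∀ w, V.acceptProb (s (eb (f x)).length) (eb (f x)) w ≤ 1 / 2) :
    ∃ r, IsBigOLog r ∧ L ∈ PCP r q := by
  obtain ⟨V', p', hV'⟩ := exists_precompose hf V
  have hlog : ∀ x, s (eb (f x)).length ≤ d * Nat.clog 2 (p'.eval x.length + 2) := fun x =>
    (hs _).trans (Nat.mul_le_mul_left d (Nat.clog_mono_right 2
      (Nat.add_le_add_right (hV' x).1 2)))
  refine ⟨fun n => d * Nat.clog 2 (p'.eval n + 2), ?_, V', ?_, ?_, fun x => ⟨fun hx => ?_,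
    fun hx w => ?_⟩⟩
  · obtain ⟨e, he⟩ := exists_clog_le ((PolyBounded.eval p').add (PolyBounded.const 2))
    exact isBigOLog_iff.2 ⟨d * e, fun n => by
      rw [mul_assoc]; exact Nat.mul_le_mul_left d (he n)⟩
  · refine ⟨p' + p.comp p', fun x w R => ?_⟩
    obtain ⟨hlen, t₀, ht₀, h⟩ := hV' x
    have h₁ := ((h w R).1 _).2 (hp x w R)
    rw [V'.run_eq_of_halted x w R ?_ h₁]
    · exact h₁
    · rw [Polynomial.eval_add, Polynomial.eval_comp]
      exact Nat.add_le_add ht₀ (eval_le_eval p hlen)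
  · intro x w R t
    obtain ⟨-, t₀, -, h⟩ := hV' x
    obtain ⟨h₁, h₂⟩ := (h w R).2.1 t
    exact ⟨h₁.trans ((hcoins x w R t).trans (hlog x)), h₂.trans (hqueries x w R t)⟩
  · obtain ⟨-, t₀, -, h⟩ := hV' x
    obtain ⟨w, hw⟩ := hmem x hx
    exact ⟨w, bitProb_of_forall fun R => (h w R).2.2.2 (hw R)⟩
  · obtain ⟨-, t₀, -, h⟩ := hV' x
    refine le_trans (le_of_eq ?_) (hnot x hx w)
    have hacc : V'.Accepts x w = V.Accepts (eb (f x)) w := by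
      funext R; exact propext (h w R).2.2
    rw [acceptProb_eq_bitProb, acceptProb_eq_bitProb, hacc]
    exact bitProb_eq_of_le (hlog x) fun R R' hR =>
      V.accepts_congr _ w (fun R t => hcoins x w R t) hR

theorem exists_witness_of_satisfiable {φ : ThreeCNF} (h : φ.Satisfiable) :
    ∃ w : List Bool, ∀ c ∈ φ.clauses, Clause.eval (fun i => w.getD i false) c = true := by
  obtain ⟨a, ha⟩ := h
  set N := (φ.clauses.flatten.map Literal.var).toFinset.sup id + 1 with hN
  refine ⟨(List.range N).map a, fun c hc => ?_⟩
  obtain ⟨l, hl, h⟩ := List.any_eq_true.1 (ha c hc)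
  refine List.any_eq_true.2 ⟨l, hl, ?_⟩
  have hlt : l.var < N := by
    have hmem : l.var ∈ (φ.clauses.flatten.map Literal.var).toFinset :=
      List.mem_toFinset.2 (List.mem_map_of_mem (List.mem_flatten.2 ⟨c, hc, hl⟩))
    have := Finset.le_sup (f := id) hmem
    simp only [id] at this
    omega
  simpa [Literal.eval, List.getD, hlt] using h

theorem numClauses_le_length_encode (φ : ThreeCNF) : φ.clauses.length ≤ φ.encode.length := by
  have h : φ.encode = symbolBits (clauseSymbols φ.clauses) := (symbolBits_clauseSymbols _).symm
  rw [h, length_symbolBits]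
  exact (length_le_clauseSymbols _).trans (by omega)

/-- A language with a gap reduction is decided by the reduction followed by sampling `⌈2 / ε⌉`
clauses. -/
theorem exists_PCP_of_isGapReduction {L : Language Bool} {ε : ℝ} (hε : 0 < ε)
    {f : List Bool → ThreeCNF} (hf : IsGapReduction L ε f) :
    ∃ r q : ℕ → ℕ, IsBigOLog r ∧ (∀ n, (q n : ℝ) ≤ 12 / ε) ∧ L ∈ PCP r q := by
  -- For `ε > 1` no formula has the gap, so `L` contains all strings and no round is needed.
  set k : ℕ := if ε ≤ 1 then ⌈2 / ε⌉₊ else 0 with hk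
  obtain ⟨p, hp⟩ := sampler_run k
  have hlog : ∀ n, k * Nat.clog 2 n ≤ k * Nat.clog 2 (n + 2) := fun n =>
    Nat.mul_le_mul_left k (Nat.clog_mono_right 2 (by omega))
  have hclog : ∀ φ : ThreeCNF,
      k * Nat.clog 2 φ.clauses.length ≤ k * Nat.clog 2 φ.encode.length := fun φ =>
    Nat.mul_le_mul_left k (Nat.clog_mono_right 2 (numClauses_le_length_encode φ))
  have hsound : ∀ x ∉ L, ∀ w, (sampler k).acceptProb (k * Nat.clog 2 (f x).encode.length)
      (f x).encode w ≤ 1 / 2 := by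
    intro x hx w
    obtain ⟨hm, hsat⟩ := (hf.2 x).2 hx
    have hε1 : ε ≤ 1 := by
      by_contra hlt
      have h₁ := hsat fun _ => false
      have h₂ : (1 : ℝ) ≤ (f x).numClauses := by exact_mod_cast hm
      have h₃ : (0 : ℝ) ≤ (f x).numSat fun _ => false := Nat.cast_nonneg _
      nlinarith
    have hacc : (sampler k).Accepts (f x).encode w = fun R =>
        (clauseTrials (fun i => w.getD i false) (f x).clauses k).eval R = true := by
      funext R; exact propext (hp (f x) w R).2.1
    rw [acceptProb_eq_bitProb, hacc,
      CoinTree.bitProb_eval _ ((depth_clauseTrials _ _ _).trans (hclog _))]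
    refine prob_clauseTrials_le_half hε hm (hsat _) ?_
    rw [hk, if_pos hε1]
    exact Nat.le_ceil _
  obtain ⟨r, hr, hL⟩ := mem_PCP_of_precompose (L := L) (q := fun _ => 3 * k) hf.1
    (fun x w R => (hp (f x) w R).1) hlog
    (fun x w R t => ((hp (f x) w R).2.2 t).1.trans (hclog _))
    (fun x w R t => ((hp (f x) w R).2.2 t).2)
    (fun x hx => by
      obtain ⟨w, hw⟩ := exists_witness_of_satisfiable ((hf.2 x).1 hx)
      exact ⟨w, fun R => (hp (f x) w R).2.1.2 (eval_clauseTrials hw k R)⟩)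
    hsound
  refine ⟨r, _, hr, fun _ => ?_, hL⟩
  rw [hk]
  split
  · next h =>
    have h₁ := Nat.ceil_lt_add_one (R := ℝ) (a := 2 / ε) (by positivity)
    have h₂ : (1 : ℝ) ≤ 2 / ε := by rw [le_div_iff₀ hε]; linarith
    push_cast
    have h₃ : 12 / ε = 3 * (2 / ε + 2 / ε) := by ring
    rw [h₃]
    linarith
  · simp only [mul_zero, Nat.cast_zero]
    positivity

theorem mem_PCPLogConst_of_reducesTo {L L' : Language Bool} (h : ReducesTo L' L)
    (hL : L ∈ PCPLogConst) : L' ∈ PCPLogConst := by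
  obtain ⟨f, hf, hLf⟩ := h
  obtain ⟨r, q, hr, hq, V, ⟨p, hp⟩, hres, hV⟩ := hL
  obtain ⟨d, hd⟩ := isBigOLog_iff.1 hr
  obtain ⟨c, hc⟩ := isBigOOne_iff.1 hq
  obtain ⟨r', hr', hL'⟩ := mem_PCP_of_precompose (L := L') (q := fun _ => c) hf
    (fun x w R => hp (f x) w R) hd (fun x w R t => (hres (f x) w R t).1)
    (fun x w R t => (hres (f x) w R t).2.trans (hc _))
    (fun x hx => by
      obtain ⟨w, hw⟩ := (hV (f x)).1 ((hLf x).1 hx)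
      refine ⟨w, fun R => ?_⟩
      rw [acceptProb_eq_bitProb] at hw
      exact (V.accepts_congr (f x) w (fun R t => (hres (f x) w R t).1)
        fun i hi => padBits_of_lt hi R).1 (forall_of_bitProb_eq_one hw fun i => R i))
    (fun x hx => (hV (f x)).2 fun h => hx ((hLf x).2 h))
  exact ⟨r', fun _ => c, hr', isBigOOne_iff.2 ⟨c, fun _ => le_rfl⟩, hL'⟩

/-! ### Tables of oracle answers -/

/-- The answer of a table to the query `n`. The table is a string of symbols: `(true, b)` is a bit
of the position of the current entry, least significant bit first, and `(false, b)` ends an entry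
with the answer `b`. The number `cur` is what is left to be compared with the current entry, and
`ok` says whether the comparison was successful so far. -/
def lookup (n : ℕ) : List Symb → ℕ → Bool → Bool
  | [], _, _ => false
  | (true, b) :: ts, cur, ok => lookup n ts (cur / 2) (ok && (decide (cur % 2 = 1) == b))
  | (false, b) :: ts, cur, ok => if ok && decide (cur = 0) then b else lookup n ts n true

theorem lookup_lt {n : ℕ} {ts : List Symb} {cur : ℕ} {ok : Bool}
    (h : lookup n ts cur ok = true) : cur < 2 ^ ts.length ∨ n < 2 ^ ts.length := by
  induction ts generalizing cur ok with
  | nil => cases h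
  | cons x ts ih =>
    rw [List.length_cons, pow_succ]
    obtain ⟨_ | _, b⟩ := x
    · rw [lookup] at h
      split at h
      · next h' =>
        rw [Bool.and_eq_true, decide_eq_true_iff] at h'
        left
        have : 0 < 2 ^ ts.length := by positivity
        omega
      · rcases ih h with h | h <;> right <;> omega
    · rcases ih h with h | h
      · left; omega
      · right; omega

/-- The oracle word described by a table. -/
def tableWord (ts : List Symb) : List Bool :=
  (List.range (2 ^ ts.length)).map fun n => lookup n ts n true

theorem tableWord_getD (ts : List Symb) (n : ℕ) :
    (tableWord ts).getD n false = lookup n ts n true := by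
  by_cases h : n < 2 ^ ts.length
  · simp [tableWord, List.getD, h]
  · have h' : lookup n ts n true = false := by
      by_contra hne
      rcases lookup_lt (Bool.eq_true_of_not_eq_false hne) with h' | h' <;> exact h h'
    simp [tableWord, List.getD, h, h']

/-- The entry of a table with position `n` and answer `b`. -/
def tableEntry (n : ℕ) (b : Bool) : List Symb :=
  (Nat.bits n).map (fun d => (true, d)) ++ [(false, b)]

/-- The number with the given binary digits, least significant digit first. -/
def bitsVal (l : List Bool) : ℕ := Nat.ofDigits 2 (l.map Bool.toNat)

theorem bitsVal_cons (b : Bool) (l : List Bool) : bitsVal (b :: l) = b.toNat + 2 * bitsVal l := by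
  simp [bitsVal, Nat.ofDigits_cons]

theorem bitsVal_lt (l : List Bool) : bitsVal l < 2 ^ l.length := by
  induction l with
  | nil => simp [bitsVal]
  | cons b l ih =>
    rw [bitsVal_cons, List.length_cons, pow_succ]
    have := Bool.toNat_lt b
    omega

theorem bitsVal_div_two (l : List Bool) : bitsVal l / 2 = bitsVal l.tail := by
  cases l with
  | nil => rfl
  | cons b l =>
    rw [bitsVal_cons, List.tail_cons]
    have := Bool.toNat_lt b
    omega

theorem bitsVal_mod_two (l : List Bool) : decide (bitsVal l % 2 = 1) = l.headD false := by
  cases l with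
  | nil => rfl
  | cons b l =>
    rw [bitsVal_cons, List.headD_cons]
    cases b <;> simp

theorem all_not_eq_bitsVal (l : List Bool) : l.all (!·) = decide (bitsVal l = 0) := by
  induction l with
  | nil => rfl
  | cons b l ih =>
    rw [List.all_cons, ih, bitsVal_cons]
    cases b <;> simp

theorem lookup_data_append (n : ℕ) (l : List Bool) (b : Bool) (ts : List Symb) (cur : ℕ)
    (ok : Bool) :
    lookup n (l.map (fun d => (true, d)) ++ (false, b) :: ts) cur ok =
      if ok && decide (cur = bitsVal l) then b else lookup n ts n true := by
  induction l generalizing cur ok with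
  | nil => rfl
  | cons d l ih =>
    rw [List.map_cons, List.cons_append, lookup, ih, bitsVal_cons]
    congr 2
    rw [Bool.and_assoc]
    congr 1
    rw [Bool.eq_iff_iff]
    cases d <;> simp <;> omega

theorem lookup_tableEntry_append (n m : ℕ) (b : Bool) (ts : List Symb) :
    lookup n (tableEntry m b ++ ts) n true = if n = m then b else lookup n ts n true := by
  have hm : bitsVal (Nat.bits m) = m := ofDigits_bits m
  rw [tableEntry, List.append_assoc, List.singleton_append, lookup_data_append, hm]
  simp

/-- A table that agrees with a word on given positions. -/
theorem lookup_flatMap_tableEntry (w : List Bool) (l : List ℕ) {n : ℕ} (hn : n ∈ l) :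
    lookup n (l.flatMap fun m => tableEntry m (w.getD m false)) n true = w.getD n false := by
  induction l with
  | nil => cases hn
  | cons m l ih =>
    rw [List.flatMap_cons, lookup_tableEntry_append]
    split
    · next h => rw [h]
    · next h => exact ih ((List.mem_cons.1 hn).resolve_left h)

theorem length_tableEntry_le {n s : ℕ} (b : Bool) (h : n < 2 ^ s) :
    (tableEntry n b).length ≤ s + 1 := by
  have : (Nat.bits n).length ≤ s := by
    rw [Nat.size_eq_bits_len]
    exact Nat.size_le.2 h
  simp only [tableEntry, List.length_append, List.length_map, List.length_singleton]
  omega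

theorem length_flatMap_le {α β : Type} {f : α → List β} {l : List α} {c : ℕ}
    (h : ∀ a ∈ l, (f a).length ≤ c) : (l.flatMap f).length ≤ l.length * c := by
  induction l with
  | nil => simp
  | cons a l ih =>
    rw [List.flatMap_cons, List.length_append, List.length_cons, Nat.succ_mul]
    have h₁ := h a List.mem_cons_self
    have h₂ := ih fun b hb => h b (List.mem_cons_of_mem _ hb)
    omega

/-- The symbols that a string of bits stands for; a last single bit is ignored. -/
def pairUp : List Bool → List Symb
  | b :: c :: l => (b, c) :: pairUp l
  | _ => []

theorem pairUp_symbolBits (s : List Symb) : pairUp (symbolBits s) = s := by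
  induction s with
  | nil => rfl
  | cons x s ih =>
    have : symbolBits (x :: s) = x.1 :: x.2 :: symbolBits s := rfl
    rw [this, pairUp, ih]

theorem length_pairUp_le (l : List Bool) : (pairUp l).length ≤ l.length := by
  match l with
  | [] => simp [pairUp]
  | [_] => simp [pairUp]
  | _ :: _ :: l =>
    have := length_pairUp_le l
    simp only [pairUp, List.length_cons]
    omega

/-! ### The order of coin strings -/

/-- The first `r` coins, read as a binary number whose first digit is the most significant. -/
def coinVal : ℕ → (ℕ → Bool) → ℕ
  | 0, _ => 0
  | r + 1, R => (R 0).toNat * 2 ^ r + coinVal r fun i => R (i + 1)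

/-- A finite coin string, followed by zeros. -/
def padCoins (p : List Bool) (i : ℕ) : Bool := p.getD i false

theorem coinVal_lt (r : ℕ) (R : ℕ → Bool) : coinVal r R < 2 ^ r := by
  induction r generalizing R with
  | zero => simp [coinVal]
  | succ r ih =>
    have := ih fun i => R (i + 1)
    rw [coinVal, pow_succ]
    cases R 0 <;> simp <;> omega

theorem padCoins_cons_succ (b : Bool) (p : List Bool) :
    (fun i => padCoins (b :: p) (i + 1)) = padCoins p := by
  funext i
  simp [padCoins]

theorem coinVal_cons (r : ℕ) (b : Bool) (p : List Bool) :
    coinVal (r + 1) (padCoins (b :: p)) = b.toNat * 2 ^ r + coinVal r (padCoins p) := by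
  rw [coinVal, padCoins_cons_succ]
  rfl

theorem coinVal_nil (r : ℕ) : coinVal r (padCoins []) = 0 := by
  induction r with
  | zero => rfl
  | succ r ih =>
    have h : (fun i => padCoins [] (i + 1)) = padCoins [] := rfl
    rw [coinVal, h, ih]
    simp [padCoins]

/-- The coin strings that start with `u` are those whose value lies in an interval of length
`2 ^ (r - u.length)`. -/
theorem eq_of_coinVal {r : ℕ} {u : List Bool} (hu : u.length ≤ r) {R : ℕ → Bool}
    (h₁ : coinVal r (padCoins u) ≤ coinVal r R)
    (h₂ : coinVal r R < coinVal r (padCoins u) + 2 ^ (r - u.length)) :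
    ∀ i < u.length, R i = padCoins u i := by
  induction u generalizing r R with
  | nil => intro i hi; simp at hi
  | cons b u ih =>
    obtain ⟨r, rfl⟩ : ∃ r', r = r' + 1 := ⟨r - 1, by simp at hu; omega⟩
    rw [List.length_cons] at hu h₂
    have hsub : r + 1 - (u.length + 1) = r - u.length := by omega
    rw [coinVal_cons, hsub] at h₂
    rw [coinVal_cons] at h₁
    rw [coinVal] at h₁ h₂
    have hv := coinVal_lt r fun i => R (i + 1)
    have hu' : coinVal r (padCoins u) + 2 ^ (r - u.length) ≤ 2 ^ r := by
      clear ih h₁ h₂ hv hsub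
      have hu : u.length ≤ r := by omega
      induction u generalizing r with
      | nil => simp [coinVal_nil]
      | cons c u ih =>
        obtain ⟨r, rfl⟩ : ∃ r', r = r' + 1 := ⟨r - 1, by simp at hu; omega⟩
        rw [List.length_cons] at hu
        have := ih (r := r) (by simp; omega) (by omega)
        have hsub : r + 1 - (u.length + 1) = r - u.length := by omega
        rw [coinVal_cons, List.length_cons, hsub, pow_succ]
        cases c <;> simp <;> omega
    have hb : R 0 = b := by
      cases hR : R 0 <;> cases b <;>
        simp only [hR, Bool.toNat_true, Bool.toNat_false] at h₁ h₂ ⊢ <;> omega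
    rw [hb] at h₁ h₂
    intro i hi
    cases i with
    | zero => exact hb
    | succ i =>
      have := ih (r := r) (R := fun i => R (i + 1)) (by omega) (by omega) (by omega) i
        (by simpa using hi)
      rw [this, ← congrFun (padCoins_cons_succ b u) i]

/-- A coin string lies in the interval of each of its prefixes. -/
theorem coinVal_prefix (R : ℕ → Bool) {c r : ℕ} (hc : c ≤ r) :
    coinVal r (padCoins ((List.range c).map R)) ≤ coinVal r R ∧
    coinVal r R < coinVal r (padCoins ((List.range c).map R)) + 2 ^ (r - c) := by
  induction c generalizing r R with
  | zero => simpa [coinVal_nil] using coinVal_lt r R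
  | succ c ih =>
    obtain ⟨r, rfl⟩ : ∃ r', r = r' + 1 := ⟨r - 1, by omega⟩
    have hmap : (List.range (c + 1)).map R = R 0 :: (List.range c).map fun i => R (i + 1) := by
      rw [List.range_succ_eq_map, List.map_cons, List.map_map]
      rfl
    have hsub : r + 1 - (c + 1) = r - c := by omega
    obtain ⟨h₁, h₂⟩ := ih (fun i => R (i + 1)) (r := r) (by omega)
    rw [hmap, coinVal_cons, coinVal, hsub]
    omega

theorem coinVal_append_singleton {r : ℕ} (l : List Bool) (hl : l.length < r) (b : Bool) :
    coinVal r (padCoins (l ++ [b])) =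
      coinVal r (padCoins l) + b.toNat * 2 ^ (r - (l.length + 1)) := by
  induction l generalizing r with
  | nil =>
    obtain ⟨r, rfl⟩ : ∃ r', r = r' + 1 := ⟨r - 1, by simp at hl; omega⟩
    rw [List.nil_append, coinVal_cons, coinVal_nil, coinVal_nil]
    simp
  | cons a l ih =>
    rw [List.length_cons] at hl
    obtain ⟨r, rfl⟩ : ∃ r', r = r' + 1 := ⟨r - 1, by omega⟩
    rw [List.cons_append, coinVal_cons, coinVal_cons, ih (by omega), List.length_cons]
    have : r + 1 - (l.length + 1 + 1) = r - (l.length + 1) := by omega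
    rw [this]
    omega

/-- The successor of a coin string, which is given with its last coin first: the first string
after all those that start with it. There is none after a string of ones. -/
def nextCoins : List Bool → Option (List Bool)
  | [] => none
  | true :: p => nextCoins p
  | false :: p => some (p.reverse ++ [true])

theorem nextCoins_none {r : ℕ} {p : List Bool} (hp : p.length ≤ r) (h : nextCoins p = none) :
    coinVal r (padCoins p.reverse) + 2 ^ (r - p.length) = 2 ^ r := by
  induction p with
  | nil => simp [coinVal_nil]
  | cons b p ih =>
    rw [List.length_cons] at hp
    cases b with
    | false => cases h
    | true =>
      have := ih (by omega) h
      rw [List.reverse_cons, coinVal_append_singleton _ (by simpa using hp), List.length_cons,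
        List.length_reverse]
      have h2 : 2 ^ (r - p.length) = 2 * 2 ^ (r - (p.length + 1)) := by
        rw [← pow_succ']; congr 1; omega
      simp only [Bool.toNat_true]
      omega

theorem nextCoins_some {r : ℕ} {p p' : List Bool} (hp : p.length ≤ r) (h : nextCoins p = some p') :
    p'.length ≤ p.length ∧
      coinVal r (padCoins p') = coinVal r (padCoins p.reverse) + 2 ^ (r - p.length) := by
  induction p with
  | nil => cases h
  | cons b p ih =>
    rw [List.length_cons] at hp
    rw [List.reverse_cons, coinVal_append_singleton _ (by simpa using hp), List.length_cons,
      List.length_reverse]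
    cases b with
    | false =>
      obtain rfl := Option.some.inj h
      rw [coinVal_append_singleton _ (by simpa using hp), List.length_reverse]
      simp
    | true =>
      obtain ⟨h₁, h₂⟩ := ih (by omega) h
      have h2 : 2 ^ (r - p.length) = 2 * 2 ^ (r - (p.length + 1)) := by
        rw [← pow_succ']; congr 1; omega
      simp only [Bool.toNat_true]
      omega

/-! ### The deterministic checker -/

/-- The stacks of the checker besides those of the machine that it simulates: the input, the string
`x` in two copies (one reversed), the table in two parts (one reversed), the query and its part
already compared (reversed), the coins that are prescribed and those already tossed (reversed),
and the output. -/
inductive CheckStack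
  | inp
  | src
  | cpy
  | tbl
  | tblRev
  | qa
  | qb
  | fut
  | past
  | out
  deriving DecidableEq

instance : Fintype CheckStack :=
  ⟨{.inp, .src, .cpy, .tbl, .tblRev, .qa, .qb, .fut, .past, .out}, fun i => by cases i <;> simp⟩

/-- The alphabets of these stacks. -/
abbrev CheckSymb : CheckStack → Type
  | .inp => Bool ⊕ Bool
  | .tbl => Symb
  | .tblRev => Symb
  | _ => Bool

/-- The contents of the stacks of the checker besides those of the simulated machine. -/
structure CheckAux where
  inp : List (Bool ⊕ Bool)
  src : List Bool
  cpy : List Bool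
  tbl : List Symb
  tblRev : List Symb
  qa : List Bool
  qb : List Bool
  fut : List Bool
  past : List Bool
  out : List Bool

/-- The contents, stack by stack. -/
def CheckAux.stk (A : CheckAux) : ∀ j, List (CheckSymb j)
  | .inp => A.inp
  | .src => A.src
  | .cpy => A.cpy
  | .tbl => A.tbl
  | .tblRev => A.tblRev
  | .qa => A.qa
  | .qb => A.qb
  | .fut => A.fut
  | .past => A.past
  | .out => A.out

/-- The phases of a table lookup: the query is moved to the checker's own stack and turned over;
it is compared with the next entry; at the end of an entry it must have no digit `1` left; it is
put back; finally the table is restored and the query erased. -/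
inductive LookPhase
  | unload
  | turn
  | compare
  | rest
  | back
  | restore
  | drain
  deriving DecidableEq

instance : Fintype LookPhase :=
  ⟨{.unload, .turn, .compare, .rest, .back, .restore, .drain}, fun i => by cases i <;> simp⟩

/-- The phases of the checker outside the simulation: the input is parsed; `x` is copied to the
simulated machine; after an accepting run, its stacks are cleared, the next coin string is computed
and `x` is put back; finally all stacks are cleared and the verdict is written. -/
inductive CheckPhase
  | parse
  | spread
  | clear
  | next
  | rewind
  | gather
  | finish
  deriving DecidableEq

instance : Fintype CheckPhase :=
  ⟨{.parse, .spread, .clear, .next, .rewind, .gather, .finish}, fun i => by cases i <;> simp⟩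

section Checker

variable (M : OracleTM)

/-- The internal state of the checker: the state of the simulated machine, the symbol just read,
the last answer found in the table, whether the current comparison was successful so far, whether
some stack was not yet empty, and the verdict. -/
structure CheckState where
  v : M.tm.σ
  reg : Option Symb
  bit : Bool
  ok : Bool
  flag : Bool
  ver : Bool

noncomputable instance : Fintype (CheckState M) :=
  haveI := M.tm.σFin
  Fintype.ofInjective (fun s : CheckState M => (s.v, s.reg, s.bit, s.ok, s.flag, s.ver))
    fun s s' h => by
      cases s
      cases s'
      simpa using h

/-- The labels of the checker: those of the simulated machine, the phases of the lookup of a query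
made at one of them, and the other phases. -/
abbrev CheckLabel : Type := M.tm.Λ ⊕ ((M.tm.Λ × LookPhase) ⊕ CheckPhase)

/-- The stack alphabets of the checker. -/
abbrev CheckSymbols : M.tm.K ⊕ CheckStack → Type := Sum.elim M.tm.Γ CheckSymb

abbrev CheckStmt : Type := TM2.Stmt (CheckSymbols M) (CheckLabel M) (CheckState M)

variable {M}

namespace CheckState

def readBit (s : CheckState M) (a : Option Bool) : CheckState M :=
  { s with reg := a.map fun b => (b, false) }

def read (s : CheckState M) (a : Option Symb) : CheckState M := { s with reg := a }

def isSome (s : CheckState M) : Bool := s.reg.isSome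

def symb (s : CheckState M) : Symb := s.reg.getD (false, false)

def first (s : CheckState M) : Bool := s.symb.1

/-- Read a digit of the query, a missing one being `0`, and compare it with that of the entry. -/
def compareBit (s : CheckState M) (a : Option Bool) : CheckState M :=
  { s with reg := a.map fun b => (b, false), ok := s.ok && (a.getD false == s.symb.2) }

/-- Read a digit of the query which has to be `0`, since the entry has no digits left. -/
def checkZero (s : CheckState M) (a : Option Bool) : CheckState M :=
  { s with reg := a.map fun b => (b, false), ok := s.ok && !(a.getD false) }

def clear (s : CheckState M) : CheckState M := { s with reg := none }

end CheckState

open CheckState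

/-- The label of a phase of the checker. -/
abbrev ctl (p : CheckPhase) : CheckLabel M := .inr (.inr p)

/-- The label of a phase of the lookup of the query made at the label `l`. -/
abbrev look (l : M.tm.Λ) (p : LookPhase) : CheckLabel M := .inr (.inl (l, p))

/-- Move a bit to the stack `j`, and go on at the label `l`. -/
def moveBit (j : CheckStack) (h : CheckSymb j = Bool) (l : CheckLabel M) : CheckStmt M :=
  .push (.inr j) (fun s => cast h.symm s.first) <| .load clear <| .goto fun _ => l

/-- Pop all the stacks of a list, and note in `flag` whether one of them was not empty. -/
def popAll (ks : List (M.tm.K ⊕ CheckStack)) (q : CheckStmt M) : CheckStmt M :=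
  ks.foldr (fun k q => .pop k (fun s a => { s with flag := s.flag || a.isSome }) q) q

variable (M)

/-- What the checker does when the simulated machine halts. -/
def simEnd : CheckStmt M :=
  .goto fun s => if M.accept s.v then ctl .clear else ctl .finish

/-- A step of the simulated machine. -/
def simStmt (l : M.tm.Λ) : CheckStmt M :=
  liftStmt (Γ' := CheckSymbols M) (σ := M.tm.σ) Sum.inl (fun s => s.v)
    (fun s v => { s with v := v }) Sum.inl (simEnd M) (M.tm.m l)

/-- The stacks cleared between two simulations. -/
noncomputable def simStacks : List (M.tm.K ⊕ CheckStack) :=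
  haveI := M.tm.kFin
  .inr .fut :: (Finset.univ : Finset M.tm.K).toList.map .inl

/-- All stacks of the checker, which are cleared at the end. -/
noncomputable def allStacks : List (M.tm.K ⊕ CheckStack) :=
  haveI := M.tm.kFin
  (Finset.univ : Finset (M.tm.K ⊕ CheckStack)).toList

/-- The program of the table lookup at the label `l`. -/
def lookProgram (l : M.tm.Λ) : LookPhase → CheckStmt M
  | .unload =>
    .pop (.inl M.tm.k₁) (fun s a => s.readBit (a.map M.queryAlphabet)) <|
    .branch isSome (moveBit .qb rfl (look l .unload)) (.goto fun _ => look l .turn)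
  | .turn =>
    .pop (.inr .qb) readBit <|
    .branch isSome (moveBit .qa rfl (look l .turn))
      (.load (fun s => { s with ok := true }) <| .goto fun _ => look l .compare)
  | .compare =>
    .pop (.inr .tbl) read <|
    .branch isSome
      (.push (.inr .tblRev) symb <|
        .branch first
          (.pop (.inr .qa) compareBit <|
            .branch isSome (moveBit .qb rfl (look l .compare)) (.goto fun _ => look l .compare))
          (.load (fun s => { s with reg := none, bit := s.symb.2 }) <| .goto fun _ => look l .rest))
      (.goto fun _ => look l .restore)
  | .rest =>
    .pop (.inr .qa) checkZero <|
    .branch isSome (moveBit .qb rfl (look l .rest)) (.goto fun _ => look l .back)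
  | .back =>
    .pop (.inr .qb) readBit <|
    .branch isSome (moveBit .qa rfl (look l .back)) <|
    .branch ok (.goto fun _ => look l .restore)
      (.load (fun s => { s with ok := true, bit := false }) <| .goto fun _ => look l .compare)
  | .restore =>
    .pop (.inr .tblRev) read <|
    .branch isSome
      (.push (.inr .tbl) symb <| .load clear <| .goto fun _ => look l .restore)
      (.goto fun _ => look l .drain)
  | .drain =>
    .pop (.inr .qa) readBit <|
    .branch isSome (.load clear <| .goto fun _ => look l .drain) <|
    .pop (.inr .qb) readBit <|
    .branch isSome (.load clear <| .goto fun _ => look l .drain) <|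
    .load (fun s => { s with v := M.receive s.bit s.v, bit := false, ok := false }) (simStmt M l)

/-- The program of the checker outside the simulation. -/
noncomputable def ctlProgram : CheckPhase → CheckStmt M
  | .parse =>
    .pop (.inr .inp)
      (fun s a => s.read (a.map (Sum.elim (fun b => (false, b)) fun b => (true, b)))) <|
    .branch isSome
      (.branch first
        (.pop (.inr .inp) (fun s a => s.read <| a.bind <|
            Sum.elim (fun _ => none) fun b => some (s.symb.2, b)) <|
          .branch isSome
            (.push (.inr .tbl) symb <| .load clear <| .goto fun _ => ctl .parse)
            (.goto fun _ => ctl .parse))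
        (.push (.inr .src) (fun s => s.symb.2) <| .load clear <| .goto fun _ => ctl .parse))
      (.goto fun _ => ctl .spread)
  | .spread =>
    .pop (.inr .src) readBit <|
    .branch isSome
      (.push (.inl M.tm.k₀) (fun s => M.inputAlphabet.symm s.first) <|
        moveBit .cpy rfl (ctl .spread))
      (.load (fun s => { s with v := M.tm.initialState }) <| .goto fun _ => .inl M.tm.main)
  | .clear =>
    popAll (simStacks M) <|
    .branch flag (.load (fun s => { s with flag := false }) <| .goto fun _ => ctl .clear)
      (.goto fun _ => ctl .next)
  | .next =>
    .pop (.inr .past) readBit <|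
    .branch isSome
      (.branch first (.load clear <| .goto fun _ => ctl .next)
        (.push (.inr .fut) (fun _ => true) <| .load clear <| .goto fun _ => ctl .rewind))
      (.load (fun s => { s with ver := true }) <| .goto fun _ => ctl .finish)
  | .rewind =>
    .pop (.inr .past) readBit <|
    .branch isSome (moveBit .fut rfl (ctl .rewind)) (.goto fun _ => ctl .gather)
  | .gather =>
    .pop (.inr .cpy) readBit <|
    .branch isSome (moveBit .src rfl (ctl .gather)) (.goto fun _ => ctl .spread)
  | .finish =>
    popAll (allStacks M) <|
    .branch flag (.load (fun s => { s with flag := false }) <| .goto fun _ => ctl .finish)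
      (.push (.inr .out) ver <|
        .load (fun _ => ⟨M.tm.initialState, none, false, false, false, false⟩) .halt)

/-- The program of the checker. In the simulation, a coin toss takes the next prescribed coin, or
`false` if there is none, and a query is looked up in the table. -/
noncomputable def checkProgram : CheckLabel M → CheckStmt M
  | .inl l =>
    match M.kind l with
    | .plain => simStmt M l
    | .toss =>
      .pop (.inr .fut) (fun s a => { s with bit := a.getD false }) <|
      .push (.inr .past) bit <|
      .load (fun s => { s with v := M.receive s.bit s.v, bit := false }) (simStmt M l)
    | .query => .goto fun _ => look l .unload
  | .inr (.inl (l, p)) => lookProgram M l p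
  | .inr (.inr p) => ctlProgram M p

/-- The deterministic machine that, on a string `x` and a table of oracle answers, runs `M` on `x`
with all coin strings and with the answers from the table, and accepts if all runs accept. -/
noncomputable def checker : FinTM2 where
  K := M.tm.K ⊕ CheckStack
  kFin := by
    haveI := M.tm.kFin
    infer_instance
  k₀ := .inr .inp
  k₁ := .inr .out
  Γ := CheckSymbols M
  Λ := CheckLabel M
  main := ctl .parse
  ΛFin := by
    haveI := M.tm.ΛFin
    infer_instance
  σ := CheckState M
  initialState := ⟨M.tm.initialState, none, false, false, false, false⟩
  Γk₀Fin := inferInstanceAs (Fintype (Bool ⊕ Bool))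
  m := checkProgram M

variable {M}

/-- The stacks of the checker, given those of the simulated machine and the others. -/
def checkStk (S : ∀ k, List (M.tm.Γ k)) (A : CheckAux) : ∀ k, List (CheckSymbols M k)
  | .inl k => S k
  | .inr j => A.stk j

abbrev CheckCfg (M : OracleTM) : Type := TM2.Cfg (CheckSymbols M) (CheckLabel M) (CheckState M)

/-- The configuration of the checker at the label `l`. -/
def checkCfg (l : CheckLabel M) (s : CheckState M) (S : ∀ k, List (M.tm.Γ k)) (A : CheckAux) :
    CheckCfg M :=
  ⟨some l, s, checkStk S A⟩

theorem checkStk_update_inl (S : ∀ k, List (M.tm.Γ k)) (A : CheckAux) (k : M.tm.K)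
    (l : List (M.tm.Γ k)) :
    Function.update (checkStk S A) (.inl k) l = checkStk (Function.update S k l) A := by
  funext k'
  rcases k' with k' | j
  · by_cases h : k' = k
    · subst h
      exact (Function.update_self _ _ _).trans (Function.update_self k' l S).symm
    · exact (Function.update_of_ne (by simpa using h) _ _).trans
        (Function.update_of_ne h _ _).symm
  · rfl

namespace Checker

/-! ### Single steps of the simulation and of the table lookup -/

section SimulationSteps

variable (l : M.tm.Λ) (v : M.tm.σ) (bit ok flag ver : Bool) (S : ∀ k, List (M.tm.Γ k))
  (A : CheckAux)

theorem unload_eq : checkProgram M (look l .unload) =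
    .pop (.inl M.tm.k₁) (fun s a => s.readBit (a.map M.queryAlphabet))
      (.branch isSome (moveBit .qb rfl (look l .unload)) (.goto fun _ => look l .turn)) :=
  rfl

theorem unload_cons {a : Bool} {q : List Bool}
    (h : S M.tm.k₁ = (a :: q).map M.queryAlphabet.symm) :
    totalStep (checkProgram M) (checkCfg (look l .unload) ⟨v, none, bit, ok, flag, ver⟩ S A) =
      checkCfg (look l .unload) ⟨v, none, bit, ok, flag, ver⟩
        (Function.update S M.tm.k₁ (q.map M.queryAlphabet.symm)) { A with qb := a :: A.qb } := by
  have h' : checkStk S A (.inl M.tm.k₁) =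
    M.queryAlphabet.symm a :: q.map M.queryAlphabet.symm := h
  refine (congrArg (fun q => TM2.stepAux q _ (checkStk S A)) (unload_eq l)).trans ?_
  refine (stepAux_pop_cons h' _ _ _).trans ?_
  refine (congrArg (TM2.stepAux _ _) (checkStk_update_inl S A M.tm.k₁ _)).trans ?_
  have ha : Option.map M.queryAlphabet (some (M.queryAlphabet.symm a)) = some a := by simp
  refine (congrArg (fun o => TM2.stepAux _ (CheckState.readBit _ o) _) ha).trans ?_
  exact cfg_ext rfl rfl fun k => by rcases k with k | j; · rfl
                                    · cases j <;> rfl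

theorem unload_nil (h : S M.tm.k₁ = []) :
    totalStep (checkProgram M) (checkCfg (look l .unload) ⟨v, none, bit, ok, flag, ver⟩ S A) =
      checkCfg (look l .turn) ⟨v, none, bit, ok, flag, ver⟩ (Function.update S M.tm.k₁ []) A := by
  have h' : checkStk S A (.inl M.tm.k₁) = [] := h
  refine (congrArg (fun q => TM2.stepAux q _ (checkStk S A)) (unload_eq l)).trans ?_
  refine (stepAux_pop_nil h' _ _ _).trans ?_
  exact congrArg (TM2.stepAux _ _) (checkStk_update_inl S A M.tm.k₁ _)

theorem turn_nil :
    totalStep (checkProgram M) (checkCfg (look l .turn) ⟨v, none, bit, ok, flag, ver⟩ S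
        { A with qb := [] }) =
      checkCfg (look l .compare) ⟨v, none, bit, true, flag, ver⟩ S { A with qb := [] } :=
  cfg_ext rfl rfl fun k => by rcases k with k | j; · rfl
                              · cases j <;> rfl

theorem compare_nil :
    totalStep (checkProgram M) (checkCfg (look l .compare) ⟨v, none, bit, ok, flag, ver⟩ S
        { A with tbl := [] }) =
      checkCfg (look l .restore) ⟨v, none, bit, ok, flag, ver⟩ S { A with tbl := [] } :=
  cfg_ext rfl rfl fun k => by rcases k with k | j; · rfl
                              · cases j <;> rfl

theorem compare_data_cons (b a : Bool) (q : List Bool) (t : List Symb) :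
    totalStep (checkProgram M) (checkCfg (look l .compare) ⟨v, none, bit, ok, flag, ver⟩ S
        { A with tbl := (true, b) :: t, qa := a :: q }) =
      checkCfg (look l .compare) ⟨v, none, bit, ok && (a == b), flag, ver⟩ S
        { A with tbl := t, tblRev := (true, b) :: A.tblRev, qa := q, qb := a :: A.qb } :=
  cfg_ext rfl rfl fun k => by rcases k with k | j; · rfl
                              · cases j <;> rfl

theorem compare_data_nil (b : Bool) (t : List Symb) :
    totalStep (checkProgram M) (checkCfg (look l .compare) ⟨v, none, bit, ok, flag, ver⟩ S
        { A with tbl := (true, b) :: t, qa := [] }) =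
      checkCfg (look l .compare) ⟨v, none, bit, ok && (false == b), flag, ver⟩ S
        { A with tbl := t, tblRev := (true, b) :: A.tblRev, qa := [] } :=
  cfg_ext rfl rfl fun k => by rcases k with k | j; · rfl
                              · cases j <;> rfl

theorem compare_end (b : Bool) (t : List Symb) :
    totalStep (checkProgram M) (checkCfg (look l .compare) ⟨v, none, bit, ok, flag, ver⟩ S
        { A with tbl := (false, b) :: t }) =
      checkCfg (look l .rest) ⟨v, none, b, ok, flag, ver⟩ S
        { A with tbl := t, tblRev := (false, b) :: A.tblRev } :=
  cfg_ext rfl rfl fun k => by rcases k with k | j; · rfl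
                              · cases j <;> rfl

theorem rest_cons (a : Bool) (q : List Bool) :
    totalStep (checkProgram M) (checkCfg (look l .rest) ⟨v, none, bit, ok, flag, ver⟩ S
        { A with qa := a :: q }) =
      checkCfg (look l .rest) ⟨v, none, bit, ok && !a, flag, ver⟩ S
        { A with qa := q, qb := a :: A.qb } :=
  cfg_ext rfl rfl fun k => by rcases k with k | j; · rfl
                              · cases j <;> rfl

theorem rest_nil :
    totalStep (checkProgram M) (checkCfg (look l .rest) ⟨v, none, bit, ok, flag, ver⟩ S
        { A with qa := [] }) =
      checkCfg (look l .back) ⟨v, none, bit, ok && !false, flag, ver⟩ S { A with qa := [] } :=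
  cfg_ext rfl rfl fun k => by rcases k with k | j; · rfl
                              · cases j <;> rfl

theorem back_cons (a : Bool) (q : List Bool) :
    totalStep (checkProgram M) (checkCfg (look l .back) ⟨v, none, bit, ok, flag, ver⟩ S
        { A with qb := a :: q }) =
      checkCfg (look l .back) ⟨v, none, bit, ok, flag, ver⟩ S
        { A with qa := a :: A.qa, qb := q } :=
  cfg_ext rfl rfl fun k => by rcases k with k | j; · rfl
                              · cases j <;> rfl

theorem back_nil :
    totalStep (checkProgram M) (checkCfg (look l .back) ⟨v, none, bit, ok, flag, ver⟩ S
        { A with qb := [] }) =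
      checkCfg (if ok then look l .restore else look l .compare)
        ⟨v, none, bit && ok, true, flag, ver⟩ S { A with qb := [] } := by
  cases ok <;> cases bit <;>
  exact cfg_ext rfl rfl fun k => by rcases k with k | j; · rfl
                                    · cases j <;> rfl

theorem restore_cons (x : Symb) (t : List Symb) :
    totalStep (checkProgram M) (checkCfg (look l .restore) ⟨v, none, bit, ok, flag, ver⟩ S
        { A with tblRev := x :: t }) =
      checkCfg (look l .restore) ⟨v, none, bit, ok, flag, ver⟩ S
        { A with tbl := x :: A.tbl, tblRev := t } :=
  cfg_ext rfl rfl fun k => by rcases k with k | j; · rfl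
                              · cases j <;> rfl

theorem restore_nil :
    totalStep (checkProgram M) (checkCfg (look l .restore) ⟨v, none, bit, ok, flag, ver⟩ S
        { A with tblRev := [] }) =
      checkCfg (look l .drain) ⟨v, none, bit, ok, flag, ver⟩ S { A with tblRev := [] } :=
  cfg_ext rfl rfl fun k => by rcases k with k | j; · rfl
                              · cases j <;> rfl

theorem drain_qa_cons (a : Bool) (q : List Bool) :
    totalStep (checkProgram M) (checkCfg (look l .drain) ⟨v, none, bit, ok, flag, ver⟩ S
        { A with qa := a :: q }) =
      checkCfg (look l .drain) ⟨v, none, bit, ok, flag, ver⟩ S { A with qa := q } :=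
  cfg_ext rfl rfl fun k => by rcases k with k | j; · rfl
                              · cases j <;> rfl

theorem drain_qb_cons (a : Bool) (q : List Bool) :
    totalStep (checkProgram M) (checkCfg (look l .drain) ⟨v, none, bit, ok, flag, ver⟩ S
        { A with qa := [], qb := a :: q }) =
      checkCfg (look l .drain) ⟨v, none, bit, ok, flag, ver⟩ S { A with qa := [], qb := q } :=
  cfg_ext rfl rfl fun k => by rcases k with k | j; · rfl
                              · cases j <;> rfl

/-- The state of the checker between two steps of the simulated machine. -/
abbrev idle (v : M.tm.σ) : CheckState M := ⟨v, none, false, false, false, false⟩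

/-- A configuration of the simulated machine seen in the checker. A halting configuration that
accepts makes the checker go on, one that rejects makes it finish. -/
def simCfg (A : CheckAux) : TM2.Cfg M.tm.Γ M.tm.Λ M.tm.σ → CheckCfg M
  | ⟨some l, v, S⟩ => checkCfg (.inl l) (idle v) S A
  | ⟨none, v, S⟩ => checkCfg (if M.accept v then ctl .clear else ctl .finish) (idle v) S A

theorem stepAux_simStmt :
    TM2.stepAux (simStmt M l) (idle v) (checkStk S A) =
      simCfg A (TM2.stepAux (M.tm.m l) v S) := by
  have h : ∀ c, liftCfg (Γ' := CheckSymbols M) (ι := Sum.inl) Sum.inl (simEnd M) idle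
      (fun S => checkStk S A) c = simCfg A c := by
    rintro ⟨_ | l, v, S⟩ <;> rfl
  refine (stepAux_liftStmt (Γ' := CheckSymbols M) (ι := Sum.inl) (cv := idle)
    (cs := fun S => checkStk S A) (fun _ => rfl) (fun _ _ => rfl) (fun _ _ => rfl)
    (fun S k l => checkStk_update_inl S A k l) (M.tm.m l) v S).trans (h _)

theorem drain_nil :
    totalStep (checkProgram M) (checkCfg (look l .drain) ⟨v, none, bit, ok, false, false⟩ S
        { A with qa := [], qb := [] }) =
      simCfg { A with qa := [], qb := [] } (TM2.stepAux (M.tm.m l) (M.receive bit v) S) := by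
  refine Eq.trans ?_ (stepAux_simStmt l _ S _)
  refine (congrArg (TM2.stepAux (simStmt M l) (idle (M.receive bit v))) ?_ :)
  funext k
  rcases k with k | j
  · rfl
  · cases j <;> rfl

theorem plain_step (h : M.kind l = .plain) :
    totalStep (checkProgram M) (checkCfg (.inl l) (idle v) S A) =
      simCfg A (TM2.stepAux (M.tm.m l) v S) := by
  refine Eq.trans ?_ (stepAux_simStmt l v S A)
  have e : checkProgram M (.inl l) = simStmt M l := by simp only [checkProgram, h]
  exact congrArg (fun q => TM2.stepAux q (idle v) (checkStk S A)) e

theorem toss_step (h : M.kind l = .toss) (p : List Bool) :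
    totalStep (checkProgram M) (checkCfg (.inl l) (idle v) S { A with fut := p }) =
      simCfg { A with fut := p.tail, past := p.headD false :: A.past }
        (TM2.stepAux (M.tm.m l) (M.receive (p.headD false) v) S) := by
  refine Eq.trans ?_ (stepAux_simStmt l _ S _)
  have e : checkProgram M (.inl l) = .pop (.inr .fut) (fun s a => { s with bit := a.getD false })
      (.push (.inr .past) bit
      (.load (fun s => { s with v := M.receive s.bit s.v, bit := false }) (simStmt M l))) := by
    simp only [checkProgram, h]
  refine (congrArg (fun q => TM2.stepAux q (idle v) (checkStk S { A with fut := p })) e).trans ?_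
  have : p.headD false = p.head?.getD false := by cases p <;> rfl
  rw [this]
  refine (congrArg (TM2.stepAux (simStmt M l) (idle (M.receive (p.head?.getD false) v))) ?_ :)
  funext k
  rcases k with k | j
  · rfl
  · cases j <;> rfl

theorem query_step (h : M.kind l = .query) :
    totalStep (checkProgram M) (checkCfg (.inl l) (idle v) S A) =
      checkCfg (look l .unload) (idle v) S A := by
  have e : checkProgram M (.inl l) = .goto fun _ => look l .unload := by
    simp only [checkProgram, h]
  exact congrArg (fun q => TM2.stepAux q (idle v) (checkStk S A)) e

theorem turn_cons (a : Bool) (q : List Bool) :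
    totalStep (checkProgram M) (checkCfg (look l .turn) ⟨v, none, bit, ok, flag, ver⟩ S
        { A with qb := a :: q }) =
      checkCfg (look l .turn) ⟨v, none, bit, ok, flag, ver⟩ S
        { A with qa := a :: A.qa, qb := q } :=
  cfg_ext rfl rfl fun k => by rcases k with k | j; · rfl
                              · cases j <;> rfl

end SimulationSteps

/-! ### Answering queries from the table -/

/-- The checker gets from one configuration to another in at most `n` steps. -/
def ReachIn (n : ℕ) (c c' : CheckCfg M) : Prop :=
  ∃ i ≤ n, (totalStep (checkProgram M))^[i] c = c'

theorem ReachIn.refl (n : ℕ) (c : CheckCfg M) : ReachIn n c c := ⟨0, Nat.zero_le _, rfl⟩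

theorem ReachIn.trans {m n : ℕ} {c c' c'' : CheckCfg M} (h : ReachIn m c c')
    (h' : ReachIn n c' c'') : ReachIn (m + n) c c'' := by
  obtain ⟨i, hi, rfl⟩ := h
  obtain ⟨j, hj, rfl⟩ := h'
  exact ⟨j + i, by omega, Function.iterate_add_apply _ j i c⟩

theorem ReachIn.mono {m n : ℕ} {c c' : CheckCfg M} (h : ReachIn m c c') (hmn : m ≤ n) :
    ReachIn n c c' :=
  h.imp fun _ hi => ⟨hi.1.trans hmn, hi.2⟩

theorem ReachIn.head {n : ℕ} {c c' c'' : CheckCfg M} (h : totalStep (checkProgram M) c = c')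
    (h' : ReachIn n c' c'') : ReachIn (n + 1) c c'' :=
  (ReachIn.trans ⟨1, le_rfl, h⟩ h').mono (by omega)

section Lookup

variable (l : M.tm.Λ) (v : M.tm.σ) (bit ok flag ver : Bool)

theorem reach_unload (q : List Bool) (S : ∀ k, List (M.tm.Γ k)) (A : CheckAux)
    (h : S M.tm.k₁ = q.map M.queryAlphabet.symm) :
    ReachIn (q.length + 1)
      (checkCfg (look l .unload) ⟨v, none, bit, ok, flag, ver⟩ S A)
      (checkCfg (look l .turn) ⟨v, none, bit, ok, flag, ver⟩ (Function.update S M.tm.k₁ [])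
        { A with qb := q.reverse ++ A.qb }) := by
  induction q generalizing S A with
  | nil => exact .head (unload_nil l v bit ok flag ver S A h) (.refl _ _)
  | cons a q ih =>
    refine .head (unload_cons l v bit ok flag ver S A h) ?_
    have := ih (Function.update S M.tm.k₁ (q.map M.queryAlphabet.symm))
      { A with qb := a :: A.qb } (Function.update_self _ _ _)
    simpa using this

theorem reach_turn (q : List Bool) (S : ∀ k, List (M.tm.Γ k)) (A : CheckAux) :
    ReachIn (q.length + 1)
      (checkCfg (look l .turn) ⟨v, none, bit, ok, flag, ver⟩ S { A with qb := q })
      (checkCfg (look l .compare) ⟨v, none, bit, true, flag, ver⟩ S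
        { A with qa := q.reverse ++ A.qa, qb := [] }) := by
  induction q generalizing A with
  | nil => exact .head (turn_nil l v bit ok flag ver S A) (.refl _ _)
  | cons a q ih =>
    refine .head (turn_cons l v bit ok flag ver S A a q) ?_
    simpa using ih { A with qa := a :: A.qa }

theorem reach_rest (q : List Bool) (S : ∀ k, List (M.tm.Γ k)) (A : CheckAux) :
    ReachIn (q.length + 1)
      (checkCfg (look l .rest) ⟨v, none, bit, ok, flag, ver⟩ S { A with qa := q })
      (checkCfg (look l .back) ⟨v, none, bit, ok && decide (bitsVal q = 0), flag, ver⟩ S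
        { A with qa := [], qb := q.reverse ++ A.qb }) := by
  rw [← all_not_eq_bitsVal]
  induction q generalizing ok A with
  | nil => exact .head (rest_nil l v bit ok flag ver S A) (.refl _ _)
  | cons a q ih =>
    refine .head (rest_cons l v bit ok flag ver S A a q) ?_
    simpa [Bool.and_assoc] using ih (ok && !a) { A with qb := a :: A.qb }

theorem reach_back (q : List Bool) (S : ∀ k, List (M.tm.Γ k)) (A : CheckAux) :
    ReachIn (q.length + 1)
      (checkCfg (look l .back) ⟨v, none, bit, ok, flag, ver⟩ S { A with qb := q })
      (checkCfg (if ok then look l .restore else look l .compare)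
        ⟨v, none, bit && ok, true, flag, ver⟩ S
        { A with qa := q.reverse ++ A.qa, qb := [] }) := by
  induction q generalizing A with
  | nil => exact .head (back_nil l v bit ok flag ver S A) (.refl _ _)
  | cons a q ih =>
    refine .head (back_cons l v bit ok flag ver S A a q) ?_
    simpa using ih { A with qa := a :: A.qa }

theorem reach_restore (t : List Symb) (S : ∀ k, List (M.tm.Γ k)) (A : CheckAux) :
    ReachIn (t.length + 1)
      (checkCfg (look l .restore) ⟨v, none, bit, ok, flag, ver⟩ S { A with tblRev := t })
      (checkCfg (look l .drain) ⟨v, none, bit, ok, flag, ver⟩ S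
        { A with tbl := t.reverse ++ A.tbl, tblRev := [] }) := by
  induction t generalizing A with
  | nil => exact .head (restore_nil l v bit ok flag ver S A) (.refl _ _)
  | cons a t ih =>
    refine .head (restore_cons l v bit ok flag ver S A a t) ?_
    simpa using ih { A with tbl := a :: A.tbl }

theorem reach_drain (u r : List Bool) (S : ∀ k, List (M.tm.Γ k)) (A : CheckAux) :
    ReachIn (u.length + r.length + 1)
      (checkCfg (look l .drain) ⟨v, none, bit, ok, false, false⟩ S { A with qa := u, qb := r })
      (simCfg { A with qa := [], qb := [] } (TM2.stepAux (M.tm.m l) (M.receive bit v) S)) := by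
  induction u with
  | nil =>
    induction r with
    | nil => exact .head (drain_nil l v bit ok S A) (.refl _ _)
    | cons a r ih =>
      exact (ReachIn.head (drain_qb_cons l v bit ok false false S A a r) ih).mono (by simp)
  | cons a u ih =>
    exact (ReachIn.head (drain_qa_cons l v bit ok false false S { A with qb := r } a u) ih).mono
      (by rw [List.length_cons]; omega)

/-- The comparison of the query with the entries of the table computes `lookup`. The query is
`r.reverse ++ u`, of which the part `r` has been compared. -/
theorem reach_compare (n : ℕ) (S : ∀ k, List (M.tm.Γ k)) (ts z : List Symb) (u r : List Bool)
    (A : CheckAux) (hn : bitsVal (r.reverse ++ u) = n) :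
    ∃ ok' u' r' t' z', u'.length + r'.length ≤ u.length + r.length ∧
      z'.reverse ++ t' = z.reverse ++ ts ∧
      ReachIn (ts.length * (2 * (u.length + r.length) + 3) + 1)
        (checkCfg (look l .compare) ⟨v, none, false, ok, flag, ver⟩ S
          { A with tbl := ts, tblRev := z, qa := u, qb := r })
        (checkCfg (look l .restore)
          ⟨v, none, lookup n ts (bitsVal u) ok, ok', flag, ver⟩ S
          { A with tbl := t', tblRev := z', qa := u', qb := r' }) := by
  induction ts generalizing z u r ok with
  | nil =>
    exact ⟨ok, u, r, [], z, le_rfl, rfl, (ReachIn.head (compare_nil l v false ok flag ver S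
      { A with tblRev := z, qa := u, qb := r }) (.refl 0 _)).mono (by simp)⟩
  | cons e ts ih =>
    obtain ⟨_ | _, b⟩ := e
    · -- the end of an entry
      have h₁ := ReachIn.head (compare_end l v false ok flag ver S
        { A with tblRev := z, qa := u, qb := r } b ts)
        (reach_rest l v b ok flag ver u S
          { A with tbl := ts, tblRev := (false, b) :: z, qb := r })
      have h₂ := reach_back l v b (ok && decide (bitsVal u = 0)) flag ver (u.reverse ++ r) S
          { A with tbl := ts, tblRev := (false, b) :: z, qa := [] }
      have h₃ := h₁.trans h₂
      simp only [List.append_nil] at h₃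
      rw [lookup]
      have hr : (u.reverse ++ r).reverse = r.reverse ++ u := by simp
      rw [hr] at h₃
      cases hok : ok && decide (bitsVal u = 0)
      · obtain ⟨ok', u', r', t', z', h, hz, hR⟩ := ih true ((false, b) :: z) (r.reverse ++ u) []
          (by simpa using hn)
        rw [hok] at h₃
        refine ⟨ok', u', r', t', z', by simp at h; omega, by simpa using hz, ?_⟩
        rw [hn] at hR
        simp only [Bool.and_false] at h₃
        refine (h₃.trans hR).mono ?_
        simp only [List.length_append, List.length_reverse, List.length_cons, List.length_nil]
        rw [Nat.add_mul ts.length 1, Nat.one_mul]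
        have : r.length + u.length + 0 = u.length + r.length := by omega
        rw [this]
        omega
      · rw [hok] at h₃
        refine ⟨true, r.reverse ++ u, [], ts, (false, b) :: z, by simp; omega, by simp, ?_⟩
        simp only [Bool.and_true] at h₃
        refine h₃.mono ?_
        simp only [List.length_append, List.length_reverse, List.length_cons]
        rw [Nat.add_mul ts.length 1, Nat.one_mul]
        omega
    · -- a digit of the position of an entry
      rw [lookup, bitsVal_mod_two, bitsVal_div_two]
      cases u with
      | nil =>
        obtain ⟨ok', u', r', t', z', h, hz, hR⟩ := ih (ok && (false == b)) ((true, b) :: z) [] r hn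
        refine ⟨ok', u', r', t', z', h, by simpa using hz, (ReachIn.head (compare_data_nil l v false
          ok flag ver S { A with tblRev := z, qb := r } b ts) hR).mono ?_⟩
        rw [List.length_cons, Nat.add_mul ts.length 1, Nat.one_mul]
        omega
      | cons a u =>
        obtain ⟨ok', u', r', t', z', h, hz, hR⟩ := ih (ok && (a == b)) ((true, b) :: z) u (a :: r)
          (by simpa using hn)
        refine ⟨ok', u', r', t', z', by simp at h ⊢; omega, by simpa using hz,
          (ReachIn.head (compare_data_cons l v false
          ok flag ver S { A with tblRev := z, qb := r } b a u ts) hR).mono ?_⟩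
        rw [List.length_cons, List.length_cons, List.length_cons, Nat.add_mul ts.length 1,
          Nat.one_mul]
        have : u.length + (r.length + 1) = u.length + 1 + r.length := by omega
        rw [this]
        omega

/-- A query of the simulated machine is answered from the table. -/
theorem reach_query (h : M.kind l = .query) (S : ∀ k, List (M.tm.Γ k)) (A : CheckAux)
    (hz : A.tblRev = []) (ha : A.qa = []) (hb : A.qb = []) :
    ReachIn ((A.tbl.length + 2) * (2 * (S M.tm.k₁).length + 4))
      (checkCfg (.inl l) (idle v) S A)
      (simCfg A (TM2.stepAux (M.tm.m l)
        (M.receive ((tableWord A.tbl).getD (M.queryPosition (S M.tm.k₁)) false) v)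
        (Function.update S M.tm.k₁ []))) := by
  obtain ⟨inp, src, cpy, tbl, tblRev, qa, qb, fut, past, out⟩ := A
  dsimp only at hz ha hb
  subst hz ha hb
  dsimp only
  set u := (S M.tm.k₁).map M.queryAlphabet with hu
  have hS : S M.tm.k₁ = u.map M.queryAlphabet.symm := by simp [hu]
  have hpos : M.queryPosition (S M.tm.k₁) = bitsVal u := by
    simp [OracleTM.queryPosition, bitsVal, hu, Function.comp_def]
  have hlen : (S M.tm.k₁).length = u.length := by simp [hu]
  rw [tableWord_getD, hpos, hlen]
  set A : CheckAux := ⟨inp, src, cpy, tbl, [], [], [], fut, past, out⟩ with hA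
  set S' := Function.update S M.tm.k₁ [] with hS'
  have h₁ := ReachIn.head (query_step l v S A h)
    (reach_unload l v false false false false u S A hS)
  have h₂ := reach_turn l v false false false false u.reverse S' A
  obtain ⟨ok', u', r', t', z', hlen', hz', h₃⟩ := reach_compare l v true false false (bitsVal u) S'
    tbl [] u [] A rfl
  have h₄ := reach_restore l v (lookup (bitsVal u) tbl (bitsVal u) true) ok' false false z' S'
    { A with tbl := t', qa := u', qb := r' }
  have h₅ := reach_drain l v (lookup (bitsVal u) tbl (bitsVal u) true) ok' u' r' S' A
  dsimp only at h₄
  rw [hz'] at h₄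
  simp only [List.append_nil, List.reverse_reverse, hA] at h₁ h₂ h₃ h₄ h₅
  refine ((((h₁.trans h₂).trans h₃).trans h₄).trans h₅).mono ?_
  have hz'' : z'.length ≤ tbl.length := by
    have := congrArg List.length hz'
    simp at this
    omega
  simp at hlen' ⊢
  nlinarith

end Lookup

/-! ### Clearing stacks -/

open Classical in
theorem stepAux_popAll {ks : List (M.tm.K ⊕ CheckStack)} (hks : ks.Nodup) (q : CheckStmt M)
    (s : CheckState M) (T : ∀ k, List (CheckSymbols M k)) :
    TM2.stepAux (popAll ks q) s T =
      TM2.stepAux q { s with flag := s.flag || ks.any fun k => (T k).head?.isSome }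
        (fun k => if k ∈ ks then (T k).tail else T k) := by
  induction ks generalizing s T with
  | nil => simp [popAll]
  | cons k₀ ks ih =>
    rw [List.nodup_cons] at hks
    refine (ih hks.2 { s with flag := s.flag || (T k₀).head?.isSome }
      (Function.update T k₀ (T k₀).tail)).trans ?_
    have hne : ∀ k ∈ ks, k ≠ k₀ := fun k hk h => hks.1 (h ▸ hk)
    have h₁ : (ks.any fun k => (Function.update T k₀ (T k₀).tail k).head?.isSome) =
        ks.any fun k => (T k).head?.isSome := by
      rw [Bool.eq_iff_iff]
      simp only [List.any_eq_true]
      refine exists_congr fun k => and_congr_right fun hk => ?_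
      rw [Function.update_of_ne (hne k hk)]
    have h₂ : (fun k => if k ∈ ks then (Function.update T k₀ (T k₀).tail k).tail else
        Function.update T k₀ (T k₀).tail k) =
        fun k => if k ∈ k₀ :: ks then (T k).tail else T k := by
      funext k
      by_cases hk : k = k₀
      · subst hk
        simp [hks.1]
      · simp [hk]
    rw [h₁, h₂, List.any_cons, Bool.or_assoc]

open Classical in
/-- The stacks of a list are emptied. -/
noncomputable def clearStacks (ks : List (M.tm.K ⊕ CheckStack))
    (T : ∀ k, List (CheckSymbols M k)) : ∀ k, List (CheckSymbols M k) :=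
  fun k => if k ∈ ks then [] else T k

theorem clearStacks_of_mem {ks : List (M.tm.K ⊕ CheckStack)} {k : M.tm.K ⊕ CheckStack}
    (h : k ∈ ks) (T : ∀ k, List (CheckSymbols M k)) : clearStacks ks T k = [] :=
  if_pos h

theorem clearStacks_of_notMem {ks : List (M.tm.K ⊕ CheckStack)} {k : M.tm.K ⊕ CheckStack}
    (h : k ∉ ks) (T : ∀ k, List (CheckSymbols M k)) : clearStacks ks T k = T k :=
  if_neg h

open Classical in
/-- A label at which the checker clears stacks. -/
theorem reach_popAll {ks : List (M.tm.K ⊕ CheckStack)} (hks : ks.Nodup) {L : CheckLabel M}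
    {q : CheckStmt M} (hL : checkProgram M L = popAll ks
      (.branch flag (.load (fun s => { s with flag := false }) <| .goto fun _ => L) q))
    {s : CheckState M} (hs : s.flag = false) (N : ℕ) (T : ∀ k, List (CheckSymbols M k))
    (hT : ∀ k ∈ ks, (T k).length ≤ N) :
    ReachIn (N + 1) ⟨some L, s, T⟩ (TM2.stepAux q s (clearStacks ks T)) := by
  obtain ⟨v, reg, bit, ok, flag, ver⟩ := s
  dsimp only at hs
  subst hs
  induction N generalizing T with
  | zero =>
    refine ⟨1, le_rfl, ?_⟩
    refine (congrArg (fun q => TM2.stepAux q _ T) hL).trans ((stepAux_popAll hks _ _ _).trans ?_)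
    have hT' : ∀ k ∈ ks, T k = [] := fun k hk =>
      List.length_eq_zero_iff.1 (by have := hT k hk; omega)
    have h₁ : (ks.any fun k => (T k).head?.isSome) = false := by
      rw [List.any_eq_false]
      intro k hk
      simp [hT' k hk]
    have h₂ : (fun k => if k ∈ ks then (T k).tail else T k) = clearStacks ks T := by
      funext k
      split
      · next hk => rw [hT' k hk, clearStacks_of_mem hk]; rfl
      · next hk => rw [clearStacks_of_notMem hk]
    rw [h₁, h₂]
    rfl
  | succ N ih =>
    have h₃ : clearStacks ks (fun k => if k ∈ ks then (T k).tail else T k) = clearStacks ks T := by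
      funext k
      by_cases h : k ∈ ks
      · rw [clearStacks_of_mem h, clearStacks_of_mem h]
      · rw [clearStacks_of_notMem h, clearStacks_of_notMem h, if_neg h]
    cases h₁ : ks.any fun k => (T k).head?.isSome
    · refine ⟨1, by omega, ?_⟩
      refine (congrArg (fun q => TM2.stepAux q _ T) hL).trans ((stepAux_popAll hks _ _ _).trans ?_)
      have hT' : ∀ k ∈ ks, T k = [] := by
        intro k hk
        rw [List.any_eq_false] at h₁
        have := h₁ k hk
        cases h : T k
        · rfl
        · simp [h] at this
      have h₂ : (fun k => if k ∈ ks then (T k).tail else T k) = clearStacks ks T := by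
        funext k
        split
        · next hk => rw [hT' k hk, clearStacks_of_mem hk]; rfl
        · next hk => rw [clearStacks_of_notMem hk]
      rw [h₁, h₂]
      rfl
    · have := ih (fun k => if k ∈ ks then (T k).tail else T k) (by
        intro k hk
        simp only [hk, if_true, List.length_tail]
        have := hT k hk
        omega)
      rw [h₃] at this
      refine .head ?_ this
      refine (congrArg (fun q => TM2.stepAux q _ T) hL).trans ((stepAux_popAll hks _ _ _).trans ?_)
      rw [h₁]
      rfl

theorem nodup_simStacks : (simStacks M).Nodup := by
  rw [simStacks, List.nodup_cons]
  exact ⟨by simp, (Finset.nodup_toList _).map Sum.inl_injective⟩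

theorem inl_mem_simStacks (k : M.tm.K) : Sum.inl k ∈ simStacks M :=
  List.mem_cons_of_mem _ (List.mem_map_of_mem
    (Finset.mem_toList.2 (@Finset.mem_univ _ M.tm.kFin k)))

theorem inr_mem_simStacks {j : CheckStack} : Sum.inr j ∈ simStacks M ↔ j = .fut := by
  rw [simStacks, List.mem_cons, List.mem_map]
  simp

theorem nodup_allStacks : (allStacks M).Nodup := Finset.nodup_toList _

theorem mem_allStacks (k : M.tm.K ⊕ CheckStack) : k ∈ allStacks M :=
  Finset.mem_toList.2 (@Finset.mem_univ _ (@instFintypeSum _ _ M.tm.kFin _) k)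

theorem reach_clear (v : M.tm.σ) (S : ∀ k, List (M.tm.Γ k)) (A : CheckAux) {N : ℕ}
    (hS : ∀ k, (S k).length ≤ N) (hA : A.fut.length ≤ N) :
    ReachIn (N + 1) (checkCfg (ctl .clear) (idle v) S A)
      (checkCfg (ctl .next) (idle v) (fun _ => []) { A with fut := [] }) := by
  have h := reach_popAll (nodup_simStacks (M := M)) (L := ctl .clear)
    (q := .goto fun _ => ctl .next) rfl (s := idle v) rfl N (checkStk S A) (by
      intro k hk
      rw [simStacks, List.mem_cons] at hk
      rcases hk with rfl | hk
      · exact hA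
      · obtain ⟨k, -, rfl⟩ := List.mem_map.1 hk
        exact hS k)
  refine h.imp fun i hi => ⟨hi.1, hi.2.trans (cfg_ext rfl rfl fun k => ?_)⟩
  rcases k with k | j
  · exact clearStacks_of_mem (inl_mem_simStacks k) _
  · cases j
    case fut => exact clearStacks_of_mem (inr_mem_simStacks.2 rfl) _
    all_goals
      exact clearStacks_of_notMem (fun h => CheckStack.noConfusion (inr_mem_simStacks.1 h)) _

/-- Finally the checker clears its stacks and writes the verdict. -/
theorem reach_finish (v : M.tm.σ) (ver : Bool) (S : ∀ k, List (M.tm.Γ k)) (A : CheckAux) {N : ℕ}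
    (hS : ∀ k, (S k).length ≤ N) (hA : ∀ j, (A.stk j).length ≤ N) :
    ReachIn (N + 1) (checkCfg (ctl .finish) ⟨v, none, false, false, false, ver⟩ S A)
      (haltList (checker M) [ver]) := by
  have h := reach_popAll (nodup_allStacks (M := M))
    (L := ctl .finish) (q := .push (.inr .out) CheckState.ver <|
        .load (fun _ => ⟨M.tm.initialState, none, false, false, false, false⟩) .halt) rfl
    (s := ⟨v, none, false, false, false, ver⟩) rfl N (checkStk S A) (by
      intro k _
      rcases k with k | j
      · exact hS k
      · exact hA j)
  refine h.imp fun i hi => ⟨hi.1, hi.2.trans (cfg_ext rfl rfl fun k => ?_)⟩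
  have e : clearStacks (allStacks M) (checkStk S A) = fun _ => [] := by
    funext k
    exact clearStacks_of_mem (mem_allStacks k) _
  refine (congrArg (fun T : ∀ k, List (CheckSymbols M k) =>
    Function.update T (.inr .out) (show List Bool from ver :: T (.inr .out)) k) e).trans ?_
  exact (congrFun (haltList_stk (checker M) [ver]) k).symm

/-! ### The phases outside the simulation -/

section PhaseSteps

variable (v : M.tm.σ) (S : ∀ k, List (M.tm.Γ k)) (A : CheckAux)

theorem parse_inl (b : Bool) (t : List (Bool ⊕ Bool)) :
    totalStep (checkProgram M) (checkCfg (ctl .parse) (idle v) S { A with inp := .inl b :: t }) =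
      checkCfg (ctl .parse) (idle v) S { A with inp := t, src := b :: A.src } :=
  cfg_ext rfl rfl fun k => by rcases k with k | j; · rfl
                              · cases j <;> rfl

theorem parse_inr (b c : Bool) (t : List (Bool ⊕ Bool)) :
    totalStep (checkProgram M) (checkCfg (ctl .parse) (idle v) S
        { A with inp := .inr b :: .inr c :: t }) =
      checkCfg (ctl .parse) (idle v) S { A with inp := t, tbl := (b, c) :: A.tbl } :=
  cfg_ext rfl rfl fun k => by rcases k with k | j; · rfl
                              · cases j <;> rfl

theorem parse_inr_nil (b : Bool) :
    totalStep (checkProgram M) (checkCfg (ctl .parse) (idle v) S { A with inp := [.inr b] }) =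
      checkCfg (ctl .parse) (idle v) S { A with inp := [] } :=
  cfg_ext rfl rfl fun k => by rcases k with k | j; · rfl
                              · cases j <;> rfl

theorem parse_nil :
    totalStep (checkProgram M) (checkCfg (ctl .parse) (idle v) S { A with inp := [] }) =
      checkCfg (ctl .spread) (idle v) S { A with inp := [] } :=
  cfg_ext rfl rfl fun k => by rcases k with k | j; · rfl
                              · cases j <;> rfl

theorem spread_cons (b : Bool) (t : List Bool) :
    totalStep (checkProgram M) (checkCfg (ctl .spread) (idle v) S { A with src := b :: t }) =
      checkCfg (ctl .spread) (idle v)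
        (Function.update S M.tm.k₀ (M.inputAlphabet.symm b :: S M.tm.k₀))
        { A with src := t, cpy := b :: A.cpy } := by
  have e := checkStk_update_inl S A M.tm.k₀ (M.inputAlphabet.symm b :: S M.tm.k₀)
  refine cfg_ext rfl rfl fun k => ?_
  rcases k with k | j
  · exact congrFun e (.inl k)
  · cases j <;> rfl

theorem spread_nil :
    totalStep (checkProgram M) (checkCfg (ctl .spread) (idle v) S { A with src := [] }) =
      checkCfg (.inl M.tm.main) (idle M.tm.initialState) S { A with src := [] } :=
  cfg_ext rfl rfl fun k => by rcases k with k | j; · rfl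
                              · cases j <;> rfl

theorem next_true (p : List Bool) :
    totalStep (checkProgram M) (checkCfg (ctl .next) (idle v) S { A with past := true :: p }) =
      checkCfg (ctl .next) (idle v) S { A with past := p } :=
  cfg_ext rfl rfl fun k => by rcases k with k | j; · rfl
                              · cases j <;> rfl

theorem next_false (p : List Bool) :
    totalStep (checkProgram M) (checkCfg (ctl .next) (idle v) S { A with past := false :: p }) =
      checkCfg (ctl .rewind) (idle v) S { A with past := p, fut := true :: A.fut } :=
  cfg_ext rfl rfl fun k => by rcases k with k | j; · rfl
                              · cases j <;> rfl

theorem next_nil :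
    totalStep (checkProgram M) (checkCfg (ctl .next) (idle v) S { A with past := [] }) =
      checkCfg (ctl .finish) ⟨v, none, false, false, false, true⟩ S { A with past := [] } :=
  cfg_ext rfl rfl fun k => by rcases k with k | j; · rfl
                              · cases j <;> rfl

theorem rewind_cons (b : Bool) (p : List Bool) :
    totalStep (checkProgram M) (checkCfg (ctl .rewind) (idle v) S { A with past := b :: p }) =
      checkCfg (ctl .rewind) (idle v) S { A with past := p, fut := b :: A.fut } :=
  cfg_ext rfl rfl fun k => by rcases k with k | j; · rfl
                              · cases j <;> rfl

theorem rewind_nil :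
    totalStep (checkProgram M) (checkCfg (ctl .rewind) (idle v) S { A with past := [] }) =
      checkCfg (ctl .gather) (idle v) S { A with past := [] } :=
  cfg_ext rfl rfl fun k => by rcases k with k | j; · rfl
                              · cases j <;> rfl

theorem gather_cons (b : Bool) (p : List Bool) :
    totalStep (checkProgram M) (checkCfg (ctl .gather) (idle v) S { A with cpy := b :: p }) =
      checkCfg (ctl .gather) (idle v) S { A with cpy := p, src := b :: A.src } :=
  cfg_ext rfl rfl fun k => by rcases k with k | j; · rfl
                              · cases j <;> rfl

theorem gather_nil :
    totalStep (checkProgram M) (checkCfg (ctl .gather) (idle v) S { A with cpy := [] }) =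
      checkCfg (ctl .spread) (idle v) S { A with cpy := [] } :=
  cfg_ext rfl rfl fun k => by rcases k with k | j; · rfl
                              · cases j <;> rfl

theorem reach_parse_inr : ∀ (w : List Bool) (A : CheckAux),
    ReachIn (w.length + 1)
      (checkCfg (ctl .parse) (idle v) S { A with inp := w.map .inr })
      (checkCfg (ctl .spread) (idle v) S
        { A with inp := [], tbl := (pairUp w).reverse ++ A.tbl })
  | [], A => .head (parse_nil v S A) (.refl _ _)
  | [b], A => .head (parse_inr_nil v S A b) (.head (parse_nil v S A) (.refl _ _))
  | b :: c :: w, A => by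
    have := reach_parse_inr w { A with tbl := (b, c) :: A.tbl }
    simp only [pairUp, List.reverse_cons, List.append_assoc, List.singleton_append]
    exact (ReachIn.head (parse_inr v S A b c (w.map .inr)) this).mono
      (n := w.length + 2 + 1) (by omega)

theorem reach_parse (x w : List Bool) :
    ReachIn (x.length + (w.length + 1))
      (checkCfg (ctl .parse) (idle v) S { A with inp := x.map .inl ++ w.map .inr })
      (checkCfg (ctl .spread) (idle v) S
        { A with inp := [], src := x.reverse ++ A.src, tbl := (pairUp w).reverse ++ A.tbl }) := by
  induction x generalizing A with
  | nil => exact (reach_parse_inr v S w A).mono (by simp)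
  | cons b x ih =>
    have := ih { A with src := b :: A.src }
    simp only [List.reverse_cons, List.append_assoc, List.singleton_append]
    exact (ReachIn.head (parse_inl v S A b (x.map .inl ++ w.map .inr)) this).mono
      (n := x.length + 1 + (w.length + 1)) (by omega)

theorem reach_spread (y : List Bool) :
    ReachIn (y.length + 1)
      (checkCfg (ctl .spread) (idle v) S { A with src := y })
      (checkCfg (.inl M.tm.main) (idle M.tm.initialState)
        (Function.update S M.tm.k₀ (y.reverse.map M.inputAlphabet.symm ++ S M.tm.k₀))
        { A with src := [], cpy := y.reverse ++ A.cpy }) := by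
  induction y generalizing S A with
  | nil => simpa using ReachIn.head (spread_nil v S A) (.refl 0 _)
  | cons b y ih =>
    have := ih (Function.update S M.tm.k₀ (M.inputAlphabet.symm b :: S M.tm.k₀))
      { A with cpy := b :: A.cpy }
    refine .head (spread_cons v S A b y) ?_
    simpa using this

theorem reach_gather (y : List Bool) :
    ReachIn (y.length + 1)
      (checkCfg (ctl .gather) (idle v) S { A with cpy := y })
      (checkCfg (ctl .spread) (idle v) S { A with cpy := [], src := y.reverse ++ A.src }) := by
  induction y generalizing A with
  | nil => exact .head (gather_nil v S A) (.refl 0 _)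
  | cons b y ih =>
    refine .head (gather_cons v S A b y) ?_
    simpa using ih { A with src := b :: A.src }

theorem reach_rewind (p : List Bool) :
    ReachIn (p.length + 1)
      (checkCfg (ctl .rewind) (idle v) S { A with past := p })
      (checkCfg (ctl .gather) (idle v) S { A with past := [], fut := p.reverse ++ A.fut }) := by
  induction p generalizing A with
  | nil => exact .head (rewind_nil v S A) (.refl 0 _)
  | cons b p ih =>
    refine .head (rewind_cons v S A b p) ?_
    simpa using ih { A with fut := b :: A.fut }

theorem reach_next_some {p p' : List Bool} (h : nextCoins p = some p') :
    ReachIn (p.length + 1)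
      (checkCfg (ctl .next) (idle v) S { A with past := p, fut := [] })
      (checkCfg (ctl .gather) (idle v) S { A with past := [], fut := p' }) := by
  induction p with
  | nil => cases h
  | cons b p ih =>
    cases b
    · obtain rfl := Option.some.inj h
      exact .head (next_false v S { A with fut := [] } p)
        (reach_rewind v S { A with fut := [true] } p)
    · exact .head (next_true v S { A with fut := [] } p) (ih h)

theorem reach_next_none {p : List Bool} (h : nextCoins p = none) :
    ReachIn (p.length + 1)
      (checkCfg (ctl .next) (idle v) S { A with past := p })
      (checkCfg (ctl .finish) ⟨v, none, false, false, false, true⟩ S { A with past := [] }) := by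
  induction p with
  | nil => exact .head (next_nil v S A) (.refl _ _)
  | cons b p ih =>
    cases b
    · cases h
    · exact .head (next_true v S A p) (ih h)

end PhaseSteps

/-! ### The simulation of all runs -/

/-- The stacks of the checker, besides those of the simulated machine, during the run on `x` with
the answers in the table `ts` and the coins `p`, after `n` coin tosses. -/
def runAux (x : List Bool) (ts : List Symb) (p : List Bool) (n : ℕ) : CheckAux :=
  ⟨[], [], x, ts, [], [], [], p.drop n, ((List.range n).map (padCoins p)).reverse, []⟩

theorem reach_step (x : List Bool) (ts : List Symb) (p : List Bool) {B : ℕ} (c : M.Cfg)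
    (hc : c.cfg.l ≠ none) (hB : (c.cfg.stk M.tm.k₁).length ≤ B) :
    ReachIn ((ts.length + 2) * (2 * B + 4)) (simCfg (runAux x ts p c.coins) c.cfg)
      (simCfg (runAux x ts p (M.step (tableWord ts) (padCoins p) c).coins)
        (M.step (tableWord ts) (padCoins p) c).cfg) := by
  obtain ⟨⟨_ | l, v, S⟩, a, b⟩ := c
  · exact absurd rfl hc
  have h1 : 1 ≤ (ts.length + 2) * (2 * B + 4) := Nat.mul_pos (by omega) (by omega)
  cases hk : M.kind l
  · rw [OracleTM.step_plain _ _ v S a b hk]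
    exact ⟨1, h1, plain_step l v S _ hk⟩
  · rw [OracleTM.step_toss _ _ v S a b hk]
    refine ⟨1, h1, (toss_step l v S (runAux x ts p a) hk (p.drop a)).trans ?_⟩
    have h₁ : (p.drop a).headD false = padCoins p a := by
      simp [padCoins, List.headD_eq_head?_getD]
    have h₂ : (p.drop a).tail = p.drop (a + 1) := by simp
    rw [h₁, h₂]
    simp [runAux, List.range_succ]
  · rw [OracleTM.step_query _ _ v S a b hk]
    refine (reach_query l v hk S (runAux x ts p a) rfl rfl rfl).mono ?_
    exact Nat.mul_le_mul_left _ (by simp only at hB; omega)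

theorem reach_run (x : List Bool) (ts : List Symb) (p : List Bool) {B T : ℕ}
    (hB : x.length + T * M.stackGrowth ≤ B) :
    ReachIn (T * ((ts.length + 2) * (2 * B + 4)))
      (simCfg (runAux x ts p 0) (initList M.tm (x.map M.inputAlphabet.symm)))
      (simCfg (runAux x ts p (M.run x (tableWord ts) (padCoins p) T).coins)
        (M.run x (tableWord ts) (padCoins p) T).cfg) := by
  induction T with
  | zero => exact .refl _ _
  | succ T ih =>
    rw [Nat.add_mul T 1, Nat.one_mul] at hB
    have ih := ih (by omega)
    rw [M.run_succ]
    by_cases h : (M.run x (tableWord ts) (padCoins p) T).cfg.l = none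
    · rw [M.step_of_halted _ _ h]
      exact ih.mono (Nat.mul_le_mul_right _ (Nat.le_succ T))
    · refine (ih.trans (reach_step x ts p (B := B) _ h ((M.length_stk_run_le _ _ _ _ _).trans
        (by omega)))).mono ?_
      rw [Nat.add_mul T 1, Nat.one_mul]

/-- The configuration in which the run with the coins `p` is about to begin. -/
def startCfg (v : M.tm.σ) (x : List Bool) (ts : List Symb) (p : List Bool) : CheckCfg M :=
  checkCfg (ctl .spread) (idle v) (fun _ => []) ⟨[], x.reverse, [], ts, [], [], [], p, [], []⟩

open Classical in
/-- The checker runs through the coin strings in increasing order: each run that accepts, having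
tossed the coins `u`, settles all strings that start with `u`. -/
theorem reach_verdict (x : List Bool) (ts : List Symb) {r T N : ℕ}
    (hr : ∀ R t, (M.run x (tableWord ts) R t).coins ≤ r)
    (hT : ∀ R, (M.run x (tableWord ts) R T).cfg.l = none)
    (hN : x.length + T * M.stackGrowth + ts.length + r ≤ N)
    (m : ℕ) (v : M.tm.σ) (p : List Bool) (hp : p.length ≤ r)
    (hm : 2 ^ r - coinVal r (padCoins p) ≤ m) :
    ReachIn (m * (T * ((ts.length + 2) * (2 * N + 4)) + 4 * (N + 1)))
      (startCfg v x ts p)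
      (haltList (checker M) [decide (∀ R, coinVal r (padCoins p) ≤ coinVal r R →
        M.Accepts x (tableWord ts) R)]) := by
  induction m generalizing v p with
  | zero =>
    have := coinVal_lt r (padCoins p)
    omega
  | succ m ih =>
    set w := tableWord ts with hw
    have h₁ : ReachIn (x.length + 1) (startCfg v x ts p)
        (simCfg (runAux x ts p 0) (initList M.tm (x.map M.inputAlphabet.symm))) := by
      have e : initList M.tm (x.map M.inputAlphabet.symm) = ⟨some M.tm.main, M.tm.initialState,
          Function.update (fun _ => []) M.tm.k₀ (x.map M.inputAlphabet.symm)⟩ :=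
        cfg_ext rfl rfl (congrFun (initList_stk _ _))
      rw [e]
      have := reach_spread v (fun _ => []) ⟨[], [], [], ts, [], [], [], p, [], []⟩ x.reverse
      simpa [startCfg, runAux, simCfg] using this
    have h₂ := h₁.trans (reach_run (T := T) x ts p (B := N) (by omega))
    have hc := hr (padCoins p) T
    have hacc := M.accepts_iff_of_halted x w (padCoins p) (hT (padCoins p))
    have hstk := M.length_stk_run_le x w (padCoins p) T
    have hl := hT (padCoins p)
    rw [← hw] at h₂
    set n := (M.run x w (padCoins p) T).coins with hn
    set P := ((List.range n).map (padCoins p)).reverse with hP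
    have hPlen : P.length = n := by simp [hP]
    have hfut : (p.drop n).length ≤ r := by simp; omega
    have hPrev : P.reverse = (List.range n).map (padCoins p) := by simp [hP]
    -- all coin strings in the interval that starts with this run give the same run
    have hsame : ∀ R, coinVal r (padCoins p) ≤ coinVal r R →
        coinVal r R < coinVal r (padCoins P.reverse) + 2 ^ (r - P.length) →
        (M.Accepts x w R ↔ M.Accepts x w (padCoins p)) := by
      intro R hR₁ hR₂
      have hpre := coinVal_prefix (padCoins p) hc
      rw [← hPrev] at hpre
      have hu : P.reverse.length = n := by simp [hP]
      have heq := eq_of_coinVal (r := r) (u := P.reverse) (by omega) (hpre.1.trans hR₁)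
        (by rwa [List.length_reverse])
      have hrun : M.run x w R T = M.run x w (padCoins p) T := by
        refine M.run_congr x w fun i hi => ?_
        have hi : i < n := hi
        rw [heq i (by omega), hPrev]
        simp [padCoins, List.getD, hi]
      rw [M.accepts_iff_of_halted x w R (hT R), hrun, hacc]
    generalize (M.run x w (padCoins p) T).cfg = c at h₂ hl hstk hacc
    obtain ⟨l, v', S⟩ := c
    obtain rfl : l = none := hl
    have h₂ : ReachIn _ _ (checkCfg (if M.accept v' then ctl .clear else ctl .finish) (idle v') S
      (runAux x ts p n)) := h₂
    dsimp only at hstk hacc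
    rw [Nat.add_mul m 1, Nat.one_mul]
    by_cases ha : M.accept v' = true
    · rw [if_pos ha] at h₂
      have hyes := hacc.2 ha
      have h₃ := h₂.trans (reach_clear v' S (runAux x ts p n) (N := N)
        (fun k => (hstk k).trans (by omega)) (hfut.trans (by omega)))
      cases hnext : nextCoins P with
      | none =>
        have h₄ := reach_next_none v' (fun _ => []) { runAux x ts p n with fut := [] } hnext
        have h₅ := reach_finish v' true (fun _ => []) { runAux x ts p n with fut := [], past := [] }
          (N := N) (fun _ => Nat.zero_le _) (by
            intro j
            cases j <;> simp [CheckAux.stk, runAux] <;> omega)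
        have hlast := nextCoins_none (r := r) (by omega) hnext
        rw [decide_eq_true fun R hR => (hsame R hR (by
          have := coinVal_lt r R
          omega)).2 hyes]
        exact ((h₃.trans h₄).trans h₅).mono (by omega)
      | some p' =>
        obtain ⟨hlen', hval⟩ := nextCoins_some (r := r) (by omega) hnext
        have hpre := coinVal_prefix (padCoins p) hc
        rw [← hPrev, ← hPlen, ← hval] at hpre
        have h₄ := reach_next_some v' (fun _ => []) (runAux x ts p n) hnext
        have h₅ := reach_gather v' (fun _ => []) ⟨[], [], [], ts, [], [], [], p', [], []⟩ x
        rw [List.append_nil] at h₅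
        have h₆ := ih v' p' (by omega) (by omega)
        have hiff : (∀ R, coinVal r (padCoins p) ≤ coinVal r R → M.Accepts x w R) ↔
            ∀ R, coinVal r (padCoins p') ≤ coinVal r R → M.Accepts x w R := by
          refine ⟨fun h R hR => h R (by omega), fun h R hR => ?_⟩
          rcases lt_or_ge (coinVal r R) (coinVal r (padCoins p')) with hlt | hge
          · exact (hsame R hR (by omega)).2 hyes
          · exact h R hge
        rw [decide_eq_decide.2 hiff]
        exact (((h₃.trans h₄).trans h₅).trans h₆).mono (by omega)
    · rw [if_neg ha] at h₂
      have h₃ := reach_finish v' false S (runAux x ts p n) (N := N)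
        (fun k => (hstk k).trans (by omega)) (by
          intro j
          cases j <;> simp [CheckAux.stk, runAux] <;> omega)
      rw [decide_eq_false fun h => ha (hacc.1 (h _ le_rfl))]
      exact (h₂.trans h₃).mono (by omega)

end Checker

end Checker

/-! ### PCP languages are in NP -/

section Checker

variable {M : OracleTM}

open Checker in
open Classical in
/-- If `M` runs in polynomial time and has polynomially many coin strings, a table of oracle
answers can be checked in polynomial time. -/
theorem polyTimeComputable_checker {r : ℕ → ℕ} {T : Polynomial ℕ}
    (hr : ∀ x w R t, (M.run x w R t).coins ≤ r x.length)
    (hr' : PolyBounded fun n => 2 ^ r n)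
    (hT : ∀ x w R, (M.run x w R (T.eval x.length)).cfg.l = none) :
    PolyTimeComputable encodePair encodeBool fun a : List Bool × List Bool =>
      decide (∀ R, M.Accepts a.1 (tableWord (pairUp a.2).reverse) R) := by
  obtain ⟨p, hp⟩ := hr'
  let N : Polynomial ℕ := .X + T * .C M.stackGrowth + .X + p
  let time : Polynomial ℕ := (.X + 1) + p * (T * ((.X + 2) * (2 * N + 4)) + 4 * (N + 1))
  refine ⟨⟨⟨checker M, Equiv.refl _, Equiv.refl _⟩, time, fun a => ?_⟩⟩
  refine Nonempty.some ?_
  obtain ⟨x, w⟩ := a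
  set ts := (pairUp w).reverse with hts
  have henc : encodePair (x, w) = x.map .inl ++ w.map .inr := by
    simp [encodePair, encodingProd, encodingList]
  have hlen : (encodePair (x, w)).length = x.length + w.length := by simp [henc]
  have htslen : ts.length ≤ w.length := by simpa [hts] using length_pairUp_le w
  have hp' : 2 ^ r x.length ≤ p.eval (x.length + w.length) :=
    (hp x.length).trans (eval_le_eval p (Nat.le_add_right x.length w.length))
  have hTle := eval_le_eval T (Nat.le_add_right x.length w.length)
  have hrle : r x.length ≤ p.eval (x.length + w.length) := Nat.lt_two_pow_self.le.trans hp'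
  have hNval : N.eval (x.length + w.length) = (x.length + w.length) +
      T.eval (x.length + w.length) * M.stackGrowth + (x.length + w.length) +
      p.eval (x.length + w.length) := by simp [N]
  have hTmul := Nat.mul_le_mul_right M.stackGrowth hTle
  have h₁ := reach_parse M.tm.initialState (fun _ => []) ⟨[], [], [], [], [], [], [], [], [], []⟩
    x w
  have h₂ := reach_verdict x ts (N := N.eval (x.length + w.length)) (hr x _) (hT x _)
    (by omega) (p.eval (x.length + w.length)) M.tm.initialState [] (Nat.zero_le _) (by omega)
  simp only [List.append_nil] at h₁
  obtain ⟨n, hn, hrun⟩ := h₁.trans h₂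
  have hinit : initList (checker M) (encodePair (x, w)) =
      checkCfg (ctl .parse) (idle M.tm.initialState) (fun _ => [])
        ⟨x.map .inl ++ w.map .inr, [], [], [], [], [], [], [], [], []⟩ := by
    rw [henc]
    refine cfg_ext rfl rfl fun k => (congrFun (initList_stk (checker M) _) k).trans ?_
    rcases k with k | j
    · rfl
    · cases j <;> rfl
  rw [← hinit] at hrun
  obtain ⟨e⟩ := exists_evalsToInTime _ hrun
  have htime : n ≤ time.eval (encodePair (x, w)).length := by
    rw [← add_assoc] at hn
    refine hn.trans ?_
    rw [hlen]
    simp only [time, Polynomial.eval_add, Polynomial.eval_mul, Polynomial.eval_X,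
      Polynomial.eval_one, Polynomial.eval_ofNat]
    gcongr
    omega
  simp only [coinVal_nil, Nat.zero_le, forall_const] at e
  have e₁ : (encodePair (x, w)).map (Equiv.refl (Bool ⊕ Bool)).invFun = encodePair (x, w) :=
    List.map_id _
  have : Nonempty (TM2OutputsInTime (checker M) (encodePair (x, w))
      (some [decide (∀ R, M.Accepts x (tableWord ts) R)])
      (time.eval (encodePair (x, w)).length)) :=
    ⟨⟨e.toEvalsTo, e.steps_le_m.trans htime⟩⟩
  exact (congrArg (fun s => Nonempty (TM2OutputsInTime (checker M) s
    (some [decide (∀ R, M.Accepts x (tableWord ts) R)]) _)) e₁).mpr this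

end Checker

namespace OracleTM

variable (M : OracleTM)

theorem step_congr_word {w w' : List Bool} {R : ℕ → Bool} {c : M.Cfg}
    (h : w.getD (M.queryPosition (c.cfg.stk M.tm.k₁)) false =
      w'.getD (M.queryPosition (c.cfg.stk M.tm.k₁)) false) :
    M.step w R c = M.step w' R c := by
  unfold step
  rw [h]

theorem queryPosition_lt (s : List (M.tm.Γ M.tm.k₁)) : M.queryPosition s < 2 ^ s.length := by
  have := bitsVal_lt (s.map M.queryAlphabet)
  simpa [queryPosition, bitsVal, Function.comp_def] using this

/-- The positions on the query stack in the first `T` steps of the runs of `M` with `k` coins. A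
position is listed for every step, whether it makes a query or not. -/
noncomputable def positions (x w : List Bool) (k T : ℕ) : List ℕ :=
  (Finset.univ : Finset (Fin k → Bool)).toList.flatMap fun R =>
    (List.range T).map fun t => M.queryPosition ((M.run x w (padBits R) t).cfg.stk M.tm.k₁)

/-- The table of the answers of the witness at these positions. -/
noncomputable def answers (x w : List Bool) (k T : ℕ) : List Symb :=
  (M.positions x w k T).flatMap fun m => tableEntry m (w.getD m false)

theorem length_answers_le (x w : List Bool) (k T : ℕ) :
    (M.answers x w k T).length ≤ 2 ^ k * T * (x.length + T * M.stackGrowth + 1) := by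
  have hlen : (M.positions x w k T).length ≤ 2 ^ k * T := by
    refine (length_flatMap_le (c := T) fun R _ => by simp).trans ?_
    simp
  refine (length_flatMap_le (c := x.length + T * M.stackGrowth + 1) ?_).trans
    (Nat.mul_le_mul_right _ hlen)
  intro m hm
  refine length_tableEntry_le _ ?_
  simp only [positions, List.mem_flatMap, List.mem_map, List.mem_range] at hm
  obtain ⟨R, -, t, ht, rfl⟩ := hm
  refine (M.queryPosition_lt _).trans_le (Nat.pow_le_pow_right (by omega) ?_)
  refine (M.length_stk_run_le x w _ t _).trans ?_
  have := Nat.mul_le_mul_right M.stackGrowth ht.le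
  omega

theorem run_answers (x w : List Bool) {k T : ℕ} (R : Fin k → Bool) {t : ℕ} (ht : t ≤ T) :
    M.run x (tableWord (M.answers x w k T)) (padBits R) t = M.run x w (padBits R) t := by
  induction t with
  | zero => rfl
  | succ t ih =>
    rw [run_succ, run_succ, ih (by omega)]
    refine M.step_congr_word ?_
    rw [tableWord_getD]
    refine lookup_flatMap_tableEntry w _ ?_
    simp only [positions, List.mem_flatMap, List.mem_map, List.mem_range, Finset.mem_toList,
      Finset.mem_univ, true_and]
    exact ⟨R, t, by omega, rfl⟩

end OracleTM

/-- A language in `PCP[O(log n), O(1)]` is in NP: there are polynomially many coin strings, and an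
NP witness lists the answers to all queries that can occur. -/
theorem mem_NP_of_mem_PCPLogConst {L : Language Bool} (h : L ∈ PCPLogConst) : L ∈ NP := by
  classical
  obtain ⟨r, q, hr, -, M, ⟨T, hT⟩, hres, hM⟩ := h
  obtain ⟨d, hd⟩ := isBigOLog_iff.1 hr
  have hpow := polyBounded_two_pow hd
  have hcoins : ∀ x w R t, (M.run x w R t).coins ≤ r x.length := fun x w R t => (hres x w R t).1
  have hcongr : ∀ x w R, M.Accepts x w (OracleTM.padBits fun i : Fin (r x.length) => R i) ↔
      M.Accepts x w R := fun x w R =>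
    M.accepts_congr x w (hcoins x w) fun i hi => padBits_of_lt hi R
  obtain ⟨p, hp⟩ := (PolyBounded.const 2).mul ((hpow.mul (PolyBounded.eval T)).mul
    ((PolyBounded.id.add ((PolyBounded.eval T).mul (PolyBounded.const M.stackGrowth))).add
      (PolyBounded.const 1)))
  refine ⟨_, polyTimeComputable_checker hcoins hpow hT, p, fun x => ⟨fun hx => ?_, ?_⟩⟩
  · obtain ⟨w, hw⟩ := (hM x).1 hx
    rw [acceptProb_eq_bitProb] at hw
    have hall := forall_of_bitProb_eq_one hw
    set ts := M.answers x w (r x.length) (T.eval x.length) with hts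
    refine ⟨symbolBits ts.reverse, ?_, ?_⟩
    · refine le_trans ?_ (hp x.length)
      rw [length_symbolBits, List.length_reverse]
      exact Nat.mul_le_mul_left 2 (M.length_answers_le _ _ _ _)
    · rw [decide_eq_true_iff, pairUp_symbolBits, List.reverse_reverse]
      intro R
      rw [← hcongr, M.accepts_iff_of_halted _ _ _ (hT x _ _), hts, M.run_answers x w _ le_rfl,
        ← M.accepts_iff_of_halted _ _ _ (hT x _ _)]
      exact hall _
  · rintro ⟨w, -, hw⟩
    rw [decide_eq_true_iff] at hw
    by_contra hx
    have := (hM x).2 hx (tableWord (pairUp w).reverse)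
    rw [acceptProb_eq_bitProb, bitProb_of_forall hw] at this
    norm_num at this

end Complexity

theorem theorem3 :
    ∃ C : ℝ, ∀ (L : Language Bool) (ε : ℝ), L ∈ Complexity.NP → 0 < ε →
      (∃ f : List Bool → Complexity.ThreeCNF, Complexity.IsGapReduction L ε f) →
        (∃ r q : ℕ → ℕ, Complexity.IsBigOLog r ∧ (∀ n, (q n : ℝ) ≤ C / ε) ∧
          L ∈ Complexity.PCP r q) ∧
        L ∈ Complexity.PCPLogConst ∧
        (Complexity.NPComplete L → Complexity.NP = Complexity.PCPLogConst) := by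
  refine ⟨12, fun L ε _ hε ⟨f, hf⟩ => ?_⟩
  obtain ⟨r, q, hr, hq, hL⟩ := Complexity.exists_PCP_of_isGapReduction hε hf
  have hL' : L ∈ Complexity.PCPLogConst :=
    ⟨r, q, hr, Complexity.isBigOOne_iff.2 ⟨⌈12 / ε⌉₊, fun n => by
      exact_mod_cast (hq n).trans (Nat.le_ceil _)⟩, hL⟩
  exact ⟨⟨r, q, hr, hq, hL⟩, hL', fun h => Set.Subset.antisymm
    (fun L' hL₁ => Complexity.mem_PCPLogConst_of_reducesTo (h.1 L' hL₁) hL')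
    fun _ => Complexity.mem_NP_of_mem_PCPLogConst⟩
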